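/- **Notation.** For $h\in L^2(0,\infty)$ let $\tilde h(i\tau)=\int_0^\infty e^{-i\tau t}h(t)\,dt$ (in the sense of Plancherel) be the boundary value of its Laplace transform on the imaginary axis. Put $\nu_1(\beta)=\frac1\pi\beta\,\tilde h(-i\beta^2)$ and $\nu_2(\beta)=\frac1\pi\beta\,\tilde h(i\beta^2)$ for $\beta\ge 0$, and $\nu_1(\beta)=\nu_2(\beta)=0$ for $\beta<0$. The boundary integral operator of the half-line problem $iu_t+u_{xx}=0$, $u(x,0)=0$, $u(0,t)=h(t)$, extended to all $x\in\mathbb R$, is $$[W_{bdr}(t)h](x)=\int_{-\infty}^{\infty}e^{-i\beta^2t+i\beta x}\nu_1(\beta)\,d\beta+\int_{-\infty}^{\infty}e^{i\beta^2t-\beta|x|}\nu_2(\beta)\,d\beta ,$$ where the first integral is, for each $t$, understood in the sense of Plancherel in $x$. A pair $(q,r)$ with $2\le q,r\le\infty$ is *admissible* if $\frac1q+\frac1{2r}=\frac14$. For $0\le s<1$, $W^{s,r}(\mathbb R)$ is the Bessel potential space $\{f\in L^r:(1-\partial_x^2)^{s/2}f\in L^r\}$ (so $W^{0,r}=L^r$),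 and $W^{1,r}(\mathbb R)=\{f\in L^r: f'\in L^r\}$; $H^s(\mathbb R)=W^{s,2}(\mathbb R)$. For an open interval $I$, $H^\sigma(I)$ is the space of restrictions to $I$ of elements of $H^\sigma(\mathbb R)$, with the quotient norm; $H^\sigma_0(\mathbb R^+)$ is the closure of $C_c^\infty(0,\infty)$ in $H^\sigma(\mathbb R^+)$. **Proposition.** Let $0\le s\le 1$ with $s\ne\frac12$, let $T>0$, and let $(q,r)$ be an admissible pair. There is a constant $C>0$ such that for every $h\in H^{\frac{2s+1}4}_0(\mathbb R^+)$ the function $t\mapsto\|W_{bdr}(t)h\|_{W^{s,r}(\mathbb R)}$ is measurable on $(0,T)$ and $$\|W_{bdr}(\cdot)h\|_{L^q(0,T;W^{s,r}(\mathbb R))}\le C\,\|h\|_{H^{\frac{2s+1}4}(\mathbb R^+)},$$ $$\sup_{0<t<T}\|W_{bdr}(t)h\|_{H^s(\mathbb R)}\le C\,\|h\|_{H^{\frac{2s+1}4}(\mathbb R^+)},$$ $$\sup_{x\in\mathbb R}\|[W_{bdr}(\cdot)h](x)\|_{H^{\frac{2s+1}4}_t(0,T)}\le C\,\|h\|_{H^{\frac{2s+1}4}(\mathbb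 R^+)},$$ where the temporal trace $[W_{bdr}(\cdot)h](x)$ at a point $x\in\mathbb R$ is the limit in $L^2(0,T)$, as $\delta\to0^+$, of the averages $\frac1{2\delta}\int_{x-\delta}^{x+\delta}[W_{bdr}(\cdot)h](y)\,dy$; the existence of this limit for every $x$ is part of the assertion. -/

import Mathlib

open MeasureTheory Set Filter Topology
open scoped ENNReal NNReal FourierTransform ContDiff

noncomputable section

namespace HalfLineNLS

/-! ### Sobolev norms

All norms are valued in `ℝ≥0∞`, with the value `∞` for functions outside the space. -/

/-- The Bessel potential norm of order `s` and exponent `r` on the line: it is finite exactly when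
`f ∈ L^r` and the tempered distribution `J^s f` is a function `v ∈ L^r`, and is then `‖v‖_{L^r}`.
For `r = 2` this is the norm of `H^s(ℝ)`. -/
def besselNorm (s : ℝ) (r : ℝ≥0∞) (f : ℝ → ℂ) : ℝ≥0∞ :=
  ⨅ (_ : Fact (1 ≤ r)) (F : Lp ℂ r (volume : Measure ℝ)) (_ : F =ᵐ[volume] f)
    (v : Lp ℂ r (volume : Measure ℝ))
    (_ : TemperedDistribution.besselPotential ℝ ℂ s (F : TemperedDistribution ℝ ℂ) =
      (v : TemperedDistribution ℝ ℂ)),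
    eLpNorm v r volume

/-- The norm of `H^s(Ω)`, as the quotient (restriction) norm of `H^s(ℝ)`. -/
def hNormOn (s : ℝ) (Ω : Set ℝ) (f : ℝ → ℂ) : ℝ≥0∞ :=
  ⨅ (g : ℝ → ℂ) (_ : g =ᵐ[volume.restrict Ω] f), besselNorm s 2 g

/-- `g` is the weak derivative of `f` on the line. -/
def IsWeakDeriv (f g : ℝ → ℂ) : Prop :=
  ∀ φ : ℝ → ℂ, ContDiff ℝ ∞ φ → HasCompactSupport φ →
    ∫ x, f x * deriv φ x = -∫ x, g x * φ x

/-- The norm `‖f‖_{L^r} + ‖f'‖_{L^r}` of the classical Sobolev space `W^{1,r}(ℝ)`. -/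
def firstOrderNorm (r : ℝ≥0∞) (f : ℝ → ℂ) : ℝ≥0∞ :=
  ⨅ (_ : MemLp f r volume) (g : ℝ → ℂ) (_ : MemLp g r volume) (_ : IsWeakDeriv f g),
    eLpNorm f r volume + eLpNorm g r volume

open Classical in
/-- The norm of `W^{s,r}(ℝ)`, for `0 ≤ s ≤ 1`: the classical space at the integer orders
(at `s = 0` the Bessel potential norm is the `L^r` norm), the Bessel potential space in between.
The separate clause at `s = 1` is an equivalent renorming if `1 < r < ∞`, and makes `W^{1,∞}` the
space of functions which are bounded together with their weak derivative. -/
def sobolevNorm (s : ℝ) (r : ℝ≥0∞) (f : ℝ → ℂ) : ℝ≥0∞ :=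
  if s = 1 then firstOrderNorm r f else besselNorm s r f

/-- `h` belongs to `H^s_0(ℝ⁺)`, the closure in `H^s(ℝ⁺)` of the smooth functions with compact
support in `(0, ∞)`. Only the values of `h` on `(0, ∞)` matter. -/
def MemHZero (s : ℝ) (h : ℝ → ℂ) : Prop :=
  hNormOn s (Ioi 0) h < ⊤ ∧
    ∀ ε : ℝ≥0∞, 0 < ε → ∃ φ : ℝ → ℂ, ContDiff ℝ ∞ φ ∧ HasCompactSupport φ ∧
      tsupport φ ⊆ Ioi 0 ∧ hNormOn s (Ioi 0) (h - φ) < ε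

/-- Admissible pairs of exponents; `r = ∞` (with `q = 4`) and `q = ∞` (with `r = 2`) are included. -/
def Admissible (q r : ℝ≥0∞) : Prop :=
  2 ≤ q ∧ 2 ≤ r ∧ 1 / q + 1 / (2 * r) = 1 / 4

/-! ### The boundary integral operator -/

open Classical in
/-- The integral `∫ e^{iβx} G(β) dβ` in the sense of Plancherel, for `G ∈ L²(ℝ)`: a representative
of a class in `L²(ℝ)`. -/
def planchIntegral (G : ℝ → ℂ) (x : ℝ) : ℂ :=
  if hG : MemLp G 2 volume then
    (𝓕⁻ (hG.toLp G) : Lp ℂ 2 (volume : Measure ℝ)) (x / (2 * Real.pi))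
  else 0

/-- The boundary value `∫_0^∞ e^{-iτt} h(t) dt` on the imaginary axis, at `iτ`, of the Laplace
transform of `h`. -/
def laplaceBdry (h : ℝ → ℂ) (τ : ℝ) : ℂ :=
  planchIntegral ((Ioi (0 : ℝ)).indicator h) (-τ)

/-- `ν₁(β) = π⁻¹ β h̃(-iβ²)` for `β ≥ 0`, and `0` for `β < 0`. -/
def nuOne (h : ℝ → ℂ) (β : ℝ) : ℂ :=
  if 0 ≤ β then (1 / Real.pi : ℂ) * β * laplaceBdry h (-β ^ 2) else 0

/-- `ν₂(β) = π⁻¹ β h̃(iβ²)` for `β ≥ 0`, and `0` for `β < 0`. -/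
def nuTwo (h : ℝ → ℂ) (β : ℝ) : ℂ :=
  if 0 ≤ β then (1 / Real.pi : ℂ) * β * laplaceBdry h (β ^ 2) else 0

/-- `[W_{b,1}(t)h](x) = ∫ e^{-iβ²t + iβx} ν₁(β) dβ`: the free Schrödinger evolution on the line of
the function with Fourier transform `ν₁`. -/
def wbOne (h : ℝ → ℂ) (t x : ℝ) : ℂ :=
  planchIntegral (fun β : ℝ => Complex.exp (-Complex.I * β ^ 2 * t) * nuOne h β) x

/-- `[W_{b,2}(t)h](x) = ∫ e^{iβ²t - β|x|} ν₂(β) dβ`, extended to `x < 0` through `|x|`. -/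
def wbTwo (h : ℝ → ℂ) (t x : ℝ) : ℂ :=
  ∫ β : ℝ, Complex.exp (Complex.I * β ^ 2 * t - β * |x|) * nuTwo h β

/-- The boundary integral operator `[W_bdr(t)h](x) = [W_{b,1}(t)h](x) + [W_{b,2}(t)h](x)`. -/
def wBdr (h : ℝ → ℂ) (t x : ℝ) : ℂ :=
  wbOne h t x + wbTwo h t x

/-- `g` is the trace at `x`, over the time interval `(0,T)`, of the curve `t ↦ U t` of functions
on the line: the averages of `U t` over `(x - δ, x + δ)` converge to `g t` in `L²(0,T)` as `δ → 0`.
The trace is unique up to null sets, and equals `t ↦ U t x` if `U` is continuous and bounded. -/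
def IsTemporalTrace (T : ℝ) (U : ℝ → ℝ → ℂ) (x : ℝ) (g : ℝ → ℂ) : Prop :=
  Tendsto (fun δ : ℝ => eLpNorm (fun t => (⨍ y in Ioo (x - δ) (x + δ), U t y) - g t) 2
    (volume.restrict (Ioo 0 T))) (𝓝[>] 0) (𝓝 0)

end HalfLineNLS

end

noncomputable section

namespace HalfLineNLS

open scoped SchwartzMap ComplexConjugate

/-! Everything is measured on the Fourier side. Put σ = (2s+1)/4, so that 1/4 ≤ σ ≤ 3/4, with σ =
1/2 exactly when s = 1/2. The Laplace transform on the imaginary axis is, up to scaling, the Fourier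
transform of the extension of h by zero. The substitution τ = β² turns the weighted L² norms of ν₁
and ν₂ of order s into a weighted L² norm of that transform of order σ: the Jacobian 2β absorbs one
of the two factors β coming from |ν|², and the other accounts for the extra 1/4 in σ. The data enter
only through the bound of the extension by zero from H^σ_0(ℝ⁺) to H^σ(ℝ), which is where σ ≠ 1/2 is
used. For test functions it follows from the Gagliardo form of the seminorm and a fractional Hardy
inequality (`fractional_hardy`). The Hardy inequality holds because dilation by a multiplies the
weighted norm by a^(σ-1/2), a factor different from 1.

The first half of the operator is a free Schrödinger evolution. Its L^∞L² bound is Plancherel. Its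
L⁴L^∞ bound is a TT* argument: the supremum in x is linearised by a measurable choice of positions
X(t), the Gaussian-regularised kernel decays like |t - τ|^(-1/2), and the quadratic
Hardy–Littlewood–Sobolev inequality closes the estimate. The other admissible pairs lie between
these two endpoints.

The second half is a Laplace integral in x. The Fourier transform of e^{-β|x|} is the Poisson
kernel, and Schur's test for superpositions of dilations gives the H^s bound. For L⁴L^∞, the Cauchy
representation e^{-β|x|} = ∫ e^{iβηx} dη / (π(1+η²)) shows the integral to be an average over η of
time-reversed free evolutions evaluated at ηx. A supremum over x does not see the dilation by η, so
the free estimate applies for each η. The Bessel weight of order s costs (1+η²)^{s/2} in the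
average, which stays integrable only for s < 1. At s = 1 the weak derivative of e^{-β|x|} is, up to
sign, β e^{-β|x|}, which leads back to order 0 with the density βν.

In the time variable, the two halves occupy the frequencies τ ≤ 0 and τ > 0. The trace at x is
therefore one Fourier integral in t, of the Laplace transform times a multiplier bounded by 1
(`exists_isTemporalTrace`), so its H^σ norm is at most that of the extension by zero, uniformly in
x. -/

/-- `g` is the Fourier transform of `f`, both being square integrable functions on the line. -/
structure IsFourierPair (f g : ℝ → ℂ) : Prop where
  memLp_left : MemLp f 2 volume
  memLp_right : MemLp g 2 volume
  fourier_eq : 𝓕 (memLp_left.toLp f) = memLp_right.toLp g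

/-! ### Dilations of the line and testing against Schwartz functions -/

theorem lintegral_comp_const_mul (F : ℝ → ℝ≥0∞) {a : ℝ} (ha : a ≠ 0) :
    ∫⁻ x, F (a * x) = ENNReal.ofReal |a⁻¹| * ∫⁻ x, F x := by
  have := (Homeomorph.mulLeft₀ a ha).measurableEmbedding.lintegral_map F (μ := volume)
  simp only [Homeomorph.coe_mulLeft₀, Real.map_volume_mul_left ha, lintegral_smul_measure,
    smul_eq_mul] at this
  exact this.symm

theorem MemLp.comp_const_mul {f : ℝ → ℂ} {p : ℝ≥0∞} (hf : MemLp f p volume) {a : ℝ} (ha : a ≠ 0) :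
    MemLp (fun x ↦ f (a * x)) p volume := by
  have := (Homeomorph.mulLeft₀ a ha).measurableEmbedding.memLp_map_measure_iff (μ := volume)
    (g := f) (p := p)
  rw [Homeomorph.coe_mulLeft₀, Real.map_volume_mul_left ha] at this
  exact this.1 (hf.smul_measure ENNReal.ofReal_ne_top)

theorem ae_eq_of_forall_schwartz_integral_eq {f g : ℝ → ℂ} (hf : LocallyIntegrable f volume)
    (hg : LocallyIntegrable g volume) (h : ∀ φ : 𝓢(ℝ, ℂ), ∫ x, φ x * f x = ∫ x, φ x * g x) :
    f =ᵐ[volume] g := by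
  refine ae_eq_of_integral_contDiff_smul_eq hf hg fun φ hφ hc ↦ ?_
  have h₁ : HasCompactSupport (Complex.ofRealCLM ∘ φ) := hc.comp_left rfl
  have h₂ : ContDiff ℝ ∞ (Complex.ofRealCLM ∘ φ) := by fun_prop
  simpa using h (h₁.toSchwartzMap h₂)

theorem integral_schwartz_mul_toLp {p : ℝ≥0∞} {f : ℝ → ℂ} (hf : MemLp f p volume) (φ : 𝓢(ℝ, ℂ)) :
    ∫ x, φ x * hf.toLp f x = ∫ x, φ x * f x :=
  integral_congr_ae <| by filter_upwards [hf.coeFn_toLp] with x hx; rw [hx]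

/-! ### Calculus of Fourier pairs in L² -/

namespace IsFourierPair

variable {f g f' g' : ℝ → ℂ}

theorem integral_fourier_mul (h : IsFourierPair f g) (φ : 𝓢(ℝ, ℂ)) :
    ∫ x, 𝓕 φ x * f x = ∫ x, φ x * g x := by
  have := congrArg (fun u : TemperedDistribution ℝ ℂ ↦ u φ)
    (Lp.fourier_toTemperedDistribution_eq (h.memLp_left.toLp f))
  simpa [h.fourier_eq, integral_schwartz_mul_toLp] using this

theorem integral_fourierInv_mul (h : IsFourierPair f g) (φ : 𝓢(ℝ, ℂ)) :
    ∫ x, 𝓕⁻ φ x * g x = ∫ x, φ x * f x := by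
  rw [← h.integral_fourier_mul, FourierTransform.fourier_fourierInv_eq]

/-- The Plancherel transform of an L² function is its transform as a tempered distribution, so
pairings with Schwartz functions determine it almost everywhere. Translations, dilations and Laplace
integrals are all treated by this criterion. -/
theorem of_integral (hf : MemLp f 2 volume) (hg : MemLp g 2 volume)
    (h : ∀ φ : 𝓢(ℝ, ℂ), ∫ x, 𝓕 φ x * f x = ∫ x, φ x * g x) : IsFourierPair f g := by
  refine ⟨hf, hg, ?_⟩
  have h1 : (𝓕 (hf.toLp f) : Lp ℂ 2 (volume : Measure ℝ)) =ᵐ[volume] hg.toLp g := by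
    refine ae_eq_of_forall_schwartz_integral_eq ((Lp.memLp _).locallyIntegrable (by norm_num))
      ((Lp.memLp _).locallyIntegrable (by norm_num)) fun φ ↦ ?_
    have := congrArg (fun u : TemperedDistribution ℝ ℂ ↦ u φ)
      (Lp.fourier_toTemperedDistribution_eq (hf.toLp f))
    simp only [TemperedDistribution.fourier_apply, Lp.toTemperedDistribution_apply, smul_eq_mul,
      integral_schwartz_mul_toLp] at this
    rw [← this, integral_schwartz_mul_toLp, h]
  exact Lp.ext h1

theorem congr (h : IsFourierPair f g) (hf : f =ᵐ[volume] f') (hg : g =ᵐ[volume] g') :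
    IsFourierPair f' g' := by
  refine ⟨(memLp_congr_ae hf).1 h.memLp_left, (memLp_congr_ae hg).1 h.memLp_right, ?_⟩
  rw [← (MemLp.toLp_eq_toLp_iff h.memLp_left _).2 hf, h.fourier_eq]
  exact (MemLp.toLp_eq_toLp_iff _ _).2 hg

theorem of_memLp_left (hf : MemLp f 2 volume) :
    IsFourierPair f (𝓕 (hf.toLp f) : Lp ℂ 2 (volume : Measure ℝ)) :=
  ⟨hf, Lp.memLp _, by simp⟩

theorem of_memLp_right (hg : MemLp g 2 volume) :
    IsFourierPair (𝓕⁻ (hg.toLp g) : Lp ℂ 2 (volume : Measure ℝ)) g :=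
  ⟨Lp.memLp _, hg, by simp⟩

theorem eLpNorm_eq (h : IsFourierPair f g) : eLpNorm f 2 volume = eLpNorm g 2 volume := by
  have h1 := Lp.norm_fourier_eq (h.memLp_left.toLp f)
  rw [h.fourier_eq, Lp.norm_toLp, Lp.norm_toLp] at h1
  exact ((ENNReal.toReal_eq_toReal_iff' h.memLp_right.2.ne h.memLp_left.2.ne).1 h1).symm

theorem add (h : IsFourierPair f g) (h' : IsFourierPair f' g') :
    IsFourierPair (f + f') (g + g') := by
  refine ⟨h.memLp_left.add h'.memLp_left, h.memLp_right.add h'.memLp_right, ?_⟩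
  rw [MemLp.toLp_add h.memLp_left h'.memLp_left, FourierTransform.fourier_add, h.fourier_eq,
    h'.fourier_eq]
  exact (MemLp.toLp_add _ _).symm

theorem const_smul (h : IsFourierPair f g) (c : ℂ) : IsFourierPair (c • f) (c • g) := by
  refine ⟨h.memLp_left.const_smul c, h.memLp_right.const_smul c, ?_⟩
  rw [MemLp.toLp_const_smul (hf := h.memLp_left), FourierTransform.fourier_smul, h.fourier_eq]
  exact (MemLp.toLp_const_smul _ _).symm

theorem sub (h : IsFourierPair f g) (h' : IsFourierPair f' g') :
    IsFourierPair (f - f') (g - g') := by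
  simpa [sub_eq_add_neg] using h.add (h'.const_smul (-1))

theorem ae_eq_left (h : IsFourierPair f g) (h' : IsFourierPair f' g) : f =ᵐ[volume] f' := by
  refine (MemLp.toLp_eq_toLp_iff h.memLp_left h'.memLp_left).1 ?_
  have := h.fourier_eq.trans h'.fourier_eq.symm
  exact (Lp.fourierTransformₗᵢ ℝ ℂ).injective this

theorem integral_conj_mul (h : IsFourierPair f g) (h' : IsFourierPair f' g') :
    ∫ x, conj (f x) * f' x = ∫ x, conj (g x) * g' x := by
  have h1 := Lp.inner_fourier_eq (h.memLp_left.toLp f) (h'.memLp_left.toLp f')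
  rw [h.fourier_eq, h'.fourier_eq, L2.inner_def, L2.inner_def] at h1
  have e1 : ∫ x, conj (f x) * f' x =
      ∫ x, inner ℂ (h.memLp_left.toLp f x) (h'.memLp_left.toLp f' x) :=
    integral_congr_ae <| by
      filter_upwards [h.memLp_left.coeFn_toLp, h'.memLp_left.coeFn_toLp] with x hx hx'
      rw [hx, hx']; simp [mul_comm]
  have e2 : ∫ x, conj (g x) * g' x =
      ∫ x, inner ℂ (h.memLp_right.toLp g x) (h'.memLp_right.toLp g' x) :=
    integral_congr_ae <| by
      filter_upwards [h.memLp_right.coeFn_toLp, h'.memLp_right.coeFn_toLp] with x hx hx'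
      rw [hx, hx']; simp [mul_comm]
  rw [e1, e2, h1]

theorem integral_fourier_mul_flip {u w : ℝ → ℂ} (hu : Integrable u volume)
    (hw : Integrable w volume) : ∫ x, 𝓕 u x * w x = ∫ x, u x * 𝓕 w x := by
  have := VectorFourier.integral_fourierIntegral_smul_eq_flip (f := u) (g := w)
    (L := innerₗ ℝ) (μ := volume) (ν := volume) Real.continuous_fourierChar continuous_inner hu hw
  rw [flip_innerₗ] at this
  exact this

theorem of_integrable_left (hf : Integrable f volume) (hf2 : MemLp f 2 volume) :
    IsFourierPair f (𝓕 f) := by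
  have h := of_memLp_left hf2
  refine h.congr .rfl (ae_eq_of_forall_schwartz_integral_eq
    (h.memLp_right.locallyIntegrable (by norm_num)) ?_ fun φ ↦ ?_)
  · exact (VectorFourier.fourierIntegral_continuous (L := innerₗ ℝ) Real.continuous_fourierChar
      continuous_inner hf).locallyIntegrable
  · rw [← h.integral_fourier_mul, SchwartzMap.fourier_coe, integral_fourier_mul_flip φ.integrable hf]

theorem of_integrable_right (hg : Integrable g volume) (hg2 : MemLp g 2 volume) :
    IsFourierPair (𝓕⁻ g) g := by
  have h := of_memLp_right hg2
  have hc : Continuous (𝓕⁻ g) := by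
    have : Continuous (𝓕 g) := VectorFourier.fourierIntegral_continuous (L := innerₗ ℝ)
      Real.continuous_fourierChar continuous_inner hg
    rw [show 𝓕⁻ g = fun x ↦ 𝓕 g (-x) from funext fun x ↦ Real.fourierInv_eq_fourier_neg g x]
    exact this.comp continuous_neg
  refine h.congr (ae_eq_of_forall_schwartz_integral_eq
    (h.memLp_left.locallyIntegrable (by norm_num)) hc.locallyIntegrable fun φ ↦ ?_) .rfl
  rw [← h.integral_fourierInv_mul, SchwartzMap.fourierInv_coe, Real.fourierInv_eq_fourier_comp_neg,
    integral_fourier_mul_flip φ.integrable.comp_neg hg,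
    ← integral_neg_eq_self (fun x ↦ φ x * 𝓕⁻ g x)]
  simp [Real.fourierInv_eq_fourier_neg]

/-- Translations are modulations on the Fourier side. -/
theorem comp_add_right (h : IsFourierPair f g) (z : ℝ) :
    IsFourierPair (fun x ↦ f (x + z))
      (fun ξ ↦ Complex.exp (2 * Real.pi * Complex.I * (z * ξ)) * g ξ) := by
  have hf' : MemLp (fun x ↦ f (x + z)) 2 volume :=
    h.memLp_left.comp_measurePreserving (measurePreserving_add_right volume z)
  have hnorm : ∀ ξ : ℝ, ‖Complex.exp (2 * Real.pi * Complex.I * (z * ξ))‖ = 1 := fun ξ ↦ by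
    rw [show (2 * Real.pi * Complex.I * (z * ξ) : ℂ) = ((2 * Real.pi * (z * ξ) : ℝ) : ℂ) * Complex.I
      by push_cast; ring, Complex.norm_exp_ofReal_mul_I]
  have hg' : MemLp (fun ξ : ℝ ↦ Complex.exp (2 * Real.pi * Complex.I * (z * ξ)) * g ξ) 2 volume := by
    refine (memLp_congr_norm (μ := volume) (f := g) ?_ ?_ ?_).1 h.memLp_right
    · exact h.memLp_right.1
    · exact (Continuous.aestronglyMeasurable (by fun_prop)).mul h.memLp_right.1
    · exact .of_forall fun ξ ↦ by rw [norm_mul, hnorm, one_mul]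
  refine of_integral hf' hg' fun φ ↦ ?_
  set θ : 𝓢(ℝ, ℂ) := SchwartzMap.compSubConstCLM ℂ z (𝓕 φ) with hθ
  have e1 : ∀ x, θ x = 𝓕 φ (x - z) := fun x ↦ by simp [hθ]
  have e2 : ∀ ξ, 𝓕⁻ θ ξ = Complex.exp (2 * Real.pi * Complex.I * (z * ξ)) * φ ξ := fun ξ ↦ by
    have e3 : φ ξ = 𝓕⁻ (𝓕 φ) ξ := by rw [FourierTransform.fourierInv_fourier_eq φ]
    rw [e3]
    rw [SchwartzMap.fourierInv_coe, SchwartzMap.fourierInv_coe, Real.fourierInv_eq',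
      Real.fourierInv_eq', ← integral_const_mul, ← integral_add_right_eq_self _ z]
    refine integral_congr_ae (.of_forall fun x ↦ ?_)
    simp only [e1, smul_eq_mul, ← mul_assoc, ← Complex.exp_add, add_sub_cancel_right]
    congr 2
    simp
    ring
  have := h.integral_fourierInv_mul θ
  rw [← integral_add_right_eq_self (fun x ↦ θ x * f x) z] at this
  simp only [e1, e2, add_sub_cancel_right] at this
  rw [← this]
  exact integral_congr_ae (.of_forall fun ξ ↦ by simp only; ring)

/-- Dilations are dilations on the Fourier side. -/
theorem comp_div (h : IsFourierPair f g) {c : ℝ} (hc : 0 < c) :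
    IsFourierPair (fun x ↦ f (x / c)) (fun ξ ↦ c * g (c * ξ)) := by
  have hf' : MemLp (fun x ↦ f (x / c)) 2 volume := by
    simpa [div_eq_inv_mul] using MemLp.comp_const_mul h.memLp_left (inv_ne_zero hc.ne')
  have hg' : MemLp (fun ξ ↦ (c : ℂ) * g (c * ξ)) 2 volume :=
    (MemLp.comp_const_mul h.memLp_right hc.ne').const_mul (c : ℂ)
  refine of_integral hf' hg' fun φ ↦ ?_
  set θ : 𝓢(ℝ, ℂ) := SchwartzMap.compCLMOfContinuousLinearEquiv ℂ
    (ContinuousLinearEquiv.unitsEquivAut ℝ (Units.mk0 c hc.ne')⁻¹) φ with hθ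
  have e1 : ∀ x, θ x = φ (x / c) := fun x ↦ by
    simp [hθ, div_eq_mul_inv]
  have e2 : ∀ x, 𝓕 θ x = c * 𝓕 φ (c * x) := fun x ↦ by
    rw [SchwartzMap.fourier_coe, SchwartzMap.fourier_coe, Real.fourier_eq', Real.fourier_eq']
    have := Measure.integral_comp_div (fun v : ℝ ↦
      Complex.exp (((-2 * Real.pi * inner ℝ v (c * x) : ℝ) : ℂ) * Complex.I) • φ v) c
    rw [abs_of_pos hc, Complex.real_smul] at this
    rw [← this]
    refine integral_congr_ae (.of_forall fun v ↦ ?_)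
    simp only [e1]
    congr 4
    simp
    field_simp
  have h3 := h.integral_fourier_mul θ
  have h4 := Measure.integral_comp_div (fun v : ℝ ↦ 𝓕 φ (c * v) * f v) c
  have h5 := Measure.integral_comp_div (fun v : ℝ ↦ φ v * g (c * v)) c
  rw [abs_of_pos hc, Complex.real_smul, ← integral_const_mul] at h4 h5
  simp only [mul_div_cancel₀ _ hc.ne'] at h4 h5
  simp only [e1, e2] at h3
  rw [h4]
  simp only [← mul_assoc]
  rw [h3, h5]
  exact integral_congr_ae (.of_forall fun ξ ↦ by simp only; ring)

end IsFourierPair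

/-! ### The Bessel weight and the Sobolev norms on the Fourier side -/

/-- The weight `(1 + ξ²)^{s/2}`. -/
def bracket (s ξ : ℝ) : ℝ := (1 + ξ ^ 2) ^ (s / 2)

theorem bracket_pos (s ξ : ℝ) : 0 < bracket s ξ := by unfold bracket; positivity

theorem continuous_bracket (s : ℝ) : Continuous (bracket s) := by
  unfold bracket
  exact Continuous.rpow_const (by fun_prop) fun ξ ↦ Or.inl (by positivity)

theorem hasTemperateGrowth_bracket (s : ℝ) :
    Function.HasTemperateGrowth (fun ξ : ℝ ↦ (bracket s ξ : ℂ)) := by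
  have := Function.hasTemperateGrowth_one_add_norm_sq_rpow ℝ (s / 2)
  have h2 : Function.HasTemperateGrowth (fun ξ : ℝ ↦ (((1 + ‖ξ‖ ^ 2) ^ (s / 2) : ℝ) : ℂ)) := by
    fun_prop
  simpa [bracket] using h2

theorem besselPotential_apply_of_isFourierPair {s : ℝ} {r : ℝ≥0∞} [Fact (1 ≤ r)] {f g : ℝ → ℂ}
    (hfg : IsFourierPair f g) {F : Lp ℂ r (volume : Measure ℝ)} (hF : F =ᵐ[volume] f)
    (φ : 𝓢(ℝ, ℂ)) :
    TemperedDistribution.besselPotential ℝ ℂ s (F : TemperedDistribution ℝ ℂ) φ =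
      ∫ x, 𝓕⁻ φ x * (bracket s x * g x) := by
  rw [TemperedDistribution.besselPotential, TemperedDistribution.fourierMultiplierCLM_apply_apply]
  have hb : (fun x : ℝ ↦ (((1 + ‖x‖ ^ 2) ^ (s / 2) : ℝ) : ℂ)) = fun x : ℝ ↦ (bracket s x : ℂ) := by
    funext x; simp [bracket]
  rw [hb, Lp.toTemperedDistribution_apply]
  have e1 : ∫ x, 𝓕 (SchwartzMap.smulLeftCLM ℂ (fun x : ℝ ↦ (bracket s x : ℂ)) (𝓕⁻ φ)) x • F x =
      ∫ x, 𝓕 (SchwartzMap.smulLeftCLM ℂ (fun x : ℝ ↦ (bracket s x : ℂ)) (𝓕⁻ φ)) x * f x :=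
    integral_congr_ae <| by filter_upwards [hF] with x hx; rw [hx, smul_eq_mul]
  rw [e1, hfg.integral_fourier_mul]
  refine integral_congr_ae (.of_forall fun x ↦ ?_)
  simp only [SchwartzMap.smulLeftCLM_apply_apply (hasTemperateGrowth_bracket s), smul_eq_mul]
  ring

/-- The infimum defining the norm has at most one value: a function representing the Bessel
potential distribution must agree almost everywhere with v. The conditional remains because the
definition also demands f ∈ L^r; when v is not in L^r both sides are infinite. -/
theorem besselNorm_eq_ite {s : ℝ} {r : ℝ≥0∞} (hr : 1 ≤ r) {f g v : ℝ → ℂ}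
    (hfg : IsFourierPair f g) (hv : IsFourierPair v (fun ξ ↦ bracket s ξ * g ξ)) :
    besselNorm s r f = if eLpNorm f r volume < ⊤ then eLpNorm v r volume else ⊤ := by
  have : Fact (1 ≤ r) := ⟨hr⟩
  apply le_antisymm
  · split_ifs with hf
    · rcases eq_or_ne (eLpNorm v r volume) ⊤ with hvr | hvr
      · rw [hvr]; exact le_top
      · have hfr : MemLp f r volume := ⟨hfg.memLp_left.1, hf⟩
        have hvr' : MemLp v r volume := ⟨hv.memLp_left.1, hvr.lt_top⟩
        refine iInf_le_of_le ‹_› <| iInf_le_of_le (hfr.toLp f) <| iInf_le_of_le hfr.coeFn_toLp <|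
          iInf_le_of_le (hvr'.toLp v) <| iInf_le_of_le ?_ (eLpNorm_congr_ae hvr'.coeFn_toLp).le
        ext φ
        rw [besselPotential_apply_of_isFourierPair hfg hfr.coeFn_toLp,
          hv.integral_fourierInv_mul, Lp.toTemperedDistribution_apply]
        exact (integral_schwartz_mul_toLp hvr' φ).symm
    · exact le_top
  · refine le_iInf fun _ ↦ le_iInf fun F ↦ le_iInf fun hF ↦ le_iInf fun w ↦ le_iInf fun hw ↦ ?_
    have hf : eLpNorm f r volume < ⊤ := by
      rw [← eLpNorm_congr_ae hF]; exact (Lp.memLp F).2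
    rw [if_pos hf]
    refine (eLpNorm_congr_ae ?_).le
    refine ae_eq_of_forall_schwartz_integral_eq (hv.memLp_left.locallyIntegrable (by norm_num))
      ((Lp.memLp w).locallyIntegrable hr) fun φ ↦ ?_
    have := congrArg (fun u : TemperedDistribution ℝ ℂ ↦ u φ) hw
    simp only [besselPotential_apply_of_isFourierPair hfg hF, hv.integral_fourierInv_mul,
      Lp.toTemperedDistribution_apply, smul_eq_mul] at this
    exact this

theorem besselNorm_two_eq {s : ℝ} {f g : ℝ → ℂ} (hfg : IsFourierPair f g)
    (hg : MemLp (fun ξ ↦ bracket s ξ * g ξ) 2 volume) :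
    besselNorm s 2 f = eLpNorm (fun ξ ↦ bracket s ξ * g ξ) 2 volume := by
  have hv := IsFourierPair.of_memLp_right hg
  rw [besselNorm_eq_ite (by norm_num) hfg hv, if_pos hfg.memLp_left.2, hv.eLpNorm_eq]

theorem exists_isFourierPair_of_besselNorm_lt_top {s : ℝ} {f : ℝ → ℂ} (h : besselNorm s 2 f < ⊤) :
    ∃ g, IsFourierPair f g ∧ MemLp (fun ξ ↦ bracket s ξ * g ξ) 2 volume := by
  simp only [besselNorm, iInf_lt_iff] at h
  obtain ⟨_, F, hF, w, hw, -⟩ := h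
  have hf : MemLp f 2 volume := (memLp_congr_ae hF).1 (Lp.memLp F)
  have hfg := IsFourierPair.of_memLp_left hf
  refine ⟨_, hfg, ?_⟩
  have hwg := IsFourierPair.of_memLp_left (Lp.memLp w)
  refine (memLp_congr_ae ?_).1 hwg.memLp_right
  refine ae_eq_of_forall_schwartz_integral_eq (hwg.memLp_right.locallyIntegrable (by norm_num))
    ?_ fun φ ↦ ?_
  · rw [locallyIntegrable_iff]
    intro K hK
    exact ((hfg.memLp_right.locallyIntegrable (by norm_num)).integrableOn_isCompact
      hK).continuousOn_mul (Complex.continuous_ofReal.comp (continuous_bracket s)).continuousOn hK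
  -- Testing with `𝓕 φ` cancels the inverse transform inside the Bessel multiplier and leaves a
  -- pairing with φ itself.
  · have := congrArg (fun u : TemperedDistribution ℝ ℂ ↦ u (𝓕 φ)) hw
    simp only [besselPotential_apply_of_isFourierPair hfg hF, Lp.toTemperedDistribution_apply,
      smul_eq_mul, FourierTransform.fourierInv_fourier_eq] at this
    rw [← hwg.integral_fourier_mul, this]

theorem IsWeakDeriv.ae_eq {f g g' : ℝ → ℂ} (hg : LocallyIntegrable g volume)
    (hg' : LocallyIntegrable g' volume) (h : IsWeakDeriv f g) (h' : IsWeakDeriv f g') :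
    g =ᵐ[volume] g' := by
  refine ae_eq_of_integral_contDiff_smul_eq hg hg' fun φ hφ hc ↦ ?_
  have h₁ : HasCompactSupport (Complex.ofRealCLM ∘ φ) := hc.comp_left rfl
  have h₂ : ContDiff ℝ ∞ (Complex.ofRealCLM ∘ φ) := by fun_prop
  have := (h _ h₂ h₁).symm.trans (h' _ h₂ h₁)
  simpa [mul_comm] using this

/-- Weak derivatives are unique almost everywhere, so every admissible competitor in the infimum
gives the same value. -/
theorem firstOrderNorm_eq {r : ℝ≥0∞} (hr : 1 ≤ r) {f g : ℝ → ℂ}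
    (hf : AEStronglyMeasurable f volume) (hg : LocallyIntegrable g volume) (h : IsWeakDeriv f g) :
    firstOrderNorm r f = eLpNorm f r volume + eLpNorm g r volume := by
  apply le_antisymm
  · rcases eq_or_ne (eLpNorm f r volume) ⊤ with hfr | hfr
    · simp [hfr]
    rcases eq_or_ne (eLpNorm g r volume) ⊤ with hgr | hgr
    · simp [hgr]
    exact iInf_le_of_le ⟨hf, hfr.lt_top⟩ <| iInf_le_of_le g <|
      iInf_le_of_le ⟨hg.aestronglyMeasurable, hgr.lt_top⟩ <| iInf_le_of_le h le_rfl
  · refine le_iInf fun _ ↦ le_iInf fun g' ↦ le_iInf fun hg' ↦ le_iInf fun h' ↦ ?_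
    rw [eLpNorm_congr_ae (h.ae_eq hg (hg'.locallyIntegrable hr) h')]

/-! ### Lebesgue integrals on the line -/

theorem lintegral_eq_Ioi_add_Ioi_neg (F : ℝ → ℝ≥0∞) :
    ∫⁻ x, F x = (∫⁻ x in Ioi 0, F x) + ∫⁻ x in Ioi 0, F (-x) := by
  rw [← lintegral_add_compl F (measurableSet_Ioi (a := (0 : ℝ)))]
  congr 1
  rw [compl_Ioi, ← setLIntegral_congr Iio_ae_eq_Iic, ← lintegral_indicator measurableSet_Iio,
    ← lintegral_indicator measurableSet_Ioi, ← lintegral_neg_eq_self]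
  refine lintegral_congr fun x ↦ ?_
  by_cases hx : 0 < x
  · rw [indicator_of_mem (by simpa using hx), indicator_of_mem (by simpa using hx)]
  · rw [indicator_of_notMem (by simpa using hx), indicator_of_notMem (by simpa using hx)]

theorem setLIntegral_Ioc_rpow {a b : ℝ} (ha : -1 < a) (hb : 0 ≤ b) :
    ∫⁻ x in Ioc 0 b, ENNReal.ofReal (x ^ a) = ENNReal.ofReal (b ^ (a + 1) / (a + 1)) := by
  have hi : IntegrableOn (fun x : ℝ ↦ x ^ a) (Ioc 0 b) volume :=
    (intervalIntegrable_iff_integrableOn_Ioc_of_le hb).1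
      (intervalIntegral.intervalIntegrable_rpow' ha)
  rw [← ofReal_integral_eq_lintegral_ofReal hi, ← intervalIntegral.integral_of_le hb,
    integral_rpow (Or.inl ha), Real.zero_rpow (by linarith), sub_zero]
  filter_upwards [ae_restrict_mem measurableSet_Ioc] with x hx
  exact Real.rpow_nonneg hx.1.le a

theorem setLIntegral_Ioi_rpow {a c : ℝ} (ha : a < -1) (hc : 0 < c) :
    ∫⁻ x in Ioi c, ENNReal.ofReal (x ^ a) = ENNReal.ofReal (-c ^ (a + 1) / (a + 1)) := by
  rw [← ofReal_integral_eq_lintegral_ofReal (integrableOn_Ioi_rpow_of_lt ha hc),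
    integral_Ioi_rpow_of_lt ha hc]
  filter_upwards [ae_restrict_mem measurableSet_Ioi] with x hx
  exact Real.rpow_nonneg (hc.trans hx).le a

theorem eLpNorm_two_sq {α : Type*} {m : MeasurableSpace α} {μ : Measure α} (f : α → ℂ) :
    eLpNorm f 2 μ ^ 2 = ∫⁻ x, ‖f x‖ₑ ^ 2 ∂μ := by
  have := eLpNorm_nnreal_pow_eq_lintegral (f := f) (μ := μ) (p := 2) (by norm_num)
  simpa using this

/-! ### The Gagliardo seminorm -/

/-- The kernel `|z|^{-1-2σ}`. -/
def gagliardoKernel (σ z : ℝ) : ℝ≥0∞ := ENNReal.ofReal (|z| ^ (-1 - 2 * σ))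

@[fun_prop]
theorem measurable_gagliardoKernel (σ : ℝ) : Measurable (gagliardoKernel σ) := by
  unfold gagliardoKernel; fun_prop

/-- The square of the Gagliardo seminorm of order `σ` on the line. -/
def gagliardo (σ : ℝ) (f : ℝ → ℂ) : ℝ≥0∞ :=
  ∫⁻ z, gagliardoKernel σ z * ∫⁻ x, ‖f (x + z) - f x‖ₑ ^ 2

/-- Half of the square of the Gagliardo seminorm of order `σ` on the half line. -/
def gagliardoHalf (σ : ℝ) (f : ℝ → ℂ) : ℝ≥0∞ :=
  ∫⁻ z in Ioi 0, gagliardoKernel σ z * ∫⁻ x in Ioi 0, ‖f (x + z) - f x‖ₑ ^ 2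

/-- The ratio of `gagliardo σ f` and `∫ |ξ|^{2σ} |𝓕 f|²`. -/
def gagliardoConst (σ : ℝ) : ℝ≥0∞ :=
  ∫⁻ z, gagliardoKernel σ z * ‖Complex.exp (Complex.I * z) - 1‖ₑ ^ 2

/-- Nonvanishing allows the constant to be cancelled when Gagliardo seminorms are compared. The
integrand is positive on (0,1), where |e^{iz} - 1| = 2 sin(z/2) > 0. -/
theorem gagliardoConst_ne_zero (σ : ℝ) : gagliardoConst σ ≠ 0 := by
  intro h
  rw [gagliardoConst, lintegral_eq_zero_iff (by fun_prop)] at h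
  have h1 : ∀ᵐ z ∂(volume.restrict (Ioo (0 : ℝ) 1)), False := by
    filter_upwards [ae_restrict_of_ae h, ae_restrict_mem measurableSet_Ioo] with z hz hz'
    simp only [Pi.zero_apply, mul_eq_zero, gagliardoKernel, ENNReal.ofReal_eq_zero] at hz
    rcases hz with hz | hz
    · have : 0 < |z| ^ (-1 - 2 * σ) := Real.rpow_pos_of_pos (abs_pos.2 hz'.1.ne') _
      linarith
    · simp only [ne_eq, OfNat.ofNat_ne_zero, not_false_eq_true, pow_eq_zero_iff,
        enorm_eq_zero] at hz
      have h2 := Complex.norm_exp_I_mul_ofReal_sub_one z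
      rw [hz, norm_zero, eq_comm, norm_eq_zero] at h2
      have := Real.sin_pos_of_pos_of_lt_pi (x := z / 2) (by linarith [hz'.1])
        (by linarith [hz'.2, Real.pi_gt_three])
      linarith
  rw [ae_iff] at h1
  simp at h1

/-- Near 0 the bound |e^{iz} - 1| ≤ |z| leaves |z|^(1-2σ), integrable for σ < 1; at infinity the
bound 2 leaves |z|^(-1-2σ), integrable for σ > 0. -/
theorem gagliardoConst_ne_top {σ : ℝ} (h0 : 0 < σ) (h1 : σ < 1) : gagliardoConst σ ≠ ⊤ := by
  have key : ∫⁻ z in Ioi (0 : ℝ), ENNReal.ofReal (z ^ (-1 - 2 * σ)) *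
      ENNReal.ofReal (min z 2) ^ 2 < ⊤ := by
    rw [← Ioc_union_Ioi_eq_Ioi (zero_le_one (α := ℝ)),
      lintegral_union measurableSet_Ioi (Ioc_disjoint_Ioi le_rfl), ENNReal.add_lt_top]
    constructor
    · calc _ ≤ ∫⁻ z in Ioc (0 : ℝ) 1, ENNReal.ofReal (z ^ (1 - 2 * σ)) := by
            refine setLIntegral_mono' measurableSet_Ioc fun z hz ↦ ?_
            rw [← ENNReal.ofReal_pow (le_min hz.1.le zero_le_two), ← ENNReal.ofReal_mul
              (Real.rpow_nonneg hz.1.le _)]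
            refine ENNReal.ofReal_le_ofReal ?_
            have : z ^ (1 - 2 * σ) = z ^ (-1 - 2 * σ) * z ^ 2 := by
              rw [← Real.rpow_natCast, ← Real.rpow_add hz.1]; congr 1; push_cast; ring
            rw [this]
            have := Real.rpow_nonneg hz.1.le (-1 - 2 * σ)
            gcongr
            · exact le_min hz.1.le zero_le_two
            · exact min_le_left _ _
        _ < ⊤ := by rw [setLIntegral_Ioc_rpow (by linarith) zero_le_one]; exact ENNReal.ofReal_lt_top
    · calc _ ≤ ∫⁻ z in Ioi (1 : ℝ), ENNReal.ofReal (z ^ (-1 - 2 * σ)) * 4 := by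
            refine setLIntegral_mono' measurableSet_Ioi fun z hz ↦ ?_
            gcongr
            rw [← ENNReal.ofReal_pow (le_min (zero_le_one.trans (le_of_lt hz)) zero_le_two)]
            refine ENNReal.ofReal_le_of_le_toReal ?_
            have h3 : 0 ≤ min z 2 := le_min (zero_le_one.trans (le_of_lt hz)) zero_le_two
            have h4 : min z 2 ≤ 2 := min_le_right _ _
            simp
            nlinarith
        _ < ⊤ := by
            rw [lintegral_mul_const _ (by fun_prop), setLIntegral_Ioi_rpow (by linarith) one_pos]
            exact ENNReal.mul_lt_top ENNReal.ofReal_lt_top (by norm_num)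
  have hb : ∀ z : ℝ, ‖Complex.exp (Complex.I * z) - 1‖ₑ ≤ ENNReal.ofReal (min |z| 2) := fun z ↦ by
    rw [← ofReal_norm]
    refine ENNReal.ofReal_le_ofReal (le_min (Real.norm_exp_I_mul_ofReal_sub_one_le) ?_)
    rw [Complex.norm_exp_I_mul_ofReal_sub_one, norm_mul, Real.norm_eq_abs, Real.norm_eq_abs]
    have := Real.abs_sin_le_one (z / 2)
    norm_num; linarith
  rw [← lt_top_iff_ne_top, gagliardoConst, lintegral_eq_Ioi_add_Ioi_neg, ENNReal.add_lt_top]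
  constructor
  · refine lt_of_le_of_lt (setLIntegral_mono' measurableSet_Ioi fun z hz ↦ ?_) key
    have h2 := hb z
    rw [abs_of_pos (show (0 : ℝ) < z from hz)] at h2
    rw [gagliardoKernel, abs_of_pos (show (0 : ℝ) < z from hz)]
    gcongr
  · refine lt_of_le_of_lt (setLIntegral_mono' measurableSet_Ioi fun z hz ↦ ?_) key
    have h2 := hb (-z)
    rw [abs_neg, abs_of_pos (show (0 : ℝ) < z from hz)] at h2
    rw [gagliardoKernel, abs_neg, abs_of_pos (show (0 : ℝ) < z from hz)]
    gcongr

/-- Plancherel turns the increment f(· + z) - f into the multiplier e^{2πiξz} - 1. After Tonelli,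
the dilation z ↦ 2πξz in the inner integral extracts |2πξ|^(2σ) and leaves the universal constant.
-/
theorem gagliardo_eq {σ : ℝ} {f g : ℝ → ℂ} (h : IsFourierPair f g) :
    gagliardo σ f = gagliardoConst σ *
      ∫⁻ ξ, ENNReal.ofReal (|2 * Real.pi * ξ| ^ (2 * σ)) * ‖g ξ‖ₑ ^ 2 := by
  have e1 : ∀ z : ℝ, ∫⁻ x, ‖f (x + z) - f x‖ₑ ^ 2 =
      ∫⁻ ξ, ‖Complex.exp (Complex.I * ((2 * Real.pi * ξ * z : ℝ) : ℂ)) - 1‖ₑ ^ 2 * ‖g ξ‖ₑ ^ 2 := by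
    intro z
    have h2 := ((h.comp_add_right z).sub h).eLpNorm_eq
    have h3 := congrArg (· ^ 2) h2
    simp only [eLpNorm_two_sq, Pi.sub_apply] at h3
    rw [h3]
    refine lintegral_congr fun ξ ↦ ?_
    rw [← mul_pow, ← enorm_mul, sub_mul, one_mul]
    congr 5
    push_cast; ring
  have hg : AEMeasurable (fun ξ ↦ ‖g ξ‖ₑ ^ 2) volume := h.memLp_right.1.enorm.pow_const 2
  simp only [gagliardo, e1]
  calc _ = ∫⁻ z, ∫⁻ ξ, gagliardoKernel σ z *
        (‖Complex.exp (Complex.I * ((2 * Real.pi * ξ * z : ℝ) : ℂ)) - 1‖ₑ ^ 2 * ‖g ξ‖ₑ ^ 2) := by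
        refine lintegral_congr fun z ↦ (lintegral_const_mul'' _ ?_).symm
        exact (Measurable.aemeasurable (by fun_prop)).mul hg
    _ = ∫⁻ ξ, ∫⁻ z, gagliardoKernel σ z *
        (‖Complex.exp (Complex.I * ((2 * Real.pi * ξ * z : ℝ) : ℂ)) - 1‖ₑ ^ 2 * ‖g ξ‖ₑ ^ 2) := by
        refine lintegral_lintegral_swap ?_
        refine AEMeasurable.mul (f := fun p : ℝ × ℝ ↦ gagliardoKernel σ p.1)
          (Measurable.aemeasurable (by fun_prop)) (AEMeasurable.mul (f := fun p : ℝ × ℝ ↦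
            ‖Complex.exp (Complex.I * ((2 * Real.pi * p.2 * p.1 : ℝ) : ℂ)) - 1‖ₑ ^ 2)
            (Measurable.aemeasurable (by fun_prop)) hg.comp_snd)
    _ = ∫⁻ ξ, gagliardoConst σ * (ENNReal.ofReal (|2 * Real.pi * ξ| ^ (2 * σ)) * ‖g ξ‖ₑ ^ 2) := by
        refine lintegral_congr_ae ?_
        filter_upwards [Measure.ae_ne volume (0 : ℝ)] with ξ hξ
        have hξ' : 2 * Real.pi * ξ ≠ 0 := by positivity
        simp only [← mul_assoc]
        rw [lintegral_mul_const _ (by fun_prop)]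
        congr 1
        have h5 := lintegral_comp_const_mul (fun z ↦ gagliardoKernel σ z *
          ‖Complex.exp (Complex.I * z) - 1‖ₑ ^ 2) hξ'
        rw [← gagliardoConst] at h5
        have h6 : ∀ z : ℝ, gagliardoKernel σ z = ENNReal.ofReal (|2 * Real.pi * ξ| ^ (1 + 2 * σ)) *
            gagliardoKernel σ (2 * Real.pi * ξ * z) := fun z ↦ by
          unfold gagliardoKernel
          rw [← ENNReal.ofReal_mul (by positivity), abs_mul (2 * Real.pi * ξ),
            Real.mul_rpow (abs_nonneg _) (abs_nonneg _), ← mul_assoc,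
            ← Real.rpow_add (abs_pos.2 hξ')]
          simp
        have h7 : ∀ z : ℝ, gagliardoKernel σ z *
            ‖Complex.exp (Complex.I * ((2 * Real.pi * ξ * z : ℝ) : ℂ)) - 1‖ₑ ^ 2 =
            ENNReal.ofReal (|2 * Real.pi * ξ| ^ (1 + 2 * σ)) *
            (gagliardoKernel σ (2 * Real.pi * ξ * z) *
            ‖Complex.exp (Complex.I * ((2 * Real.pi * ξ * z : ℝ) : ℂ)) - 1‖ₑ ^ 2) := fun z ↦ by
          rw [h6 z, mul_assoc]
        rw [lintegral_congr h7, lintegral_const_mul _ (by fun_prop), h5,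
          ← mul_assoc, ← ENNReal.ofReal_mul (by positivity), mul_comm (gagliardoConst σ)]
        congr 2
        rw [abs_inv, Real.rpow_add (abs_pos.2 hξ'), Real.rpow_one]
        field_simp
    _ = _ := lintegral_const_mul'' _ ((Measurable.aemeasurable (by fun_prop)).mul hg)

/-! ### The fractional Hardy inequality on the half line -/

theorem lintegral_rpow_mul_comp_dilation (σ : ℝ) (φ : ℝ → ℂ) {a : ℝ} (ha : 0 < a) :
    eLpNorm (fun x : ℝ ↦ ((|x| ^ (-σ) : ℝ) : ℂ) * φ (a * x)) 2 volume =
      ENNReal.ofReal (a ^ (σ - 1 / 2)) *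
        eLpNorm (fun x : ℝ ↦ ((|x| ^ (-σ) : ℝ) : ℂ) * φ x) 2 volume := by
  refine (ENNReal.pow_right_strictMono (n := 2) (by norm_num)).injective ?_
  simp only [mul_pow, eLpNorm_two_sq]
  have h1 := lintegral_comp_const_mul (fun x ↦ ‖((|x| ^ (-σ) : ℝ) : ℂ) * φ x‖ₑ ^ 2) ha.ne'
  have h2 : ∀ x : ℝ, ‖((|x| ^ (-σ) : ℝ) : ℂ) * φ (a * x)‖ₑ ^ 2 = ENNReal.ofReal (a ^ (2 * σ)) *
      ‖((|a * x| ^ (-σ) : ℝ) : ℂ) * φ (a * x)‖ₑ ^ 2 := fun x ↦ by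
    rw [show a ^ (2 * σ) = (a ^ σ) ^ 2 by rw [← Real.rpow_natCast, ← Real.rpow_mul ha.le]; congr 1; push_cast; ring,
      ENNReal.ofReal_pow (by positivity), ← mul_pow, enorm_mul, enorm_mul, ← mul_assoc]
    congr 2
    simp only [← ofReal_norm, Complex.norm_real, Real.norm_eq_abs]
    rw [← ENNReal.ofReal_mul (by positivity), abs_mul, Real.mul_rpow (abs_nonneg _) (abs_nonneg _),
      abs_mul, abs_of_pos ha, ← mul_assoc, abs_of_pos (Real.rpow_pos_of_pos ha _),
      ← Real.rpow_add ha]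
    simp
  rw [lintegral_congr h2, lintegral_const_mul' _ _ ENNReal.ofReal_ne_top, h1, ← mul_assoc,
    ← ENNReal.ofReal_pow (by positivity), ← ENNReal.ofReal_mul (by positivity)]
  congr 2
  rw [abs_inv, abs_of_pos ha, ← Real.rpow_neg_one, ← Real.rpow_add ha, ← Real.rpow_natCast,
    ← Real.rpow_mul ha.le]
  congr 1; push_cast; ring

/-- Dilation multiplies the weighted norm by a^(σ-1/2), so the triangle inequality bounds |1 -
a^(σ-1/2)| times the norm by the norm of the difference. For a ≥ 2 this factor is smallest at a = 2.
Finiteness of the norm is what permits the subtraction. -/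
theorem hardy_dilation {σ : ℝ} (hσ : σ ≠ 1 / 2) {φ : ℝ → ℂ} (hφm : Measurable φ)
    (hN : eLpNorm (fun x : ℝ ↦ ((|x| ^ (-σ) : ℝ) : ℂ) * φ x) 2 volume ≠ ⊤) {a : ℝ} (ha : 2 ≤ a) :
    ENNReal.ofReal |1 - 2 ^ (σ - 1 / 2)| *
        eLpNorm (fun x : ℝ ↦ ((|x| ^ (-σ) : ℝ) : ℂ) * φ x) 2 volume ≤
      eLpNorm (fun x : ℝ ↦ ((|x| ^ (-σ) : ℝ) : ℂ) * (φ (a * x) - φ x)) 2 volume := by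
  have ha0 : 0 < a := by linarith
  set N := eLpNorm (fun x : ℝ ↦ ((|x| ^ (-σ) : ℝ) : ℂ) * φ x) 2 volume with hNdef
  set D := eLpNorm (fun x : ℝ ↦ ((|x| ^ (-σ) : ℝ) : ℂ) * (φ (a * x) - φ x)) 2 volume with hD
  have hdil := lintegral_rpow_mul_comp_dilation σ φ ha0
  rw [← hNdef] at hdil
  have m1 : AEStronglyMeasurable (fun x : ℝ ↦ ((|x| ^ (-σ) : ℝ) : ℂ) * φ x) volume :=
    Measurable.aestronglyMeasurable (by fun_prop)
  have m2 : AEStronglyMeasurable (fun x : ℝ ↦ ((|x| ^ (-σ) : ℝ) : ℂ) * φ (a * x)) volume :=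
    Measurable.aestronglyMeasurable (by fun_prop)
  have m3 : AEStronglyMeasurable
      (fun x : ℝ ↦ ((|x| ^ (-σ) : ℝ) : ℂ) * (φ (a * x) - φ x)) volume :=
    Measurable.aestronglyMeasurable (by fun_prop)
  have t1 : N ≤ ENNReal.ofReal (a ^ (σ - 1 / 2)) * N + D := by
    rw [← hdil]
    refine le_trans (le_of_eq ?_) (eLpNorm_sub_le m2 m3 (by norm_num))
    rw [hNdef]; congr 1; funext x; simp only [Pi.sub_apply]; ring
  have t2 : ENNReal.ofReal (a ^ (σ - 1 / 2)) * N ≤ N + D := by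
    rw [← hdil]
    refine le_trans (le_of_eq ?_) (eLpNorm_add_le m1 m3 (by norm_num))
    congr 1; funext x; simp only [Pi.add_apply]; ring
  rcases eq_or_ne D ⊤ with hDt | hDt
  · rw [hDt]; exact le_top
  lift N to ℝ≥0 using hN with n
  lift D to ℝ≥0 using hDt with d
  have e1 : ∀ x : ℝ, ENNReal.ofReal x = ((x.toNNReal : ℝ≥0) : ℝ≥0∞) := fun _ ↦ rfl
  simp only [e1] at t1 t2 ⊢
  norm_cast at t1 t2 ⊢
  have hap : 0 < a ^ (σ - 1 / 2) := Real.rpow_pos_of_pos ha0 _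
  have t1' : (n : ℝ) ≤ a ^ (σ - 1 / 2) * n + d := by
    have := NNReal.coe_le_coe.2 t1
    push_cast at this; rwa [Real.coe_toNNReal _ hap.le] at this
  have t2' : a ^ (σ - 1 / 2) * n ≤ n + d := by
    have := NNReal.coe_le_coe.2 t2
    push_cast at this; rwa [Real.coe_toNNReal _ hap.le] at this
  rw [← NNReal.coe_le_coe]
  push_cast
  rw [Real.coe_toNNReal _ (abs_nonneg _)]
  have hn : (0 : ℝ) ≤ n := n.2
  rcases lt_or_gt_of_ne hσ with h | h
  · have h3 : a ^ (σ - 1 / 2) ≤ 2 ^ (σ - 1 / 2) :=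
      Real.rpow_le_rpow_of_nonpos two_pos ha (by linarith)
    have h4 : (2 : ℝ) ^ (σ - 1 / 2) ≤ 1 :=
      Real.rpow_le_one_of_one_le_of_nonpos one_le_two (by linarith)
    rw [abs_of_nonneg (by linarith)]
    nlinarith
  · have h3 : (2 : ℝ) ^ (σ - 1 / 2) ≤ a ^ (σ - 1 / 2) :=
      Real.rpow_le_rpow two_pos.le ha (by linarith)
    have h4 : 1 ≤ (2 : ℝ) ^ (σ - 1 / 2) := Real.one_le_rpow one_le_two (by linarith)
    rw [abs_of_nonpos (by linarith)]
    nlinarith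

/-- The fractional Hardy inequality of order `σ ≠ 1/2` on the half line. -/
theorem fractional_hardy {σ : ℝ} (h0 : 0 < σ) (hσ : σ ≠ 1 / 2) {φ : ℝ → ℂ} (hφm : Measurable φ)
    (hφ0 : ∀ x ≤ 0, φ x = 0)
    (hN : eLpNorm (fun x : ℝ ↦ ((|x| ^ (-σ) : ℝ) : ℂ) * φ x) 2 volume ≠ ⊤) :
    ENNReal.ofReal |1 - 2 ^ (σ - 1 / 2)| ^ 2 *
        ∫⁻ x in Ioi 0, ENNReal.ofReal (x ^ (-2 * σ)) * ‖φ x‖ₑ ^ 2 ≤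
      ENNReal.ofReal (2 ^ (1 + 2 * σ)) * gagliardoHalf σ φ := by
  set κ := ENNReal.ofReal |1 - 2 ^ (σ - 1 / 2)|
  have hw : ∀ x ∈ Ioi (0 : ℝ), ∀ w : ℂ, ‖((|x| ^ (-σ) : ℝ) : ℂ) * w‖ₑ ^ 2 =
      ENNReal.ofReal (x ^ (-2 * σ)) * ‖w‖ₑ ^ 2 := fun x hx w ↦ by
    have hx : 0 < x := hx
    rw [enorm_mul, mul_pow, ← ofReal_norm, Complex.norm_real, abs_of_pos hx, Real.norm_eq_abs,
      abs_of_pos (Real.rpow_pos_of_pos hx _), ← ENNReal.ofReal_pow (by positivity),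
      ← Real.rpow_natCast, ← Real.rpow_mul hx.le]
    congr 3; push_cast; ring
  have hsplit : ∀ F : ℝ → ℂ, (∀ x ≤ 0, F x = 0) →
      eLpNorm (fun x : ℝ ↦ ((|x| ^ (-σ) : ℝ) : ℂ) * F x) 2 volume ^ 2 =
        ∫⁻ x in Ioi 0, ENNReal.ofReal (x ^ (-2 * σ)) * ‖F x‖ₑ ^ 2 := fun F hF ↦ by
    rw [eLpNorm_two_sq, ← setLIntegral_congr_fun measurableSet_Ioi (fun x hx ↦ hw x hx (F x)),
      setLIntegral_eq_of_support_subset]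
    intro x hx
    by_contra hx'
    exact hx (by simp [hF x (not_lt.1 hx')])
  have hdil : ∀ μ ∈ Ioo (1 : ℝ) 2,
      κ ^ 2 * ∫⁻ x in Ioi 0, ENNReal.ofReal (x ^ (-2 * σ)) * ‖φ x‖ₑ ^ 2 ≤
      ∫⁻ x in Ioi 0, ENNReal.ofReal (x ^ (-2 * σ)) * ‖φ (x + x * μ) - φ x‖ₑ ^ 2 := by
    intro μ hμ
    have h1 := hardy_dilation hσ hφm hN (a := 1 + μ) (by linarith [hμ.1])
    have h2 := pow_le_pow_left₀ (zero_le) h1 2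
    rw [mul_pow, hsplit _ hφ0, hsplit] at h2
    · refine h2.trans (le_of_eq (lintegral_congr fun x ↦ ?_))
      congr 5; ring
    · intro x hx
      rw [hφ0 x hx, hφ0 _ (mul_nonpos_of_nonneg_of_nonpos (by linarith [hμ.1]) hx), sub_zero]
  -- The dilation inequality is averaged over μ in (1,2), an interval of length one. The
  -- substitution z = xμ then converts dilation differences into translation differences, with dμ =
  -- dz/x supplying the missing power of x.
  calc _ = ∫⁻ μ in Ioo (1 : ℝ) 2,
        κ ^ 2 * ∫⁻ x in Ioi 0, ENNReal.ofReal (x ^ (-2 * σ)) * ‖φ x‖ₑ ^ 2 := by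
        rw [setLIntegral_const, Real.volume_Ioo]; norm_num
    _ ≤ ∫⁻ μ in Ioo (1 : ℝ) 2, ∫⁻ x in Ioi 0,
        ENNReal.ofReal (x ^ (-2 * σ)) * ‖φ (x + x * μ) - φ x‖ₑ ^ 2 :=
        setLIntegral_mono' measurableSet_Ioo hdil
    _ = ∫⁻ x in Ioi 0, ∫⁻ μ in Ioo (1 : ℝ) 2,
        ENNReal.ofReal (x ^ (-2 * σ)) * ‖φ (x + x * μ) - φ x‖ₑ ^ 2 :=
        lintegral_lintegral_swap (Measurable.aemeasurable (by
          simp only [Function.uncurry_def]; fun_prop))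
    _ ≤ ∫⁻ x in Ioi 0, ∫⁻ z in Ioi 0, ENNReal.ofReal (2 ^ (1 + 2 * σ)) *
        (gagliardoKernel σ z * ‖φ (x + z) - φ x‖ₑ ^ 2) := by
        refine setLIntegral_mono' measurableSet_Ioi fun x hx ↦ ?_
        have hx : 0 < x := hx
        have h1 := lintegral_comp_const_mul (fun z ↦ (Ioo x (2 * x)).indicator
          (fun z ↦ ‖φ (x + z) - φ x‖ₑ ^ 2) z) hx.ne'
        have h2 : ∫⁻ μ in Ioo (1 : ℝ) 2, ENNReal.ofReal (x ^ (-2 * σ)) * ‖φ (x + x * μ) - φ x‖ₑ ^ 2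
            = ENNReal.ofReal (x ^ (-1 - 2 * σ)) * ∫⁻ z in Ioo x (2 * x), ‖φ (x + z) - φ x‖ₑ ^ 2 := by
          rw [lintegral_const_mul' _ _ ENNReal.ofReal_ne_top, ← lintegral_indicator measurableSet_Ioo,
            ← lintegral_indicator measurableSet_Ioo,
            show x ^ (-1 - 2 * σ) = x ^ (-2 * σ) * |x⁻¹| by
              rw [abs_inv, abs_of_pos hx, ← Real.rpow_neg_one, ← Real.rpow_add hx]; congr 1; ring,
            ENNReal.ofReal_mul (by positivity), mul_assoc, ← h1]
          congr 1
          refine lintegral_congr fun μ ↦ ?_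
          have : x * μ ∈ Ioo x (2 * x) ↔ μ ∈ Ioo (1 : ℝ) 2 := by
            simp only [mem_Ioo]
            constructor
            · rintro ⟨a, b⟩; constructor <;> nlinarith
            · rintro ⟨a, b⟩; constructor <;> nlinarith
          by_cases hμ : μ ∈ Ioo (1 : ℝ) 2
          · rw [indicator_of_mem hμ, indicator_of_mem (this.2 hμ)]
          · rw [indicator_of_notMem hμ, indicator_of_notMem (fun h ↦ hμ (this.1 h))]
        rw [h2, ← lintegral_const_mul' _ _ ENNReal.ofReal_ne_top]
        refine (setLIntegral_mono' measurableSet_Ioo fun z hz ↦ ?_).trans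
          (lintegral_mono_set (fun z hz ↦ hx.trans hz.1))
        have hz0 : 0 < z := hx.trans hz.1
        rw [← mul_assoc, gagliardoKernel, ← ENNReal.ofReal_mul (by positivity), abs_of_pos hz0]
        gcongr
        -- Since z < 2x, the negative power of x is at most the same power of z/2; this is the
        -- source of 2^(1+2σ).
        rw [show (2 : ℝ) ^ (1 + 2 * σ) = 2⁻¹ ^ (-1 - 2 * σ) by
          rw [Real.inv_rpow zero_le_two, ← Real.rpow_neg zero_le_two]; congr 1; ring,
          ← Real.mul_rpow (by norm_num) hz0.le]
        exact Real.rpow_le_rpow_of_nonpos (by linarith) (by linarith [hz.2]) (by linarith)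
    _ = ∫⁻ z in Ioi 0, ∫⁻ x in Ioi 0, ENNReal.ofReal (2 ^ (1 + 2 * σ)) *
        (gagliardoKernel σ z * ‖φ (x + z) - φ x‖ₑ ^ 2) :=
        lintegral_lintegral_swap (Measurable.aemeasurable (by
          simp only [Function.uncurry_def]; fun_prop))
    _ = _ := by
        rw [gagliardoHalf, ← lintegral_const_mul' _ _ ENNReal.ofReal_ne_top]
        refine lintegral_congr fun z ↦ ?_
        rw [lintegral_const_mul _ (by fun_prop), lintegral_const_mul _ (by fun_prop)]

/-! ### Extension by zero -/

theorem gagliardoHalf_le_gagliardo (σ : ℝ) (f : ℝ → ℂ) : gagliardoHalf σ f ≤ gagliardo σ f :=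
  (setLIntegral_le_lintegral _ _).trans
    (lintegral_mono fun _ ↦ mul_le_mul_right (setLIntegral_le_lintegral _ _) _)

theorem gagliardoHalf_congr (σ : ℝ) {f g : ℝ → ℂ} (h : f =ᵐ[volume.restrict (Ioi 0)] g) :
    gagliardoHalf σ f = gagliardoHalf σ g := by
  refine setLIntegral_congr_fun measurableSet_Ioi fun z hz ↦ ?_
  have hz : 0 < z := hz
  congr 1
  have h1 : ∀ᵐ x ∂(volume : Measure ℝ), x ∈ Ioi 0 → f x = g x :=
    (ae_restrict_iff' measurableSet_Ioi).1 h
  have h2 : ∀ᵐ x ∂(volume : Measure ℝ), x + z ∈ Ioi 0 → f (x + z) = g (x + z) :=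
    (measurePreserving_add_right volume z).quasiMeasurePreserving.ae h1
  refine lintegral_congr_ae ?_
  filter_upwards [h, ae_restrict_of_ae h2, ae_restrict_mem measurableSet_Ioi] with x a b c
  rw [a, b (add_pos (show (0 : ℝ) < x from c) hz)]

/-- As φ vanishes on (-∞,0], an increment z > 0 adds to the half-line integral only the mass of |φ|²
on (0,z]. Integrating the kernel over z ≥ y gives y^(-2σ)/(2σ), which is the Hardy weight. Negative
increments contribute as much as positive ones, hence the factor 2. -/
theorem gagliardo_le_gagliardoHalf_add {σ : ℝ} (hσ : 0 < σ) {φ : ℝ → ℂ} (hφm : Measurable φ)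
    (hφ0 : ∀ x ≤ 0, φ x = 0) :
    gagliardo σ φ ≤ 2 * (gagliardoHalf σ φ + ENNReal.ofReal (1 / (2 * σ)) *
      ∫⁻ x in Ioi 0, ENNReal.ofReal (x ^ (-2 * σ)) * ‖φ x‖ₑ ^ 2) := by
  have hsymm : ∀ z : ℝ, ∫⁻ x, ‖φ (x + -z) - φ x‖ₑ ^ 2 = ∫⁻ x, ‖φ (x + z) - φ x‖ₑ ^ 2 := fun z ↦ by
    rw [← lintegral_add_right_eq_self _ z]
    refine lintegral_congr fun x ↦ ?_
    rw [add_neg_cancel_right, enorm_sub_rev]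
  have hsplit : ∀ z ∈ Ioi (0 : ℝ), ∫⁻ x, ‖φ (x + z) - φ x‖ₑ ^ 2 ≤
      (∫⁻ x in Ioi 0, ‖φ (x + z) - φ x‖ₑ ^ 2) + ∫⁻ y in Ioi 0, (Iic z).indicator (fun _ ↦ 1) y *
        ‖φ y‖ₑ ^ 2 := fun z hz ↦ by
    rw [← lintegral_add_compl _ (measurableSet_Ioi (a := (0 : ℝ))), compl_Ioi]
    refine add_le_add le_rfl (le_of_eq ?_)
    calc ∫⁻ x in Iic 0, ‖φ (x + z) - φ x‖ₑ ^ 2 = ∫⁻ x in Iic 0, ‖φ (x + z)‖ₑ ^ 2 :=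
          setLIntegral_congr_fun measurableSet_Iic fun x hx ↦ by rw [hφ0 x hx, sub_zero]
      _ = ∫⁻ x, (Iic 0).indicator (fun x ↦ ‖φ (x + z)‖ₑ ^ 2) x :=
          (lintegral_indicator measurableSet_Iic _).symm
      _ = ∫⁻ y, (Iic z).indicator (fun y ↦ ‖φ y‖ₑ ^ 2) y := by
          rw [← lintegral_add_right_eq_self ((Iic z).indicator fun y ↦ ‖φ y‖ₑ ^ 2) z]
          refine lintegral_congr fun x ↦ ?_
          simp [indicator_apply]
      _ = ∫⁻ y in Ioi 0, (Iic z).indicator (fun y ↦ ‖φ y‖ₑ ^ 2) y := by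
          refine (setLIntegral_eq_of_support_subset fun y hy ↦ ?_).symm
          by_contra hy'
          exact hy (by simp [indicator_apply, hφ0 y (not_lt.1 hy')])
      _ = _ := lintegral_congr fun y ↦ by simp [indicator_apply]
  have hhalf : ∫⁻ z in Ioi 0, gagliardoKernel σ z * ∫⁻ x, ‖φ (x + z) - φ x‖ₑ ^ 2 ≤
      gagliardoHalf σ φ + ENNReal.ofReal (1 / (2 * σ)) *
      ∫⁻ x in Ioi 0, ENNReal.ofReal (x ^ (-2 * σ)) * ‖φ x‖ₑ ^ 2 := by
    calc _ ≤ ∫⁻ z in Ioi 0, (gagliardoKernel σ z * (∫⁻ x in Ioi 0, ‖φ (x + z) - φ x‖ₑ ^ 2) +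
          ∫⁻ y in Ioi 0, gagliardoKernel σ z * ((Iic z).indicator (fun _ ↦ 1) y * ‖φ y‖ₑ ^ 2)) := by
          refine setLIntegral_mono' measurableSet_Ioi fun z hz ↦ ?_
          rw [lintegral_const_mul' (gagliardoKernel σ z) _ ENNReal.ofReal_ne_top, ← mul_add]
          gcongr
          exact hsplit z hz
      _ = gagliardoHalf σ φ + ∫⁻ z in Ioi 0, ∫⁻ y in Ioi 0,
          gagliardoKernel σ z * ((Iic z).indicator (fun _ ↦ 1) y * ‖φ y‖ₑ ^ 2) := by
          rw [gagliardoHalf, ← lintegral_add_left']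
          refine AEMeasurable.mul (by fun_prop) (Measurable.aemeasurable ?_)
          exact Measurable.lintegral_prod_right' (f := fun p : ℝ × ℝ ↦ ‖φ (p.2 + p.1) - φ p.2‖ₑ ^ 2)
            (by fun_prop)
      _ = gagliardoHalf σ φ + ∫⁻ y in Ioi 0, ∫⁻ z in Ioi 0,
          gagliardoKernel σ z * ((Iic z).indicator (fun _ ↦ 1) y * ‖φ y‖ₑ ^ 2) := by
          rw [lintegral_lintegral_swap]
          refine Measurable.aemeasurable ?_
          have : (Function.uncurry fun (z y : ℝ) ↦ gagliardoKernel σ z *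
              ((Iic z).indicator (fun _ ↦ (1 : ℝ≥0∞)) y * ‖φ y‖ₑ ^ 2)) = fun p : ℝ × ℝ ↦
              gagliardoKernel σ p.1 * ({p : ℝ × ℝ | p.2 ≤ p.1}.indicator (fun _ ↦ 1) p *
              ‖φ p.2‖ₑ ^ 2) := by
            funext p; simp [Function.uncurry_def, indicator_apply]
          rw [this]
          have : Measurable ({p : ℝ × ℝ | p.2 ≤ p.1}.indicator (fun _ ↦ (1 : ℝ≥0∞))) :=
            measurable_const.indicator (measurableSet_le measurable_snd measurable_fst)
          fun_prop
      _ = _ := by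
          congr 1
          rw [← lintegral_const_mul' _ _ ENNReal.ofReal_ne_top]
          refine setLIntegral_congr_fun measurableSet_Ioi fun y hy ↦ ?_
          have hy : 0 < y := hy
          simp only [← mul_assoc]
          rw [lintegral_mul_const]
          · congr 1
            calc _ = ∫⁻ z in Ioi 0, (Ici y).indicator (gagliardoKernel σ) z := by
                  refine lintegral_congr fun z ↦ ?_
                  simp [indicator_apply]
              _ = ∫⁻ z in Ioi y, ENNReal.ofReal (z ^ (-1 - 2 * σ)) := by
                  rw [lintegral_indicator measurableSet_Ici, Measure.restrict_restrict
                    measurableSet_Ici, inter_eq_left.2 (show Ici y ⊆ Ioi 0 from fun z hz ↦ hy.trans_le hz),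
                    ← setLIntegral_congr Ioi_ae_eq_Ici]
                  refine setLIntegral_congr_fun measurableSet_Ioi fun z hz ↦ ?_
                  simp only [gagliardoKernel, abs_of_pos (hy.trans hz)]
              _ = _ := by
                  rw [setLIntegral_Ioi_rpow (by linarith) hy, ← ENNReal.ofReal_mul (by positivity)]
                  congr 1
                  rw [show -1 - 2 * σ + 1 = -2 * σ by ring, neg_mul, neg_div_neg_eq]; ring
          · have : Measurable fun z : ℝ ↦ (Iic z).indicator (fun _ ↦ (1 : ℝ≥0∞)) y := by
              have : (fun z : ℝ ↦ (Iic z).indicator (fun _ ↦ (1 : ℝ≥0∞)) y) =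
                  (Ici y).indicator fun _ ↦ 1 := by funext z; simp [indicator_apply]
              rw [this]; exact measurable_const.indicator measurableSet_Ici
            fun_prop
  rw [gagliardo, lintegral_eq_Ioi_add_Ioi_neg, two_mul]
  refine add_le_add hhalf (le_trans (le_of_eq ?_) hhalf)
  refine lintegral_congr fun z ↦ ?_
  rw [hsymm, gagliardoKernel, abs_neg, gagliardoKernel]

theorem memLp_rpow_mul_of_tsupport_subset (σ : ℝ) {φ : ℝ → ℂ} (hφ : Continuous φ)
    (hc : HasCompactSupport φ) (hs : tsupport φ ⊆ Ioi 0) :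
    MemLp (fun x : ℝ ↦ ((|x| ^ (-σ) : ℝ) : ℂ) * φ x) 2 volume := by
  refine Continuous.memLp_of_hasCompactSupport ?_ hc.mul_left
  refine continuous_of_tsupport fun x hx ↦ ?_
  have hx0 : 0 < x := hs (tsupport_mul_subset_right hx)
  refine ContinuousAt.mul ?_ hφ.continuousAt
  exact Complex.continuous_ofReal.continuousAt.comp
    (continuous_abs.continuousAt.rpow_const (Or.inl (abs_pos.2 hx0.ne').ne'))

theorem enorm_bracket_mul_sq (σ ξ : ℝ) (w : ℂ) :
    ‖(bracket σ ξ : ℂ) * w‖ₑ ^ 2 = ENNReal.ofReal ((1 + ξ ^ 2) ^ σ) * ‖w‖ₑ ^ 2 := by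
  rw [enorm_mul, mul_pow, ← ofReal_norm, Complex.norm_real, Real.norm_eq_abs,
    abs_of_pos (bracket_pos σ ξ), ← ENNReal.ofReal_pow (bracket_pos σ ξ).le, bracket,
    ← Real.rpow_natCast, ← Real.rpow_mul (by positivity)]
  congr 3; push_cast; ring

/-- The full seminorm of φ is bounded by the half-line seminorm and a Hardy term, and the Hardy
inequality absorbs the latter. The half-line seminorm sees only (0,∞), hence does not exceed the
seminorm of any other extension g. The L² part compares in the same way. -/
theorem exists_eLpNorm_bracket_le_of_eq_on_Ioi {σ : ℝ} (h0 : 0 < σ) (h1 : σ < 1)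
    (hσ : σ ≠ 1 / 2) : ∃ C : ℝ≥0, ∀ φ φ' g g' : ℝ → ℂ, Continuous φ → HasCompactSupport φ →
      tsupport φ ⊆ Ioi 0 → IsFourierPair φ φ' → IsFourierPair g g' →
      g =ᵐ[volume.restrict (Ioi 0)] φ →
      eLpNorm (fun ξ ↦ bracket σ ξ * φ' ξ) 2 volume ≤
        C * eLpNorm (fun ξ ↦ bracket σ ξ * g' ξ) 2 volume := by
  set κ := ENNReal.ofReal |1 - 2 ^ (σ - 1 / 2)| with hκ
  have hκ0 : κ ^ 2 ≠ 0 := by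
    rw [hκ]
    refine pow_ne_zero _ (ENNReal.ofReal_pos.2 (abs_pos.2 (sub_ne_zero.2 ?_))).ne'
    intro h
    rcases lt_or_gt_of_ne hσ with h2 | h2
    · exact absurd h.symm (Real.rpow_lt_one_of_one_lt_of_neg one_lt_two (by linarith)).ne
    · exact absurd h (Real.one_lt_rpow one_lt_two (by linarith)).ne
  have hκt : κ ^ 2 ≠ ⊤ := ENNReal.pow_ne_top ENNReal.ofReal_ne_top
  set A : ℝ≥0∞ := 2 * (1 + ENNReal.ofReal (1 / (2 * σ)) *
    ((κ ^ 2)⁻¹ * ENNReal.ofReal (2 ^ (1 + 2 * σ)))) with hA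
  have hAt : A ≠ ⊤ := by
    rw [hA]
    exact ENNReal.mul_ne_top (by norm_num) (ENNReal.add_ne_top.2 ⟨by norm_num,
      ENNReal.mul_ne_top ENNReal.ofReal_ne_top (ENNReal.mul_ne_top (ENNReal.inv_ne_top.2 hκ0)
        ENNReal.ofReal_ne_top)⟩)
  set M : ℝ≥0∞ := 1 + A * ENNReal.ofReal ((2 * Real.pi) ^ (2 * σ)) with hM
  have hMt : M ≠ ⊤ := ENNReal.add_ne_top.2 ⟨by norm_num, ENNReal.mul_ne_top hAt
    ENNReal.ofReal_ne_top⟩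
  have hM1 : 1 ≤ M := le_self_add
  refine ⟨M.toNNReal, fun φ φ' g g' hφ hc hs hφp hgp hae ↦ ?_⟩
  rw [ENNReal.coe_toNNReal hMt]
  have hφ0 : ∀ x ≤ 0, φ x = 0 := fun x hx ↦ by
    by_contra h
    exact absurd (hs (subset_tsupport φ h)) (not_lt.2 hx)
  have hφm := hφ.measurable
  have hN := (memLp_rpow_mul_of_tsupport_subset σ hφ hc hs).2.ne
  have hcst0 := gagliardoConst_ne_zero σ
  have hcstt := gagliardoConst_ne_top h0 h1
  have hGφ := gagliardo_eq (σ := σ) hφp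
  have hGg := gagliardo_eq (σ := σ) hgp
  have hhardy := fractional_hardy h0 hσ hφm hφ0 hN
  have hGH : gagliardoHalf σ φ ≤ gagliardo σ g := by
    rw [← gagliardoHalf_congr σ hae]; exact gagliardoHalf_le_gagliardo σ g
  have hN2 : ∫⁻ x in Ioi 0, ENNReal.ofReal (x ^ (-2 * σ)) * ‖φ x‖ₑ ^ 2 ≤
      (κ ^ 2)⁻¹ * ENNReal.ofReal (2 ^ (1 + 2 * σ)) * gagliardoHalf σ φ := by
    rw [mul_assoc, mul_comm (κ ^ 2)⁻¹, ← div_eq_mul_inv, ENNReal.le_div_iff_mul_le (Or.inl hκ0)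
      (Or.inl hκt), mul_comm]
    exact hhardy
  have hG : gagliardo σ φ ≤ A * gagliardo σ g := by
    refine (gagliardo_le_gagliardoHalf_add h0 hφm hφ0).trans ?_
    rw [hA, mul_assoc 2, add_mul, one_mul, mul_assoc (ENNReal.ofReal _)]
    gcongr
    exact hN2.trans (mul_le_mul_right hGH _)
  have hhom : ∫⁻ ξ, ENNReal.ofReal (|2 * Real.pi * ξ| ^ (2 * σ)) * ‖φ' ξ‖ₑ ^ 2 ≤
      A * ∫⁻ ξ, ENNReal.ofReal (|2 * Real.pi * ξ| ^ (2 * σ)) * ‖g' ξ‖ₑ ^ 2 := by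
    rw [hGφ, hGg, mul_left_comm] at hG
    exact (ENNReal.mul_le_mul_iff_right hcst0 hcstt).1 hG
  have hg' : ∫⁻ ξ, ENNReal.ofReal (|2 * Real.pi * ξ| ^ (2 * σ)) * ‖g' ξ‖ₑ ^ 2 ≤
      ENNReal.ofReal ((2 * Real.pi) ^ (2 * σ)) *
        ∫⁻ ξ, ‖(bracket σ ξ : ℂ) * g' ξ‖ₑ ^ 2 := by
    rw [← lintegral_const_mul' _ _ ENNReal.ofReal_ne_top]
    refine lintegral_mono fun ξ ↦ ?_
    simp only [enorm_bracket_mul_sq]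
    rw [← mul_assoc, ← ENNReal.ofReal_mul (by positivity), abs_mul, abs_of_pos Real.two_pi_pos,
      Real.mul_rpow (by positivity) (by positivity)]
    gcongr
    rw [Real.rpow_mul (abs_nonneg _)]
    gcongr
    rw [Real.rpow_two, sq_abs]; linarith
  have hL2 : ∫⁻ ξ, ‖φ' ξ‖ₑ ^ 2 ≤ ∫⁻ ξ, ‖(bracket σ ξ : ℂ) * g' ξ‖ₑ ^ 2 := by
    calc ∫⁻ ξ, ‖φ' ξ‖ₑ ^ 2 = ∫⁻ x, ‖φ x‖ₑ ^ 2 := by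
          rw [← eLpNorm_two_sq, ← eLpNorm_two_sq, hφp.eLpNorm_eq]
      _ = ∫⁻ x in Ioi 0, ‖φ x‖ₑ ^ 2 := by
          refine (setLIntegral_eq_of_support_subset fun x hx ↦ ?_).symm
          by_contra hx'
          exact hx (by simp [hφ0 x (not_lt.1 hx')])
      _ = ∫⁻ x in Ioi 0, ‖g x‖ₑ ^ 2 := lintegral_congr_ae <| by
          filter_upwards [hae] with x hx; rw [hx]
      _ ≤ ∫⁻ x, ‖g x‖ₑ ^ 2 := setLIntegral_le_lintegral _ _
      _ = ∫⁻ ξ, ‖g' ξ‖ₑ ^ 2 := by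
          rw [← eLpNorm_two_sq, ← eLpNorm_two_sq, hgp.eLpNorm_eq]
      _ ≤ _ := by
          refine lintegral_mono fun ξ ↦ ?_
          simp only [enorm_bracket_mul_sq]
          refine le_mul_of_one_le_left (by positivity) (ENNReal.one_le_ofReal.2 ?_)
          exact Real.one_le_rpow (by nlinarith [sq_nonneg ξ]) h0.le
  have hsq : eLpNorm (fun ξ ↦ bracket σ ξ * φ' ξ) 2 volume ^ 2 ≤
      (M * eLpNorm (fun ξ ↦ bracket σ ξ * g' ξ) 2 volume) ^ 2 := by
    rw [mul_pow, eLpNorm_two_sq, eLpNorm_two_sq]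
    calc _ ≤ ∫⁻ ξ, (‖φ' ξ‖ₑ ^ 2 + ENNReal.ofReal (|2 * Real.pi * ξ| ^ (2 * σ)) * ‖φ' ξ‖ₑ ^ 2) := by
          refine lintegral_mono fun ξ ↦ ?_
          simp only [enorm_bracket_mul_sq]
          conv_rhs => rw [← one_mul (‖φ' ξ‖ₑ ^ 2), ← mul_assoc, ← add_mul, mul_one,
            ← ENNReal.ofReal_one, ← ENNReal.ofReal_add zero_le_one (by positivity)]
          gcongr
          -- Subadditivity of t ↦ t^σ for σ ≤ 1 splits the inhomogeneous weight into its L² and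
          -- homogeneous parts.
          calc (1 + ξ ^ 2) ^ σ ≤ 1 ^ σ + (ξ ^ 2) ^ σ :=
                Real.rpow_add_le_add_rpow zero_le_one (sq_nonneg ξ) h0.le h1.le
            _ ≤ 1 + |2 * Real.pi * ξ| ^ (2 * σ) := by
                rw [Real.one_rpow, Real.rpow_mul (abs_nonneg _), Real.rpow_two, sq_abs]
                refine add_le_add le_rfl (Real.rpow_le_rpow (sq_nonneg ξ) ?_ h0.le)
                rw [mul_pow]
                have : 1 ≤ (2 * Real.pi) ^ 2 := by nlinarith [Real.pi_gt_three]
                nlinarith [sq_nonneg ξ]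
      _ = (∫⁻ ξ, ‖φ' ξ‖ₑ ^ 2) + ∫⁻ ξ, ENNReal.ofReal (|2 * Real.pi * ξ| ^ (2 * σ)) * ‖φ' ξ‖ₑ ^ 2 :=
          lintegral_add_left' (hφp.memLp_right.1.enorm.pow_const 2) _
      _ ≤ M * ∫⁻ ξ, ‖(bracket σ ξ : ℂ) * g' ξ‖ₑ ^ 2 := by
          rw [hM, add_mul, one_mul, mul_assoc]
          gcongr
          exact hhom.trans (mul_le_mul_right hg' _)
      _ ≤ _ := by
          gcongr
          -- As M ≥ 1, it may be replaced by M², which avoids a square root in the constant.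
          exact le_self_pow₀ hM1 (by norm_num)
  exact (ENNReal.pow_right_strictMono (n := 2) (by norm_num)).le_iff_le.1 hsq

/-! ### From test functions to their closure -/

theorem exists_isFourierPair_of_hNormOn_lt {σ : ℝ} {Ω : Set ℝ} {h : ℝ → ℂ} {N : ℝ≥0∞}
    (hN : hNormOn σ Ω h < N) : ∃ g g' : ℝ → ℂ, g =ᵐ[volume.restrict Ω] h ∧ IsFourierPair g g' ∧
      MemLp (fun ξ ↦ bracket σ ξ * g' ξ) 2 volume ∧
      eLpNorm (fun ξ ↦ bracket σ ξ * g' ξ) 2 volume < N := by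
  simp only [hNormOn, iInf_lt_iff] at hN
  obtain ⟨g, hg, hN⟩ := hN
  obtain ⟨g', hgg', hm⟩ := exists_isFourierPair_of_besselNorm_lt_top (hN.trans_le le_top)
  exact ⟨g, g', hg, hgg', hm, by rwa [← besselNorm_two_eq hgg' hm]⟩

theorem one_le_bracket {s : ℝ} (hs : 0 ≤ s) (ξ : ℝ) : 1 ≤ bracket s ξ :=
  Real.one_le_rpow (by nlinarith [sq_nonneg ξ]) (by linarith)

theorem eLpNorm_le_eLpNorm_bracket_mul {s : ℝ} (hs : 0 ≤ s) (g : ℝ → ℂ) (p : ℝ≥0∞) :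
    eLpNorm g p volume ≤ eLpNorm (fun ξ ↦ bracket s ξ * g ξ) p volume := by
  refine eLpNorm_mono fun ξ ↦ ?_
  rw [norm_mul, Complex.norm_real, Real.norm_eq_abs, abs_of_pos (bracket_pos s ξ)]
  exact le_mul_of_one_le_left (norm_nonneg _) (one_le_bracket hs ξ)

theorem exists_subseq_ae_tendsto_of_eLpNorm {f : ℕ → ℝ → ℂ} {g : ℝ → ℂ}
    (hf : ∀ n, AEStronglyMeasurable (f n) volume) (hg : AEStronglyMeasurable g volume)
    (h : Tendsto (fun n ↦ eLpNorm (f n - g) 2 volume) atTop (𝓝 0)) :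
    ∃ ns : ℕ → ℕ, StrictMono ns ∧
      ∀ᵐ x ∂volume, Tendsto (fun i ↦ f (ns i) x) atTop (𝓝 (g x)) :=
  (tendstoInMeasure_of_tendsto_eLpNorm (by norm_num) hf hg h).exists_seq_tendsto_ae

/-- For `σ ≠ 1/2`, the extension by zero is bounded from `H^σ_0(ℝ⁺)` to `H^σ(ℝ)`. -/
theorem exists_eLpNorm_bracket_indicator_le {σ : ℝ} (h0 : 0 < σ) (h1 : σ < 1) (hσ : σ ≠ 1 / 2) :
    ∃ C : ℝ≥0, ∀ h : ℝ → ℂ, MemHZero σ h → ∃ h' : ℝ → ℂ,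
      IsFourierPair ((Ioi (0 : ℝ)).indicator h) h' ∧
      eLpNorm (fun ξ ↦ bracket σ ξ * h' ξ) 2 volume ≤ C * hNormOn σ (Ioi 0) h := by
  obtain ⟨C, hC⟩ := exists_eLpNorm_bracket_le_of_eq_on_Ioi h0 h1 hσ
  refine ⟨C, fun h hh ↦ ?_⟩
  set N := hNormOn σ (Ioi 0) h with hNdef
  set ε : ℕ → ℝ≥0 := fun n ↦ 1 / ((n : ℝ≥0) + 1) with hε
  have hεpos : ∀ n, 0 < ε n := fun n ↦ by simp only [hε]; positivity
  have hεlim : Tendsto (fun n ↦ (ε n : ℝ≥0∞)) atTop (𝓝 0) := by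
    rw [← ENNReal.coe_zero, ENNReal.tendsto_coe]
    exact tendsto_one_div_add_atTop_nhds_zero_nat
  have hlt : ∀ n, N < N + ε n := fun n ↦
    ENNReal.lt_add_right hh.1.ne (ENNReal.coe_pos.2 (hεpos n)).ne'
  choose u u' hu hup hum huN using fun n ↦ exists_isFourierPair_of_hNormOn_lt (hlt n)
  choose φ hφ hφc hφs hφN using fun n ↦ hh.2 (ε n) (ENNReal.coe_pos.2 (hεpos n))
  choose w w' hw hwp hwm hwN using fun n ↦ exists_isFourierPair_of_hNormOn_lt (hφN n)
  have hhm : MemLp ((Ioi (0 : ℝ)).indicator h) 2 volume := by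
    refine (memLp_congr_ae ?_).1 ((hup 0).memLp_left.indicator (measurableSet_Ioi (a := (0 : ℝ))))
    filter_upwards [(ae_restrict_iff' measurableSet_Ioi).1 (hu 0)] with x hx
    simp only [indicator_apply]
    split_ifs with hx'
    · exact hx hx'
    · rfl
  have hφm : ∀ n, MemLp (φ n) 2 volume := fun n ↦
    (hφ n).continuous.memLp_of_hasCompactSupport (hφc n)
  have hφp := fun n ↦ IsFourierPair.of_memLp_left (hφm n)
  set φ' : ℕ → ℝ → ℂ := fun n ↦ ⇑(𝓕 ((hφm n).toLp (φ n)) : Lp ℂ 2 (volume : Measure ℝ)) with hφ'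
  have hhp := IsFourierPair.of_memLp_left hhm
  refine ⟨_, hhp, ?_⟩
  set h' : ℝ → ℂ := ⇑(𝓕 (hhm.toLp _) : Lp ℂ 2 (volume : Measure ℝ)) with hh'
  -- On (0,∞) the difference of a nearly optimal extension `u n` of h and a small extension `w n` of
  -- h - φₙ equals φₙ, so it competes with the extension of φₙ by zero.
  have hbound : ∀ n, eLpNorm (fun ξ ↦ bracket σ ξ * φ' n ξ) 2 volume ≤ C * (N + ε n + ε n) := by
    intro n
    have e1 := hC (φ n) (φ' n) (u n - w n) (u' n - w' n) (hφ n).continuous (hφc n) (hφs n) (hφp n)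
      ((hup n).sub (hwp n)) (by
        filter_upwards [hu n, hw n] with x hx hx'
        simp [hx, hx'])
    refine e1.trans ?_
    gcongr
    calc eLpNorm (fun ξ ↦ bracket σ ξ * (u' n - w' n) ξ) 2 volume
        = eLpNorm ((fun ξ ↦ bracket σ ξ * u' n ξ) - (fun ξ ↦ bracket σ ξ * w' n ξ)) 2 volume := by
          congr 1; funext ξ; simp only [Pi.sub_apply]; ring
      _ ≤ _ := eLpNorm_sub_le (hum n).1 (hwm n).1 (by norm_num)
      _ ≤ _ := add_le_add (huN n).le (hwN n).le
  have hconv : ∀ n, eLpNorm (φ' n - h') 2 volume ≤ ε n := by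
    intro n
    rw [← ((hφp n).sub hhp).eLpNorm_eq]
    calc eLpNorm (φ n - (Ioi (0 : ℝ)).indicator h) 2 volume
        ≤ eLpNorm (w n) 2 volume := by
          refine eLpNorm_mono_ae ?_
          filter_upwards [(ae_restrict_iff' measurableSet_Ioi).1 (hw n)] with x hx
          by_cases hx' : x ∈ Ioi (0 : ℝ)
          · rw [hx hx', Pi.sub_apply, indicator_of_mem hx', Pi.sub_apply, norm_sub_rev]
          · rw [Pi.sub_apply, indicator_of_notMem hx', image_eq_zero_of_notMem_tsupport
              (fun h ↦ hx' (hφs n h))]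
            simp
      _ = eLpNorm (w' n) 2 volume := (hwp n).eLpNorm_eq
      _ ≤ _ := eLpNorm_le_eLpNorm_bracket_mul h0.le _ _
      _ ≤ ε n := (hwN n).le
  obtain ⟨ns, hns, hae⟩ := exists_subseq_ae_tendsto_of_eLpNorm
    (fun n ↦ (hφp n).memLp_right.1) hhp.memLp_right.1
    (tendsto_of_tendsto_of_tendsto_of_le_of_le tendsto_const_nhds hεlim
      (fun _ ↦ zero_le) hconv)
  have hbm : ∀ n, AEStronglyMeasurable (fun ξ ↦ (bracket σ ξ : ℂ) * φ' n ξ) volume := fun n ↦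
    (Complex.continuous_ofReal.comp (continuous_bracket σ)).aestronglyMeasurable.mul
      (hφp n).memLp_right.1
  have hlim : Tendsto (fun n ↦ (C : ℝ≥0∞) * (N + ε n + ε n)) atTop (𝓝 (C * N)) := by
    have := ENNReal.Tendsto.const_mul (a := (C : ℝ≥0∞))
      ((hεlim.const_add N).add hεlim) (Or.inr ENNReal.coe_ne_top)
    simpa using this
  -- L² convergence of the transforms gives almost everywhere convergence along a subsequence, and
  -- Fatou carries the weighted bound to the limit.
  calc eLpNorm (fun ξ ↦ bracket σ ξ * h' ξ) 2 volume
      ≤ liminf (fun i ↦ eLpNorm (fun ξ ↦ bracket σ ξ * φ' (ns i) ξ) 2 volume) atTop := by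
        refine Lp.eLpNorm_lim_le_liminf_eLpNorm (fun i ↦ hbm (ns i)) _ ?_
        filter_upwards [hae] with ξ hξ using hξ.const_mul _
    _ ≤ liminf (fun i ↦ (C : ℝ≥0∞) * (N + ε (ns i) + ε (ns i))) atTop :=
        liminf_le_liminf (.of_forall fun i ↦ hbound (ns i))
    _ = C * N := (hlim.comp hns.tendsto_atTop).liminf_eq

/-! ### The Hardy–Littlewood–Sobolev inequality for the kernel `|t - τ|^{-1/2}` -/

/-- A pointwise bound handles the singularity of the kernel, and Hölder with exponents 4 and 4/3
handles its tail, where y^(-2) is integrable. -/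
theorem setLIntegral_Ioi_rpow_mul_le {g : ℝ → ℝ≥0∞} (hg : Measurable g) {a S : ℝ} (ha : 0 < a)
    (hS : 0 < S) (hga : ∀ y, g y ≤ ENNReal.ofReal a)
    (hgS : ∫⁻ y, g y ^ (4 / 3 : ℝ) ≤ ENNReal.ofReal S) :
    ∫⁻ y in Ioi 0, ENNReal.ofReal (y ^ (-1 / 2 : ℝ)) * g y ≤
      ENNReal.ofReal (3 * (S ^ (1 / 2 : ℝ) * a ^ (1 / 3 : ℝ))) := by
  -- This splitting radius makes both parts multiples of S^(1/2) a^(1/3).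
  set R : ℝ := S * a ^ (-4 / 3 : ℝ) with hR
  have hR0 : 0 < R := by positivity
  rw [← Ioc_union_Ioi_eq_Ioi hR0.le, lintegral_union measurableSet_Ioi (Ioc_disjoint_Ioi le_rfl)]
  have h1 : ∫⁻ y in Ioc 0 R, ENNReal.ofReal (y ^ (-1 / 2 : ℝ)) * g y ≤
      ENNReal.ofReal (2 * (S ^ (1 / 2 : ℝ) * a ^ (1 / 3 : ℝ))) := by
    calc _ ≤ ∫⁻ y in Ioc 0 R, ENNReal.ofReal (y ^ (-1 / 2 : ℝ)) * ENNReal.ofReal a :=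
          lintegral_mono fun y ↦ mul_le_mul_right (hga y) _
      _ = _ := by
          rw [lintegral_mul_const _ (by fun_prop), setLIntegral_Ioc_rpow (by norm_num) hR0.le,
            ← ENNReal.ofReal_mul (by positivity)]
          congr 1
          rw [show (-1 / 2 + 1 : ℝ) = 1 / 2 by norm_num, hR, Real.mul_rpow hS.le (by positivity),
            ← Real.rpow_mul ha.le, show (1 / 3 : ℝ) = -4 / 3 * (1 / 2) + 1 by norm_num,
            Real.rpow_add ha, Real.rpow_one]
          ring
  have h2 : ∫⁻ y in Ioi R, ENNReal.ofReal (y ^ (-1 / 2 : ℝ)) * g y ≤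
      ENNReal.ofReal (S ^ (1 / 2 : ℝ) * a ^ (1 / 3 : ℝ)) := by
    have hpq : Real.HolderConjugate 4 (4 / 3) := by
      rw [Real.holderConjugate_iff]; norm_num
    refine (ENNReal.lintegral_mul_le_Lp_mul_Lq _ hpq (by fun_prop) hg.aemeasurable).trans ?_
    have h3 : ∫⁻ y in Ioi R, ENNReal.ofReal (y ^ (-1 / 2 : ℝ)) ^ (4 : ℝ) = ENNReal.ofReal R⁻¹ := by
      rw [← show ENNReal.ofReal (-R ^ (-2 + 1 : ℝ) / (-2 + 1)) = ENNReal.ofReal R⁻¹ by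
        norm_num [Real.rpow_neg_one], ← setLIntegral_Ioi_rpow (by norm_num) hR0]
      refine setLIntegral_congr_fun measurableSet_Ioi fun y hy ↦ ?_
      have hy0 : 0 < y := hR0.trans hy
      rw [ENNReal.ofReal_rpow_of_pos (by positivity), ← Real.rpow_mul hy0.le]
      norm_num
    calc _ ≤ ENNReal.ofReal R⁻¹ ^ (1 / 4 : ℝ) * ENNReal.ofReal S ^ (1 / (4 / 3) : ℝ) := by
          rw [h3]
          gcongr
          exact (setLIntegral_le_lintegral _ _).trans hgS
      _ = _ := by
          rw [ENNReal.ofReal_rpow_of_pos (by positivity), ENNReal.ofReal_rpow_of_pos hS,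
            ← ENNReal.ofReal_mul (by positivity)]
          congr 1
          rw [Real.inv_rpow hR0.le, hR, Real.mul_rpow hS.le (by positivity), mul_inv,
            ← Real.rpow_neg hS.le, ← Real.rpow_mul ha.le, ← Real.rpow_neg ha.le, mul_right_comm,
            ← Real.rpow_add hS]
          norm_num
  refine (add_le_add h1 h2).trans (le_of_eq ?_)
  rw [← ENNReal.ofReal_add (by positivity) (by positivity)]
  congr 1; ring

theorem lintegral_rpow_abs_mul_le {g : ℝ → ℝ≥0∞} (hg : Measurable g) {a S : ℝ} (ha : 0 < a)
    (hS : 0 < S) (hga : ∀ y, g y ≤ ENNReal.ofReal a)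
    (hgS : ∫⁻ y, g y ^ (4 / 3 : ℝ) ≤ ENNReal.ofReal S) (t : ℝ) :
    ∫⁻ τ, ENNReal.ofReal (|t - τ| ^ (-1 / 2 : ℝ)) * g τ ≤
      ENNReal.ofReal (6 * (S ^ (1 / 2 : ℝ) * a ^ (1 / 3 : ℝ))) := by
  rw [← lintegral_add_right_eq_self _ t, lintegral_eq_Ioi_add_Ioi_neg]
  have h1 := setLIntegral_Ioi_rpow_mul_le (g := fun y ↦ g (y + t)) (by fun_prop) ha hS
    (fun y ↦ hga _) (by rwa [lintegral_add_right_eq_self (fun y ↦ g y ^ (4 / 3 : ℝ))])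
  have h2 := setLIntegral_Ioi_rpow_mul_le (g := fun y ↦ g (-y + t)) (by fun_prop) ha hS
    (fun y ↦ hga _) (by
      rwa [lintegral_neg_eq_self (fun y ↦ g (y + t) ^ (4 / 3 : ℝ)),
        lintegral_add_right_eq_self (fun y ↦ g y ^ (4 / 3 : ℝ))])
  refine (add_le_add (le_trans (le_of_eq ?_) h1) (le_trans (le_of_eq ?_) h2)).trans (le_of_eq ?_)
  · refine setLIntegral_congr_fun measurableSet_Ioi fun y hy ↦ ?_
    simp only [sub_add_cancel_right, abs_neg, abs_of_pos (show (0 : ℝ) < y from hy)]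
  · refine setLIntegral_congr_fun measurableSet_Ioi fun y hy ↦ ?_
    simp only [sub_add_cancel_right, abs_neg, abs_of_pos (show (0 : ℝ) < y from hy)]
  · rw [← ENNReal.ofReal_add (by positivity) (by positivity)]
    congr 1; ring

/-- The quadratic form of the Hardy–Littlewood–Sobolev inequality on the line, for the
kernel `|t - τ|^{-1/2}`. -/
theorem hardy_littlewood_sobolev_quadratic {f : ℝ → ℝ} (hf : Measurable f) (hf0 : ∀ t, 0 ≤ f t) :
    ∫⁻ t, ∫⁻ τ, ENNReal.ofReal (|t - τ| ^ (-1 / 2 : ℝ)) *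
        (ENNReal.ofReal (f t) * ENNReal.ofReal (f τ)) ≤
      12 * (∫⁻ t, ENNReal.ofReal (f t) ^ (4 / 3 : ℝ)) ^ (3 / 2 : ℝ) := by
  set S := ∫⁻ t, ENNReal.ofReal (f t) ^ (4 / 3 : ℝ) with hSdef
  rcases eq_or_ne S ⊤ with hSt | hSt
  · rw [hSt, ENNReal.top_rpow_of_pos (by norm_num)]; simp
  rcases eq_or_ne S 0 with hS0 | hS0
  · rw [hSdef, lintegral_eq_zero_iff (by fun_prop)] at hS0
    refine le_of_eq_of_le (lintegral_eq_zero_of_ae_eq_zero ?_) zero_le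
    filter_upwards [hS0] with t ht
    have : ENNReal.ofReal (f t) = 0 := by
      simpa using (ENNReal.rpow_eq_zero_iff_of_pos (by norm_num)).1 ht
    simp [this]
  have hSr : 0 < S.toReal := ENNReal.toReal_pos hS0 hSt
  -- The form is cut down to f(τ) ≤ f(t), so that f(t) serves as the pointwise bound of the inner
  -- function. The inner integral is then at most 6 S^(1/2) f(t)^(1/3), and the outer factor f(t)
  -- completes the power 4/3. By symmetry the whole form is at most twice this half.
  set k : ℝ → ℝ → ℝ≥0∞ := fun t τ ↦ ENNReal.ofReal (|t - τ| ^ (-1 / 2 : ℝ)) *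
    (ENNReal.ofReal (f t) * ({p : ℝ × ℝ | f p.2 ≤ f p.1}.indicator
      (fun p ↦ ENNReal.ofReal (f p.2)) (t, τ))) with hk
  have hind : Measurable ({p : ℝ × ℝ | f p.2 ≤ f p.1}.indicator
      (fun p ↦ ENNReal.ofReal (f p.2))) :=
    Measurable.indicator (by fun_prop) (measurableSet_le (by fun_prop) (by fun_prop))
  have hkm : Measurable (Function.uncurry k) := by
    simp only [hk, Function.uncurry_def]; fun_prop
  have hhalf : ∫⁻ t, ∫⁻ τ, k t τ ≤ 6 * S ^ (3 / 2 : ℝ) := by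
    calc ∫⁻ t, ∫⁻ τ, k t τ ≤ ∫⁻ t, (6 * S ^ (1 / 2 : ℝ)) * ENNReal.ofReal (f t) ^ (4 / 3 : ℝ) := by
          refine lintegral_mono fun t ↦ ?_
          rcases (hf0 t).eq_or_lt with h0 | h0
          · simp [hk, ← h0]
          have h1 := lintegral_rpow_abs_mul_le
            (g := fun τ ↦ {p : ℝ × ℝ | f p.2 ≤ f p.1}.indicator
              (fun p ↦ ENNReal.ofReal (f p.2)) (t, τ)) (by fun_prop) h0 hSr (fun τ ↦ by
                simp only [indicator_apply, mem_ofPred_eq]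
                split_ifs with h
                · exact ENNReal.ofReal_le_ofReal h
                · exact zero_le) (by
                rw [ENNReal.ofReal_toReal hSt]
                refine lintegral_mono fun τ ↦ ?_
                gcongr
                simp only [indicator_apply]
                split_ifs with h
                · exact le_rfl
                · exact zero_le) t
          simp only [hk]
          simp_rw [mul_left_comm _ (ENNReal.ofReal (f t))]
          rw [lintegral_const_mul _ (by fun_prop)]
          refine (mul_le_mul_right h1 _).trans (le_of_eq ?_)
          rw [ENNReal.ofReal_mul (by norm_num), ENNReal.ofReal_mul (by positivity),
            ← ENNReal.ofReal_rpow_of_pos hSr, ENNReal.ofReal_toReal hSt,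
            ← ENNReal.ofReal_rpow_of_pos h0, show (4 / 3 : ℝ) = 1 / 3 + 1 by norm_num,
            ENNReal.rpow_add _ _ (ENNReal.ofReal_pos.2 h0).ne' ENNReal.ofReal_ne_top,
            ENNReal.rpow_one]
          norm_num
          ring
      _ = _ := by
          rw [lintegral_const_mul _ (by fun_prop), ← hSdef, mul_assoc]
          congr 1
          rw [show (3 / 2 : ℝ) = 1 / 2 + 1 by norm_num, ENNReal.rpow_add _ _ hS0 hSt,
            ENNReal.rpow_one]
  calc _ ≤ ∫⁻ t, ∫⁻ τ, (k t τ + k τ t) := by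
        refine lintegral_mono fun t ↦ lintegral_mono fun τ ↦ ?_
        simp only [hk, indicator_apply, mem_ofPred_eq]
        rcases le_total (f t) (f τ) with h | h
        · rw [if_pos h]
          refine le_trans (le_of_eq ?_) le_add_self
          rw [abs_sub_comm, mul_comm (ENNReal.ofReal (f t))]
        · rw [if_pos h]; exact le_self_add
    _ = (∫⁻ t, ∫⁻ τ, k t τ) + ∫⁻ t, ∫⁻ τ, k τ t := by
        rw [← lintegral_add_left (show Measurable fun t ↦ ∫⁻ τ, k t τ from
          Measurable.lintegral_prod_right' hkm)]
        refine lintegral_congr fun t ↦ lintegral_add_left (hkm.comp measurable_prodMk_left) _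
    _ = (∫⁻ t, ∫⁻ τ, k t τ) + ∫⁻ t, ∫⁻ τ, k t τ := by
        congr 1
        exact lintegral_lintegral_swap (hkm.comp measurable_swap).aemeasurable
    _ ≤ 6 * S ^ (3 / 2 : ℝ) + 6 * S ^ (3 / 2 : ℝ) := add_le_add hhalf hhalf
    _ = _ := by rw [← add_mul]; norm_num

/-! ### The `L⁴L^∞` Strichartz estimate -/

/-- In the explicit Gaussian formula the exponential has modulus at most 1, because 1/(ε + it) has
nonnegative real part, and the prefactor is controlled by |ε + it| ≥ |t|. This is the dispersive
decay, uniform in ε. -/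
theorem norm_integral_gaussian_le {ε : ℝ} (hε : 0 < ε) {t : ℝ} (ht : t ≠ 0) (x : ℝ) :
    ‖∫ ξ : ℝ, Complex.exp (Complex.I * x * ξ) * Complex.exp (-(ε + Complex.I * t) * ξ ^ 2)‖ ≤
      Real.sqrt Real.pi * |t| ^ (-1 / 2 : ℝ) := by
  have hre : 0 < ((ε : ℂ) + Complex.I * t).re := by simpa using hε
  have hb : (ε : ℂ) + Complex.I * t ≠ 0 := fun h ↦ by rw [h] at hre; simp at hre
  rw [fourierIntegral_gaussian hre, norm_mul]
  have h1 : ‖Complex.exp (-(x : ℂ) ^ 2 / (4 * (ε + Complex.I * t)))‖ ≤ 1 := by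
    rw [Complex.norm_exp, Real.exp_le_one_iff]
    have : (-(x : ℂ) ^ 2 / (4 * (ε + Complex.I * t))).re =
        -x ^ 2 / 4 * ((ε : ℂ) + Complex.I * t)⁻¹.re := by
      rw [show (-(x : ℂ) ^ 2 / (4 * (ε + Complex.I * t))) =
        ((-x ^ 2 / 4 : ℝ) : ℂ) * ((ε : ℂ) + Complex.I * t)⁻¹ by push_cast; field_simp,
        Complex.re_ofReal_mul]
    rw [this, Complex.inv_re]
    have := div_nonneg hre.le (Complex.normSq_nonneg ((ε : ℂ) + Complex.I * t))
    nlinarith [sq_nonneg x]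
  have h2 : ‖((Real.pi : ℂ) / (ε + Complex.I * t)) ^ (1 / 2 : ℂ)‖ ≤
      Real.sqrt Real.pi * |t| ^ (-1 / 2 : ℝ) := by
    have : (1 / 2 : ℂ) = ((1 / 2 : ℝ) : ℂ) := by push_cast; rfl
    rw [this, Complex.norm_cpow_real, norm_div, Complex.norm_real, Real.norm_eq_abs,
      abs_of_pos Real.pi_pos, Real.div_rpow Real.pi_pos.le (norm_nonneg _), Real.sqrt_eq_rpow,
      div_eq_mul_inv, ← Real.rpow_neg (norm_nonneg _), neg_div]
    gcongr ?_ * ?_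
    refine Real.rpow_le_rpow_of_nonpos (abs_pos.2 ht) ?_ (by norm_num)
    calc |t| = |((ε : ℂ) + Complex.I * t).im| := by simp
      _ ≤ _ := Complex.abs_im_le_norm _
  calc _ ≤ Real.sqrt Real.pi * |t| ^ (-1 / 2 : ℝ) * 1 := by gcongr
    _ = _ := mul_one _

/-- The phase `e^{i(xξ - tξ²)}` of the free Schrödinger evolution. -/
def schrodingerPhase (t x ξ : ℝ) : ℂ := Complex.exp (Complex.I * ((x * ξ - t * ξ ^ 2 : ℝ) : ℂ))

@[simp]
theorem norm_schrodingerPhase (t x ξ : ℝ) : ‖schrodingerPhase t x ξ‖ = 1 := by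
  rw [schrodingerPhase, mul_comm, Complex.norm_exp_ofReal_mul_I]

theorem continuous_schrodingerPhase :
    Continuous fun p : ℝ × ℝ × ℝ ↦ schrodingerPhase p.1 p.2.1 p.2.2 := by
  unfold schrodingerPhase; fun_prop

@[fun_prop]
theorem measurable_schrodingerPhase_comp {α : Type*} [MeasurableSpace α] {t x ξ : α → ℝ}
    (ht : Measurable t) (hx : Measurable x) (hξ : Measurable ξ) :
    Measurable fun a ↦ schrodingerPhase (t a) (x a) (ξ a) := by
  unfold schrodingerPhase; fun_prop

/-- The `TT*` estimate: the adjoint of the evolution, along an arbitrary measurable choice of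
positions, is bounded from `L^{4/3}` to `L²` with Gaussian weights, uniformly in the weight. -/
theorem lintegral_adjoint_sq_le {a : ℝ → ℂ} (ha : Measurable a) (hai : Integrable a volume)
    {X : ℝ → ℝ} (hX : Measurable X) {ε : ℝ} (hε : 0 < ε) :
    ∫⁻ ξ, ENNReal.ofReal (Real.exp (-ε * ξ ^ 2)) *
        ‖∫ t, a t * schrodingerPhase t (X t) ξ‖ₑ ^ 2 ≤
      ENNReal.ofReal (12 * Real.sqrt Real.pi) *
        (∫⁻ t, ‖a t‖ₑ ^ (4 / 3 : ℝ)) ^ (3 / 2 : ℝ) := by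
  set A : ℝ → ℂ := fun ξ ↦ ∫ t, a t * schrodingerPhase t (X t) ξ with hA
  set F : ℝ → ℝ × ℝ → ℂ := fun ξ p ↦ (Real.exp (-ε * ξ ^ 2) : ℂ) *
    ((a p.1 * schrodingerPhase p.1 (X p.1) ξ) *
      conj (a p.2 * schrodingerPhase p.2 (X p.2) ξ)) with hF
  have hAbd : ∀ ξ, ‖A ξ‖ ≤ ∫ t, ‖a t‖ := fun ξ ↦ by
    refine (norm_integral_le_integral_norm _).trans (le_of_eq ?_)
    simp
  have hAm : Measurable A := by
    have : StronglyMeasurable fun p : ℝ × ℝ ↦ a p.2 * schrodingerPhase p.2 (X p.2) p.1 :=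
      Measurable.stronglyMeasurable (by fun_prop)
    exact this.integral_prod_right'.measurable
  have hgauss : Integrable (fun ξ : ℝ ↦ Real.exp (-ε * ξ ^ 2)) volume := integrable_exp_neg_mul_sq hε
  have hFint : ∀ ξ, ∫ p, F ξ p ∂(volume.prod volume) =
      (Real.exp (-ε * ξ ^ 2) * ‖A ξ‖ ^ 2 : ℝ) := fun ξ ↦ by
    simp only [hF]
    rw [integral_const_mul, integral_prod_mul (fun t ↦ a t * schrodingerPhase t (X t) ξ)
      (fun t ↦ conj (a t * schrodingerPhase t (X t) ξ)), integral_conj, Complex.mul_conj,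
      Complex.normSq_eq_norm_sq]
    push_cast; rfl
  have hFm : Measurable (Function.uncurry F) := by
    simp only [hF, Function.uncurry_def]
    fun_prop
  have hFi : Integrable (Function.uncurry F) (volume.prod (volume.prod volume)) := by
    refine (hgauss.mul_prod (hai.norm.mul_prod hai.norm)).mono' hFm.aestronglyMeasurable
      (.of_forall fun p ↦ ?_)
    simp only [hF, Function.uncurry_def, norm_mul, RCLike.norm_conj, norm_schrodingerPhase, mul_one,
      Complex.norm_real, Real.norm_eq_abs, Real.abs_exp]
    exact le_rfl
  have hswap := integral_integral_swap hFi
  simp only [hFint] at hswap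
  have hinner : ∀ p : ℝ × ℝ, p.1 - p.2 ≠ 0 → ‖∫ ξ, F ξ p‖ₑ ≤
      ENNReal.ofReal (Real.sqrt Real.pi) * (ENNReal.ofReal (|p.1 - p.2| ^ (-1 / 2 : ℝ)) *
        (ENNReal.ofReal ‖a p.1‖ * ENNReal.ofReal ‖a p.2‖)) := fun p hp ↦ by
    -- For fixed times, the product of the two phases is a quadratic phase with parameters X(t) -
    -- X(τ) and t - τ, so the dispersive bound applies whatever the positions are.
    have h1 : ∫ ξ, F ξ p = a p.1 * conj (a p.2) * ∫ ξ : ℝ,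
        Complex.exp (Complex.I * ((X p.1 - X p.2 : ℝ) : ℂ) * ξ) *
          Complex.exp (-(ε + Complex.I * ((p.1 - p.2 : ℝ) : ℂ)) * ξ ^ 2) := by
      rw [← integral_const_mul]
      refine integral_congr_ae (.of_forall fun ξ ↦ ?_)
      simp only [hF, map_mul, schrodingerPhase, ← Complex.exp_conj, Complex.conj_I,
        Complex.conj_ofReal, Complex.ofReal_exp]
      rw [mul_mul_mul_comm (a p.1), mul_left_comm, ← Complex.exp_add, ← Complex.exp_add,
        ← Complex.exp_add]
      congr 2
      push_cast; ring
    rw [h1, ← ofReal_norm, norm_mul, norm_mul, RCLike.norm_conj, ← ENNReal.ofReal_mul (by positivity),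
      ← ENNReal.ofReal_mul (by positivity), ← ENNReal.ofReal_mul (by positivity)]
    refine ENNReal.ofReal_le_ofReal ?_
    have := norm_integral_gaussian_le hε hp (X p.1 - X p.2)
    calc _ ≤ ‖a p.1‖ * ‖a p.2‖ * (Real.sqrt Real.pi * |p.1 - p.2| ^ (-1 / 2 : ℝ)) := by gcongr
      _ = _ := by ring
  have hne : ∀ᵐ p : ℝ × ℝ ∂(volume.prod volume), p.1 - p.2 ≠ 0 := by
    have hm : MeasurableSet {p : ℝ × ℝ | p.1 - p.2 ≠ 0} :=
      (measurableSet_eq_fun (by fun_prop) measurable_const).compl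
    rw [Measure.ae_prod_iff_ae_ae hm]
    refine .of_forall fun t ↦ ?_
    filter_upwards [Measure.ae_ne volume t] with τ hτ
    exact sub_ne_zero.2 hτ.symm
  calc _ = ∫⁻ ξ, ENNReal.ofReal (Real.exp (-ε * ξ ^ 2) * ‖A ξ‖ ^ 2) := by
        refine lintegral_congr fun ξ ↦ ?_
        rw [ENNReal.ofReal_mul (Real.exp_pos _).le, ENNReal.ofReal_pow (norm_nonneg _), ofReal_norm]
    _ = ENNReal.ofReal (∫ ξ, Real.exp (-ε * ξ ^ 2) * ‖A ξ‖ ^ 2) := by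
        refine (ofReal_integral_eq_lintegral_ofReal ?_ (.of_forall fun ξ ↦ by positivity)).symm
        refine hgauss.mul_bdd (c := (∫ t, ‖a t‖) ^ 2) (by fun_prop) (.of_forall fun ξ ↦ ?_)
        rw [Real.norm_eq_abs, abs_of_nonneg (by positivity)]
        have := hAbd ξ
        gcongr
    _ = ‖∫ ξ, ((Real.exp (-ε * ξ ^ 2) * ‖A ξ‖ ^ 2 : ℝ) : ℂ)‖ₑ := by
        rw [integral_complex_ofReal, ← ofReal_norm, Complex.norm_real, Real.norm_eq_abs, abs_of_nonneg]
        exact integral_nonneg fun ξ ↦ by positivity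
    _ ≤ ∫⁻ p, ‖∫ ξ, F ξ p‖ₑ ∂(volume.prod volume) := by
        rw [hswap]; exact enorm_integral_le_lintegral_enorm _
    _ ≤ ∫⁻ p : ℝ × ℝ, ENNReal.ofReal (Real.sqrt Real.pi) *
        (ENNReal.ofReal (|p.1 - p.2| ^ (-1 / 2 : ℝ)) *
        (ENNReal.ofReal ‖a p.1‖ * ENNReal.ofReal ‖a p.2‖)) ∂(volume.prod volume) := by
        refine lintegral_mono_ae ?_
        filter_upwards [hne] with p hp using hinner p hp
    _ = ENNReal.ofReal (Real.sqrt Real.pi) * ∫⁻ t, ∫⁻ τ,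
        (ENNReal.ofReal (|t - τ| ^ (-1 / 2 : ℝ)) *
        (ENNReal.ofReal ‖a t‖ * ENNReal.ofReal ‖a τ‖)) := by
        rw [lintegral_const_mul' _ _ ENNReal.ofReal_ne_top,
          lintegral_prod _ (Measurable.aemeasurable (by fun_prop))]
    _ ≤ ENNReal.ofReal (Real.sqrt Real.pi) *
        (12 * (∫⁻ t, ENNReal.ofReal ‖a t‖ ^ (4 / 3 : ℝ)) ^ (3 / 2 : ℝ)) :=
        mul_le_mul_right (hardy_littlewood_sobolev_quadratic ha.norm fun t ↦ norm_nonneg _) _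
    _ = _ := by
        simp only [ofReal_norm]
        rw [ENNReal.ofReal_mul (by norm_num), ← mul_assoc, mul_comm (ENNReal.ofReal 12)]
        norm_num

theorem lintegral_mul_sq_le {α : Type*} {m : MeasurableSpace α} (μ : Measure α) {f g : α → ℝ≥0∞}
    (hf : AEMeasurable f μ) (hg : AEMeasurable g μ) :
    (∫⁻ x, f x * g x ∂μ) ^ 2 ≤ (∫⁻ x, f x ^ 2 ∂μ) * ∫⁻ x, g x ^ 2 ∂μ := by
  have h := ENNReal.lintegral_mul_le_Lp_mul_Lq μ Real.HolderConjugate.two_two hf hg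
  refine (pow_le_pow_left₀ zero_le h 2).trans (le_of_eq ?_)
  simp only [ENNReal.rpow_two, mul_pow, ← ENNReal.rpow_natCast, ← ENNReal.rpow_mul]
  norm_num

/-- The free Schrödinger evolution `∫ e^{i(xξ - tξ²)} μ(ξ) dξ`. -/
def schrodingerEvolution (μ : ℝ → ℂ) (t x : ℝ) : ℂ := ∫ ξ, schrodingerPhase t x ξ * μ ξ

theorem norm_schrodingerEvolution_le (μ : ℝ → ℂ) (t x : ℝ) :
    ‖schrodingerEvolution μ t x‖ ≤ ∫ ξ, ‖μ ξ‖ :=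
  (norm_integral_le_integral_norm _).trans (le_of_eq (by simp))

theorem continuous_schrodingerEvolution {μ : ℝ → ℂ} (hμ : Integrable μ volume) :
    Continuous fun p : ℝ × ℝ ↦ schrodingerEvolution μ p.1 p.2 := by
  refine continuous_of_dominated (bound := fun ξ ↦ ‖μ ξ‖) (fun p ↦ ?_) (fun p ↦ ?_) hμ.norm ?_
  · exact (Measurable.aestronglyMeasurable (by fun_prop)).mul hμ.1
  · exact .of_forall fun ξ ↦ by simp
  · refine .of_forall fun ξ ↦ ?_
    have : Continuous fun p : ℝ × ℝ ↦ schrodingerPhase p.1 p.2 ξ :=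
      continuous_schrodingerPhase.comp (f := fun p : ℝ × ℝ ↦ (p.1, p.2, ξ)) (by fun_prop)
    exact this.mul continuous_const

theorem measurable_schrodingerEvolution_comp {μ : ℝ → ℂ} (hμ : Integrable μ volume) {X : ℝ → ℝ}
    (hX : Measurable X) : Measurable fun t ↦ schrodingerEvolution μ t (X t) :=
  (continuous_schrodingerEvolution hμ).measurable.comp (f := fun t : ℝ ↦ (t, X t))
    (measurable_id.prodMk hX)

/-- The constant of the `L⁴L^∞` Strichartz estimate. -/
def strichartzConst : ℝ≥0∞ :=
  (ENNReal.ofReal (Real.exp 1) * ENNReal.ofReal (12 * Real.sqrt Real.pi)) ^ 2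

theorem strichartzConst_ne_top : strichartzConst ≠ ⊤ :=
  ENNReal.pow_ne_top (ENNReal.mul_ne_top ENNReal.ofReal_ne_top ENNReal.ofReal_ne_top)

/-- Duality with the density conj(w)|w|²: its pairing with w and the integral of the 4/3 power of
its modulus both equal P = ∫|w|⁴. Cauchy–Schwarz on the Fourier side and the adjoint bound give P² ≤
c‖μ‖₂² P^(3/2). The truncation to [-M,M] makes P finite, so that P^(3/2) can be cancelled. -/
theorem setLIntegral_evolution_along_le {μ : ℝ → ℂ} (hμm : Measurable μ)
    (hμ : Integrable μ volume) {n : ℝ} (hn : 0 < n) (hsupp : ∀ ξ, n < |ξ| → μ ξ = 0) {X : ℝ → ℝ}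
    (hX : Measurable X) (M : ℝ) :
    ∫⁻ t in Icc (-M) M, ‖schrodingerEvolution μ t (X t)‖ₑ ^ 4 ≤
      strichartzConst * (∫⁻ ξ, ‖μ ξ‖ₑ ^ 2) ^ 2 := by
  set w : ℝ → ℂ := fun t ↦ schrodingerEvolution μ t (X t) with hw
  have hwm : Measurable w := measurable_schrodingerEvolution_comp hμ hX
  set B := ∫ ξ, ‖μ ξ‖ with hB
  have hwB : ∀ t, ‖w t‖ ≤ B := fun t ↦ norm_schrodingerEvolution_le μ t (X t)
  set a : ℝ → ℂ := (Icc (-M) M).indicator fun t ↦ conj (w t) * (‖w t‖ ^ 2 : ℝ) with ha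
  have ham : Measurable a := Measurable.indicator (by fun_prop) measurableSet_Icc
  have hai : Integrable a volume := by
    rw [ha, integrable_indicator_iff measurableSet_Icc]
    refine Measure.integrableOn_of_bounded (M := B * B ^ 2) (by simp)
      (Measurable.aestronglyMeasurable (by fun_prop)) (.of_forall fun t ↦ ?_)
    rw [norm_mul, RCLike.norm_conj, Complex.norm_real, Real.norm_eq_abs, abs_of_nonneg (by positivity)]
    have := hwB t
    gcongr
  set P := ∫⁻ t in Icc (-M) M, ‖w t‖ₑ ^ 4 with hP
  have hPt : P ≠ ⊤ := by
    refine ne_top_of_le_ne_top (b := ∫⁻ t in Icc (-M) M, ENNReal.ofReal B ^ 4) ?_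
      (lintegral_mono fun t ↦ ?_)
    · rw [setLIntegral_const]
      exact ENNReal.mul_ne_top (ENNReal.pow_ne_top ENNReal.ofReal_ne_top) (by simp)
    · gcongr
      rw [← ofReal_norm]
      exact ENNReal.ofReal_le_ofReal (hwB t)
  have haP : ∫⁻ t, ‖a t‖ₑ ^ (4 / 3 : ℝ) = P := by
    rw [hP, ← lintegral_indicator measurableSet_Icc]
    refine lintegral_congr fun t ↦ ?_
    simp only [ha, indicator_apply]
    split_ifs with h
    · rw [← ofReal_norm, norm_mul, RCLike.norm_conj, Complex.norm_real, Real.norm_eq_abs,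
        abs_of_nonneg (by positivity), ← pow_succ', ENNReal.ofReal_pow (norm_nonneg _), ofReal_norm,
        ← ENNReal.rpow_natCast, ← ENNReal.rpow_mul, ← ENNReal.rpow_natCast]
      norm_num
    · simp
  set A : ℝ → ℂ := fun ξ ↦ ∫ t, a t * schrodingerPhase t (X t) ξ with hA
  have hAm : Measurable A := by
    have : StronglyMeasurable fun p : ℝ × ℝ ↦ a p.2 * schrodingerPhase p.2 (X p.2) p.1 :=
      Measurable.stronglyMeasurable (by fun_prop)
    exact this.integral_prod_right'.measurable
  -- On the support |ξ| ≤ n of μ the inverse Gaussian weight is at most e, so the final constant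
  -- does not depend on n.
  set ε : ℝ := 1 / n ^ 2 with hε
  have hε0 : 0 < ε := by positivity
  have hTT := lintegral_adjoint_sq_le ham hai hX hε0
  rw [haP] at hTT
  have hpair : ∫ t, a t * w t = ∫ ξ, μ ξ * A ξ := by
    have hi : Integrable (Function.uncurry fun t ξ : ℝ ↦
        a t * (schrodingerPhase t (X t) ξ * μ ξ)) (volume.prod volume) := by
      refine (hai.norm.mul_prod hμ.norm).mono'
        (Measurable.aestronglyMeasurable (by simp only [Function.uncurry_def]; fun_prop))
        (.of_forall fun p ↦ ?_)
      simp [Function.uncurry_def]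
    have := integral_integral_swap hi
    simp only [hw, schrodingerEvolution, hA, ← integral_const_mul]
    rw [this]
    refine integral_congr_ae (.of_forall fun ξ ↦ integral_congr_ae (.of_forall fun t ↦ ?_))
    simp only; ring
  have hPle : P ≤ ∫⁻ ξ, ‖μ ξ‖ₑ * ‖A ξ‖ₑ := by
    have h1 : ∫ t, a t * w t = ((∫ t in Icc (-M) M, ‖w t‖ ^ 4 : ℝ) : ℂ) := by
      rw [← integral_complex_ofReal, ← integral_indicator measurableSet_Icc]
      refine integral_congr_ae (.of_forall fun t ↦ ?_)
      simp only [ha, indicator_apply]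
      split_ifs
      · rw [mul_right_comm, Complex.conj_mul']; push_cast; ring
      · simp
    have h2 : P = ENNReal.ofReal (∫ t in Icc (-M) M, ‖w t‖ ^ 4) := by
      rw [ofReal_integral_eq_lintegral_ofReal]
      · refine lintegral_congr fun t ↦ ?_
        rw [ENNReal.ofReal_pow (norm_nonneg _), ofReal_norm]
      · refine Measure.integrableOn_of_bounded (M := B ^ 4) (by simp)
          (Measurable.aestronglyMeasurable (by fun_prop)) (.of_forall fun t ↦ ?_)
        rw [Real.norm_eq_abs, abs_of_nonneg (by positivity)]
        have := hwB t
        gcongr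
      · exact .of_forall fun t ↦ by positivity
    calc P = ‖∫ t, a t * w t‖ₑ := by
          rw [h1, h2, ← ofReal_norm, Complex.norm_real, Real.norm_eq_abs, abs_of_nonneg]
          exact integral_nonneg fun t ↦ by positivity
      _ ≤ ∫⁻ ξ, ‖μ ξ * A ξ‖ₑ := by rw [hpair]; exact enorm_integral_le_lintegral_enorm _
      _ = _ := by simp only [enorm_mul]
  have hsq : P ^ 2 ≤ (ENNReal.ofReal (Real.exp 1) * ∫⁻ ξ, ‖μ ξ‖ₑ ^ 2) *
      (ENNReal.ofReal (12 * Real.sqrt Real.pi) * P ^ (3 / 2 : ℝ)) := by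
    have h1 : ∫⁻ ξ, ‖μ ξ‖ₑ * ‖A ξ‖ₑ = ∫⁻ ξ, (ENNReal.ofReal (Real.exp (ε * ξ ^ 2 / 2)) * ‖μ ξ‖ₑ) *
        (ENNReal.ofReal (Real.exp (-ε * ξ ^ 2 / 2)) * ‖A ξ‖ₑ) := by
      refine lintegral_congr fun ξ ↦ ?_
      rw [mul_mul_mul_comm, ← ENNReal.ofReal_mul (Real.exp_pos _).le, ← Real.exp_add]
      ring_nf
      simp
    calc P ^ 2 ≤ (∫⁻ ξ, ‖μ ξ‖ₑ * ‖A ξ‖ₑ) ^ 2 := pow_le_pow_left₀ zero_le hPle 2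
      _ ≤ (∫⁻ ξ, (ENNReal.ofReal (Real.exp (ε * ξ ^ 2 / 2)) * ‖μ ξ‖ₑ) ^ 2) *
          ∫⁻ ξ, (ENNReal.ofReal (Real.exp (-ε * ξ ^ 2 / 2)) * ‖A ξ‖ₑ) ^ 2 := by
          rw [h1]
          exact lintegral_mul_sq_le _ (by fun_prop) (by fun_prop)
      _ ≤ _ := by
          refine mul_le_mul' ?_ (le_trans (le_of_eq ?_) hTT)
          · rw [← lintegral_const_mul' _ _ ENNReal.ofReal_ne_top]
            refine lintegral_mono fun ξ ↦ ?_
            rw [mul_pow]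
            rcases lt_or_ge n |ξ| with h | h
            · simp [hsupp ξ h]
            · rw [← ENNReal.ofReal_pow (Real.exp_pos _).le, ← Real.exp_nat_mul]
              gcongr
              have : ξ ^ 2 ≤ n ^ 2 := by rw [← sq_abs ξ]; gcongr
              rw [hε]
              push_cast
              field_simp
              linarith
          · refine lintegral_congr fun ξ ↦ ?_
            rw [mul_pow, ← ENNReal.ofReal_pow (Real.exp_pos _).le, ← Real.exp_nat_mul]
            congr 3
            push_cast; ring
  rcases eq_or_ne P 0 with hP0 | hP0
  · rw [hP0]; exact zero_le
  have h3 : P ^ (1 / 2 : ℝ) ≤ ENNReal.ofReal (Real.exp 1) * ENNReal.ofReal (12 * Real.sqrt Real.pi) *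
      ∫⁻ ξ, ‖μ ξ‖ₑ ^ 2 := by
    have hp0 : P ^ (3 / 2 : ℝ) ≠ 0 := by simp [hP0, hPt]
    have hpt : P ^ (3 / 2 : ℝ) ≠ ⊤ := by simp [hP0, hPt]
    refine (ENNReal.mul_le_mul_iff_left hp0 hpt).1 (le_trans (le_of_eq ?_) (hsq.trans (le_of_eq ?_)))
    · rw [← ENNReal.rpow_add _ _ hP0 hPt, ← ENNReal.rpow_natCast]; norm_num
    · ring
  calc P = (P ^ (1 / 2 : ℝ)) ^ 2 := by
        rw [← ENNReal.rpow_natCast, ← ENNReal.rpow_mul]; norm_num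
    _ ≤ _ := pow_le_pow_left₀ zero_le h3 2
    _ = _ := by rw [mul_pow, strichartzConst]

theorem lintegral_evolution_along_le {μ : ℝ → ℂ} (hμm : Measurable μ)
    (hμ : Integrable μ volume) {n : ℝ} (hn : 0 < n) (hsupp : ∀ ξ, n < |ξ| → μ ξ = 0) {X : ℝ → ℝ}
    (hX : Measurable X) :
    ∫⁻ t, ‖schrodingerEvolution μ t (X t)‖ₑ ^ 4 ≤ strichartzConst * (∫⁻ ξ, ‖μ ξ‖ₑ ^ 2) ^ 2 := by
  have hU : (⋃ N : ℕ, Icc (-(N : ℝ)) N) = univ := by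
    refine eq_univ_of_forall fun t ↦ mem_iUnion.2 ?_
    obtain ⟨N, hN⟩ := exists_nat_ge |t|
    exact ⟨N, abs_le.1 hN⟩
  rw [← setLIntegral_univ, ← hU, setLIntegral_iUnion_of_directed]
  · exact iSup_le fun N ↦ setLIntegral_evolution_along_le hμm hμ hn hsupp hX N
  · refine (monotone_nat_of_le_succ fun N ↦ ?_).directed_le
    push_cast
    exact Icc_subset_Icc (by linarith) (by linarith)

/-- A maximum over finitely many points becomes an evaluation along one measurable curve of
positions, the form in which the duality bound is available. -/
theorem exists_measurable_argmax {u : ℝ → ℝ → ℂ} (hu : ∀ X : ℝ → ℝ, Measurable X → Measurable fun t ↦ u t (X t))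
    (x : ℕ → ℝ) (N : ℕ) :
    ∃ X : ℝ → ℝ, Measurable X ∧ ∀ t, ∀ i ≤ N, ‖u t (x i)‖ₑ ≤ ‖u t (X t)‖ₑ := by
  induction N with
  | zero => exact ⟨fun _ ↦ x 0, measurable_const, fun t i hi ↦ by rw [Nat.le_zero.1 hi]⟩
  | succ N ih =>
    obtain ⟨X, hX, h⟩ := ih
    have h1 : Measurable fun t ↦ ‖u t (X t)‖ₑ :=
      (hu X hX).enorm
    have h2 : Measurable fun t ↦ ‖u t (x (N + 1))‖ₑ :=
      (hu _ measurable_const).enorm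
    refine ⟨fun t ↦ if ‖u t (X t)‖ₑ ≤ ‖u t (x (N + 1))‖ₑ then x (N + 1) else X t,
      Measurable.ite (measurableSet_le h1 h2) measurable_const hX, fun t i hi ↦ ?_⟩
    rcases Nat.le_succ_iff.1 hi with hi | rfl <;> beta_reduce <;> split_ifs with hle
    · exact (h t i hi).trans hle
    · exact h t i hi
    · exact le_rfl
    · exact (not_le.1 hle).le

/-- The supremum over space of the free evolution, written as a countable supremum. -/
def evolutionSup (μ : ℝ → ℂ) (t : ℝ) : ℝ≥0∞ :=
  ⨆ i : ℕ, ‖schrodingerEvolution μ t (TopologicalSpace.denseSeq ℝ i)‖ₑ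

theorem enorm_schrodingerEvolution_le_evolutionSup {μ : ℝ → ℂ} (hμ : Integrable μ volume)
    (t x : ℝ) : ‖schrodingerEvolution μ t x‖ₑ ≤ evolutionSup μ t := by
  have hc : Continuous fun x ↦ ‖schrodingerEvolution μ t x‖ₑ :=
    ((continuous_schrodingerEvolution hμ).comp (by fun_prop : Continuous fun x : ℝ ↦ (t, x))).enorm
  have hcl : IsClosed {x | ‖schrodingerEvolution μ t x‖ₑ ≤ evolutionSup μ t} :=
    isClosed_le hc continuous_const
  have := (TopologicalSpace.denseRange_denseSeq ℝ).induction_on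
    (p := fun x ↦ ‖schrodingerEvolution μ t x‖ₑ ≤ evolutionSup μ t) x hcl
    (fun i ↦ le_iSup (fun i ↦ ‖schrodingerEvolution μ t (TopologicalSpace.denseSeq ℝ i)‖ₑ) i)
  exact this

/-- The `L⁴L^∞` Strichartz estimate for frequency-localised data. -/
theorem lintegral_evolutionSup_le {μ : ℝ → ℂ} (hμm : Measurable μ)
    (hμ : Integrable μ volume) {n : ℝ} (hn : 0 < n) (hsupp : ∀ ξ, n < |ξ| → μ ξ = 0) :
    ∫⁻ t, evolutionSup μ t ^ 4 ≤ strichartzConst * (∫⁻ ξ, ‖μ ξ‖ₑ ^ 2) ^ 2 := by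
  set x := TopologicalSpace.denseSeq ℝ
  -- The supremum is the increasing limit of finite maxima, each realised along a measurable curve;
  -- monotone convergence then applies.
  have h1 : ∀ t, evolutionSup μ t ^ 4 =
      ⨆ N : ℕ, (⨆ i ≤ N, ‖schrodingerEvolution μ t (x i)‖ₑ) ^ 4 := fun t ↦ by
    rw [evolutionSup, ← ENNReal.iSup_pow]
    congr 1
    refine le_antisymm (iSup_le fun i ↦ le_iSup_of_le i (le_iSup₂_of_le i le_rfl le_rfl))
      (iSup_le fun N ↦ iSup₂_le fun i _ ↦ le_iSup (fun i ↦ ‖schrodingerEvolution μ t (x i)‖ₑ) i)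
  simp only [h1]
  rw [lintegral_iSup]
  · refine iSup_le fun N ↦ ?_
    obtain ⟨X, hX, hmax⟩ := exists_measurable_argmax
      (fun X hX ↦ measurable_schrodingerEvolution_comp hμ hX) x N
    refine le_trans (lintegral_mono fun t ↦ ?_) (lintegral_evolution_along_le hμm hμ hn hsupp hX)
    exact pow_le_pow_left₀ zero_le (iSup₂_le fun i hi ↦ hmax t i hi) 4
  · intro N
    refine Measurable.pow_const (Measurable.iSup fun i ↦ Measurable.iSup fun _ ↦ ?_) 4
    exact (measurable_schrodingerEvolution_comp hμ measurable_const).enorm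
  · intro N N' hN t
    exact pow_le_pow_left₀ zero_le (iSup₂_le fun i (hi : i ≤ N) ↦
      le_iSup₂_of_le (f := fun i (_ : i ≤ N') ↦ ‖schrodingerEvolution μ t (x i)‖ₑ) i
        (hi.trans hN) le_rfl) 4

/-! ### Lower semicontinuity of the `L^p` norms along `L²` convergence -/

/-- L² convergence yields an almost everywhere convergent subsequence, along which Fatou applies to
the L^p norms. -/
theorem eLpNorm_le_of_frequently_le {f : ℕ → ℝ → ℂ} {g : ℝ → ℂ} {p c : ℝ≥0∞}
    (hf : ∀ n, AEStronglyMeasurable (f n) volume) (hg : AEStronglyMeasurable g volume)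
    (h : Tendsto (fun n ↦ eLpNorm (f n - g) 2 volume) atTop (𝓝 0))
    (hc : ∃ᶠ n in atTop, eLpNorm (f n) p volume ≤ c) : eLpNorm g p volume ≤ c := by
  obtain ⟨ns, hns, hle⟩ := extraction_of_frequently_atTop hc
  obtain ⟨ms, -, hae⟩ := exists_subseq_ae_tendsto_of_eLpNorm (fun n ↦ hf (ns n)) hg
    (h.comp hns.tendsto_atTop)
  calc eLpNorm g p volume ≤ liminf (fun i ↦ eLpNorm (f (ns (ms i))) p volume) atTop :=
        Lp.eLpNorm_lim_le_liminf_eLpNorm (fun i ↦ hf _) g hae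
    _ ≤ liminf (fun _ : ℕ ↦ c) atTop := liminf_le_liminf (.of_forall fun i ↦ hle (ms i))
    _ = c := by simp

theorem eLpNorm_le_liminf_of_tendsto {f : ℕ → ℝ → ℂ} {g : ℝ → ℂ} (p : ℝ≥0∞)
    (hf : ∀ n, AEStronglyMeasurable (f n) volume) (hg : AEStronglyMeasurable g volume)
    (h : Tendsto (fun n ↦ eLpNorm (f n - g) 2 volume) atTop (𝓝 0)) :
    eLpNorm g p volume ≤ liminf (fun n ↦ eLpNorm (f n) p volume) atTop :=
  le_of_forall_gt fun c hc ↦ by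
    obtain ⟨d, hd, hdc⟩ := exists_between hc
    exact (eLpNorm_le_of_frequently_le hf hg h
      ((frequently_lt_of_liminf_lt (by isBoundedDefault) hd).mono fun _ h ↦ h.le)).trans_lt hdc

/-- L² continuity in time makes every L^p norm lower semicontinuous in time, even when it is not
continuous or takes the value ∞. The measurability asserted in the theorem comes from here. -/
theorem measurable_eLpNorm_of_continuous {v : ℝ → ℝ → ℂ}
    (hm : ∀ t, AEStronglyMeasurable (v t) volume)
    (hc : ∀ t₀, Tendsto (fun t ↦ eLpNorm (v t - v t₀) 2 volume) (𝓝 t₀) (𝓝 0)) (p : ℝ≥0∞) :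
    Measurable fun t ↦ eLpNorm (v t) p volume := by
  refine LowerSemicontinuous.measurable fun t₀ y hy ↦ ?_
  by_contra hcon
  obtain ⟨ts, hts, hle⟩ := exists_seq_forall_of_frequently (not_eventually.1 hcon)
  exact absurd (eLpNorm_le_of_frequently_le (fun n ↦ hm (ts n)) (hm t₀) ((hc t₀).comp hts)
    (Frequently.of_forall fun n ↦ not_lt.1 (hle n))) (not_le.2 hy)

theorem tendsto_eLpNorm_two_mul {ι : Type*} {l : Filter ι} [l.IsCountablyGenerated]
    {m : ι → ℝ → ℂ} {ν : ℝ → ℂ} (hν : MemLp ν 2 volume) {C : ℝ≥0}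
    (hm : ∀ i, AEStronglyMeasurable (m i) volume) (hC : ∀ i, ∀ᵐ β, ‖m i β‖ₑ ≤ C)
    (hlim : ∀ᵐ β, Tendsto (fun i ↦ m i β) l (𝓝 0)) :
    Tendsto (fun i ↦ eLpNorm (fun β ↦ m i β * ν β) 2 volume) l (𝓝 0) := by
  have h1 : Tendsto (fun i ↦ ∫⁻ β, ‖m i β * ν β‖ₑ ^ 2) l (𝓝 (∫⁻ _ : ℝ, 0)) := by
    refine tendsto_of_seq_tendsto fun u hu ↦ ?_
    refine tendsto_lintegral_of_dominated_convergence' (fun β ↦ (C * ‖ν β‖ₑ) ^ 2)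
      (fun i ↦ ((hm _).mul hν.1).enorm.pow_const 2) (fun i ↦ ?_) ?_ ?_
    · filter_upwards [hC (u i)] with β hβ
      rw [enorm_mul]
      gcongr
    · simp only [mul_pow]
      rw [lintegral_const_mul' _ _ (by finiteness), ← eLpNorm_two_sq]
      exact ENNReal.mul_ne_top (by finiteness) (ENNReal.pow_ne_top hν.2.ne)
    · filter_upwards [hlim] with β hβ
      have h2 : Tendsto (fun i ↦ ‖m (u i) β * ν β‖ₑ ^ 2) atTop (𝓝 (‖0 * ν β‖ₑ ^ 2)) :=
        ((ENNReal.continuous_pow 2).tendsto _).comp (((hβ.comp hu).mul_const (ν β)).enorm)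
      simpa using h2
  simp only [lintegral_zero, ← eLpNorm_two_sq] at h1
  have h2 := h1.ennrpow_const (1 / 2)
  rw [ENNReal.zero_rpow_of_pos (by norm_num)] at h2
  refine h2.congr fun i ↦ ?_
  rw [← ENNReal.rpow_natCast, ← ENNReal.rpow_mul]
  norm_num

/-! ### Curves satisfying the endpoint Strichartz estimates -/

/-- The curve `t ↦ v t` is continuous with values in `L²`, and its norms in `L^∞L²` and in
`L⁴L^∞` are at most `N`. -/
structure StrichartzBound (v : ℝ → ℝ → ℂ) (N : ℝ≥0∞) : Prop where
  aesm : ∀ t, AEStronglyMeasurable (v t) volume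
  cont : ∀ t₀, Tendsto (fun t ↦ eLpNorm (v t - v t₀) 2 volume) (𝓝 t₀) (𝓝 0)
  two_le : ∀ t, eLpNorm (v t) 2 volume ≤ N
  four_le : eLpNorm (fun t ↦ eLpNorm (v t) ⊤ volume) 4 volume ≤ N

namespace StrichartzBound

variable {v w : ℝ → ℝ → ℂ} {N N' : ℝ≥0∞}

theorem measurable (hv : StrichartzBound v N) (p : ℝ≥0∞) :
    Measurable fun t ↦ eLpNorm (v t) p volume :=
  measurable_eLpNorm_of_continuous hv.aesm hv.cont p

theorem mono (hv : StrichartzBound v N) (h : N ≤ N') : StrichartzBound v N' :=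
  ⟨hv.aesm, hv.cont, fun t ↦ (hv.two_le t).trans h, hv.four_le.trans h⟩

theorem congr (hv : StrichartzBound v N) (h : ∀ t, v t =ᵐ[volume] w t) : StrichartzBound w N where
  aesm t := (hv.aesm t).congr (h t)
  cont t₀ := (hv.cont t₀).congr fun t ↦ eLpNorm_congr_ae ((h t).sub (h t₀))
  two_le t := (eLpNorm_congr_ae (h t)).symm.le.trans (hv.two_le t)
  four_le := by
    refine le_of_eq_of_le (congrArg (fun F ↦ eLpNorm F 4 volume) ?_) hv.four_le
    funext t
    exact (eLpNorm_congr_ae (h t)).symm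

theorem add (hv : StrichartzBound v N) (hw : StrichartzBound w N') :
    StrichartzBound (fun t ↦ v t + w t) (N + N') where
  aesm t := (hv.aesm t).add (hw.aesm t)
  cont t₀ := by
    refine tendsto_of_tendsto_of_tendsto_of_le_of_le tendsto_const_nhds
      (by simpa using (hv.cont t₀).add (hw.cont t₀)) (fun _ ↦ zero_le) fun t ↦ ?_
    have : v t + w t - (v t₀ + w t₀) = (v t - v t₀) + (w t - w t₀) := by abel
    simp only [this]
    exact eLpNorm_add_le ((hv.aesm t).sub (hv.aesm t₀)) ((hw.aesm t).sub (hw.aesm t₀)) (by norm_num)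
  two_le t := (eLpNorm_add_le (hv.aesm t) (hw.aesm t) (by norm_num)).trans
    (add_le_add (hv.two_le t) (hw.two_le t))
  four_le := by
    calc _ ≤ eLpNorm ((fun t ↦ eLpNorm (v t) ⊤ volume) + fun t ↦ eLpNorm (w t) ⊤ volume) 4 volume :=
          eLpNorm_mono_enorm fun t ↦ by
            simpa using eLpNorm_add_le (hv.aesm t) (hw.aesm t) le_top
      _ ≤ _ := eLpNorm_add_le (hv.measurable ⊤).aestronglyMeasurable
          (hw.measurable ⊤).aestronglyMeasurable (by norm_num)
      _ ≤ _ := add_le_add hv.four_le hw.four_le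

theorem of_norm_eq (hv : StrichartzBound v N) (hw : ∀ t, AEStronglyMeasurable (w t) volume)
    (h : ∀ t, ∀ᵐ x, ‖w t x‖ = ‖v t x‖)
    (h' : ∀ t t₀, ∀ᵐ x, ‖w t x - w t₀ x‖ = ‖v t x - v t₀ x‖) : StrichartzBound w N where
  aesm := hw
  cont t₀ := (hv.cont t₀).congr fun t ↦ (eLpNorm_congr_norm_ae (h' t t₀)).symm
  two_le t := (eLpNorm_congr_norm_ae (h t)).le.trans (hv.two_le t)
  four_le := by
    refine le_of_eq_of_le (congrArg (fun F ↦ eLpNorm F 4 volume) ?_) hv.four_le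
    funext t
    exact eLpNorm_congr_norm_ae (h t)

end StrichartzBound

theorem eLpNorm_four_pow {F : ℝ → ℝ≥0∞} : eLpNorm F 4 volume ^ 4 = ∫⁻ t, F t ^ 4 := by
  have := eLpNorm_nnreal_pow_eq_lintegral (f := F) (μ := volume) (p := 4) (by norm_num)
  simpa using this

/-- The `L⁴L^∞` bound passes to limits in `L²` at each time. -/
theorem eLpNorm_four_le_of_tendsto {f : ℕ → ℝ → ℝ → ℂ} {v : ℝ → ℝ → ℂ} {N : ℝ≥0∞}
    (hf : ∀ n t, AEStronglyMeasurable (f n t) volume) (hv : ∀ t, AEStronglyMeasurable (v t) volume)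
    (hm : ∀ n, Measurable fun t ↦ eLpNorm (f n t) ⊤ volume)
    (h : ∀ t, Tendsto (fun n ↦ eLpNorm (f n t - v t) 2 volume) atTop (𝓝 0))
    (hN : ∀ n, eLpNorm (fun t ↦ eLpNorm (f n t) ⊤ volume) 4 volume ≤ N) :
    eLpNorm (fun t ↦ eLpNorm (v t) ⊤ volume) 4 volume ≤ N := by
  refine (ENNReal.pow_right_strictMono (n := 4) (by norm_num)).le_iff_le.1 ?_
  simp only [eLpNorm_four_pow]
  calc ∫⁻ t, eLpNorm (v t) ⊤ volume ^ 4
      ≤ ∫⁻ t, liminf (fun n ↦ eLpNorm (f n t) ⊤ volume ^ 4) atTop := by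
        refine lintegral_mono fun t ↦ ?_
        have h1 := eLpNorm_le_liminf_of_tendsto ⊤ (fun n ↦ hf n t) (hv t) (h t)
        refine (pow_le_pow_left₀ zero_le h1 4).trans (le_of_eq ?_)
        have hmono : Monotone fun x : ℝ≥0∞ ↦ x ^ 4 := fun a b hab ↦ pow_le_pow_left₀ zero_le hab 4
        exact hmono.map_liminf_of_continuousAt _ (ENNReal.continuous_pow 4).continuousAt
    _ ≤ liminf (fun n ↦ ∫⁻ t, eLpNorm (f n t) ⊤ volume ^ 4) atTop :=
        lintegral_liminf_le fun n ↦ (hm n).pow_const 4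
    _ ≤ liminf (fun _ : ℕ ↦ N ^ 4) atTop := liminf_le_liminf (.of_forall fun n ↦ by
        simp only [← eLpNorm_four_pow]
        exact pow_le_pow_left₀ zero_le (hN n) 4)
    _ = N ^ 4 := by simp

/-! ### The Plancherel integral -/

theorem eLpNorm_two_comp_const_mul_sq (G : ℝ → ℂ) {c : ℝ} (hc : 0 < c) :
    eLpNorm (fun ξ ↦ G (c * ξ)) 2 volume ^ 2 = ENNReal.ofReal c⁻¹ * eLpNorm G 2 volume ^ 2 := by
  rw [eLpNorm_two_sq, eLpNorm_two_sq, lintegral_comp_const_mul (fun ξ ↦ ‖G ξ‖ₑ ^ 2) hc.ne',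
    abs_of_pos (inv_pos.2 hc)]

/-- The factor 2π converts between the kernel e^{iβx} and the normalisation e^{2πiξx}; it explains
the arguments β/(2π) of the weights below. -/
theorem isFourierPair_planchIntegral {G : ℝ → ℂ} (hG : MemLp G 2 volume) :
    IsFourierPair (planchIntegral G)
      (fun ξ ↦ ((2 * Real.pi : ℝ) : ℂ) * G (2 * Real.pi * ξ)) := by
  have h := (IsFourierPair.of_memLp_right hG).comp_div Real.two_pi_pos
  refine h.congr (.of_forall fun x ↦ ?_) .rfl
  simp only [planchIntegral, dif_pos hG]

theorem eLpNorm_planchIntegral {G : ℝ → ℂ} (hG : MemLp G 2 volume) :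
    eLpNorm (planchIntegral G) 2 volume = ENNReal.ofReal √(2 * Real.pi) * eLpNorm G 2 volume := by
  have hp := Real.two_pi_pos
  refine (ENNReal.pow_right_strictMono (n := 2) (by norm_num)).injective ?_
  rw [(isFourierPair_planchIntegral hG).eLpNorm_eq, mul_pow, ← ENNReal.ofReal_pow (by positivity),
    Real.sq_sqrt hp.le]
  have : (fun ξ ↦ ((2 * Real.pi : ℝ) : ℂ) * G (2 * Real.pi * ξ)) =
      ((2 * Real.pi : ℝ) : ℂ) • fun ξ ↦ G (2 * Real.pi * ξ) := rfl
  rw [this, eLpNorm_const_smul, mul_pow, eLpNorm_two_comp_const_mul_sq G hp, ← mul_assoc]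
  congr 1
  rw [← ofReal_norm, Complex.norm_real, Real.norm_of_nonneg hp.le,
    ← ENNReal.ofReal_pow hp.le, ← ENNReal.ofReal_mul (by positivity)]
  congr 1
  field_simp

theorem planchIntegral_sub {G G' : ℝ → ℂ} (hG : MemLp G 2 volume) (hG' : MemLp G' 2 volume) :
    planchIntegral (G - G') =ᵐ[volume] planchIntegral G - planchIntegral G' := by
  refine (isFourierPair_planchIntegral (hG.sub hG')).ae_eq_left
    (((isFourierPair_planchIntegral hG).sub (isFourierPair_planchIntegral hG')).congr .rfl
      (.of_forall fun ξ ↦ ?_))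
  simp only [Pi.sub_apply]
  ring

theorem eLpNorm_planchIntegral_sub {G G' : ℝ → ℂ} (hG : MemLp G 2 volume)
    (hG' : MemLp G' 2 volume) : eLpNorm (planchIntegral G - planchIntegral G') 2 volume =
      ENNReal.ofReal √(2 * Real.pi) * eLpNorm (G - G') 2 volume := by
  rw [← eLpNorm_planchIntegral (hG.sub hG'), eLpNorm_congr_ae (planchIntegral_sub hG hG')]

theorem planchIntegral_ae_eq_integral {G : ℝ → ℂ} (hG : MemLp G 2 volume)
    (hG1 : Integrable G volume) :
    planchIntegral G =ᵐ[volume] fun x ↦ ∫ β : ℝ, Complex.exp (Complex.I * (x * β : ℝ)) * G β := by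
  have hp := Real.two_pi_pos
  have h := isFourierPair_planchIntegral hG
  have h1 := IsFourierPair.of_integrable_right
    ((hG1.comp_mul_left' hp.ne').const_mul ((2 * Real.pi : ℝ) : ℂ)) h.memLp_right
  refine (h.ae_eq_left h1).trans (.of_forall fun x ↦ ?_)
  simp only
  rw [Real.fourierInv_eq']
  have h2 := Measure.integral_comp_mul_left
    (fun β : ℝ ↦ Complex.exp (Complex.I * (x * β : ℝ)) * G β) (2 * Real.pi)
  rw [abs_of_pos (inv_pos.2 hp), Complex.real_smul] at h2
  have h3 : ∀ y : ℂ, ((2 * Real.pi : ℝ) : ℂ) * ((((2 * Real.pi)⁻¹ : ℝ) : ℂ) * y) = y := fun y ↦ by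
    push_cast
    have : (Real.pi : ℂ) ≠ 0 := by exact_mod_cast Real.pi_ne_zero
    field_simp
  rw [← h3 (∫ β : ℝ, Complex.exp (Complex.I * (x * β : ℝ)) * G β), ← h2, ← integral_const_mul]
  refine integral_congr_ae (.of_forall fun ξ ↦ ?_)
  simp only [smul_eq_mul]
  rw [mul_left_comm]
  congr 3
  simp
  ring

theorem isWeakDeriv_of_isFourierPair {f f' g : ℝ → ℂ} (h : IsFourierPair f g)
    (h' : IsFourierPair f' (fun ξ ↦ 2 * Real.pi * Complex.I * ξ * g ξ)) : IsWeakDeriv f f' := by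
  intro φ hφ hc
  set ψ : 𝓢(ℝ, ℂ) := hc.toSchwartzMap hφ with hψ
  have hc' : HasCompactSupport (deriv φ) := hc.deriv
  have hφ' : ContDiff ℝ ∞ (deriv φ) := by
    exact (contDiff_infty_iff_deriv.1 hφ).2
  set θ : 𝓢(ℝ, ℂ) := hc'.toSchwartzMap hφ' with hθ
  have e0 : ⇑ψ = φ := by ext x; simp [hψ]
  have e1 : ⇑θ = deriv φ := by ext x; simp [hθ]
  have e2 : ∀ ξ, 𝓕⁻ θ ξ = -(2 * Real.pi * Complex.I * ξ) * 𝓕⁻ ψ ξ := fun ξ ↦ by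
    rw [SchwartzMap.fourierInv_coe, SchwartzMap.fourierInv_coe, e0, e1,
      Real.fourierInv_eq_fourier_neg, Real.fourierInv_eq_fourier_neg, Real.fourier_deriv
        (hφ.continuous.integrable_of_hasCompactSupport hc) (hφ.differentiable (by simp))
        (hφ'.continuous.integrable_of_hasCompactSupport hc')]
    simp
  have h1 := h.integral_fourierInv_mul θ
  have h2 := h'.integral_fourierInv_mul ψ
  rw [e1] at h1
  rw [e0] at h2
  simp only [mul_comm (f _), mul_comm (f' _)]
  rw [← h1, ← h2, ← integral_neg]
  refine integral_congr_ae (.of_forall fun ξ ↦ ?_)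
  simp only [e2]
  ring

/-! ### The free evolution -/

/-- The multiplier `e^{-iβ²t}` of the free Schrödinger evolution. -/
def freePhase (t β : ℝ) : ℂ := Complex.exp (-Complex.I * β ^ 2 * t)

theorem norm_freePhase (t β : ℝ) : ‖freePhase t β‖ = 1 := by
  rw [freePhase, show -Complex.I * β ^ 2 * t = ((-(β ^ 2 * t) : ℝ) : ℂ) * Complex.I by
    push_cast; ring, Complex.norm_exp_ofReal_mul_I]

theorem continuous_freePhase_right (t : ℝ) : Continuous (freePhase t) := by
  unfold freePhase; fun_prop

theorem memLp_freePhase_mul {ν : ℝ → ℂ} {p : ℝ≥0∞} (hν : MemLp ν p volume) (t : ℝ) :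
    MemLp (fun β ↦ freePhase t β * ν β) p volume :=
  (memLp_congr_norm hν.1 ((continuous_freePhase_right t).aestronglyMeasurable.mul hν.1)
    (.of_forall fun β ↦ by simp [norm_freePhase])).1 hν

theorem eLpNorm_freePhase_mul (ν : ℝ → ℂ) (p : ℝ≥0∞) (t : ℝ) :
    eLpNorm (fun β ↦ freePhase t β * ν β) p volume = eLpNorm ν p volume :=
  eLpNorm_congr_norm_ae (.of_forall fun β ↦ by simp [norm_freePhase])

theorem tendsto_eLpNorm_freePhase_sub_mul {ν : ℝ → ℂ} (hν : MemLp ν 2 volume) (t₀ : ℝ) :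
    Tendsto (fun t ↦ eLpNorm (fun β ↦ (freePhase t β - freePhase t₀ β) * ν β) 2 volume)
      (𝓝 t₀) (𝓝 0) := by
  refine tendsto_eLpNorm_two_mul hν (C := 2) (fun t ↦ ?_) (fun t ↦ .of_forall fun β ↦ ?_)
    (.of_forall fun β ↦ ?_)
  · exact ((continuous_freePhase_right t).sub (continuous_freePhase_right t₀)).aestronglyMeasurable
  · rw [← ofReal_norm]
    refine ENNReal.ofReal_le_of_le_toReal ?_
    refine (norm_sub_le _ _).trans ?_
    simp only [norm_freePhase]
    norm_num
  · have : Continuous fun t ↦ freePhase t β - freePhase t₀ β := by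
      unfold freePhase; fun_prop
    simpa using this.tendsto t₀

/-- The constant of the Strichartz estimates for the free evolution. -/
def evolutionConst : ℝ≥0∞ := ENNReal.ofReal √(2 * Real.pi) + strichartzConst ^ (1 / 4 : ℝ)

theorem evolutionConst_ne_top : evolutionConst ≠ ⊤ :=
  ENNReal.add_ne_top.2 ⟨ENNReal.ofReal_ne_top,
    ENNReal.rpow_ne_top_of_nonneg (by norm_num) strichartzConst_ne_top⟩

theorem tendsto_eLpNorm_indicator_sub {ν : ℝ → ℂ} (hν : MemLp ν 2 volume) {S : ℕ → Set ℝ}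
    (hS : ∀ n, MeasurableSet (S n)) (h : ∀ᵐ β, ∀ᶠ n in atTop, β ∈ S n) :
    Tendsto (fun n ↦ eLpNorm ((S n).indicator ν - ν) 2 volume) atTop (𝓝 0) := by
  have h2 := tendsto_eLpNorm_two_mul (l := atTop) (m := fun n ↦ (S n)ᶜ.indicator (1 : ℝ → ℂ)) hν
    (C := 1) (fun n ↦ (measurable_const.indicator (hS n).compl).aestronglyMeasurable)
    (fun n ↦ .of_forall fun β ↦ ?_) ?_
  · refine h2.congr fun n ↦ eLpNorm_congr_norm_ae (.of_forall fun β ↦ ?_)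
    by_cases hβ : β ∈ S n <;> simp [hβ]
  · by_cases hβ : β ∈ S n <;> simp [hβ]
  · filter_upwards [h] with β hβ
    refine tendsto_const_nhds.congr' ?_
    filter_upwards [hβ] with n hn
    simp [hn]

theorem integrable_indicator_Icc {ν : ℝ → ℂ} (hν : MemLp ν 2 volume) (a b : ℝ) :
    Integrable ((Icc a b).indicator ν) volume :=
  (integrable_indicator_iff measurableSet_Icc).2
    ((hν.locallyIntegrable (by norm_num)).integrableOn_isCompact isCompact_Icc)

theorem planchIntegral_freePhase_ae_eq {μ : ℝ → ℂ} (hμ : MemLp μ 2 volume)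
    (hμ1 : Integrable μ volume) (t : ℝ) :
    planchIntegral (fun β ↦ freePhase t β * μ β) =ᵐ[volume] schrodingerEvolution μ t := by
  refine (planchIntegral_ae_eq_integral (memLp_freePhase_mul hμ t) ?_).trans (.of_forall fun x ↦ ?_)
  · exact memLp_one_iff_integrable.1 (memLp_freePhase_mul (memLp_one_iff_integrable.2 hμ1) t)
  · refine integral_congr_ae (.of_forall fun β ↦ ?_)
    simp only [freePhase, schrodingerPhase, ← mul_assoc, ← Complex.exp_add]
    congr 2
    push_cast
    ring

theorem eLpNorm_four_evolutionSup_le {μ : ℝ → ℂ} (hμm : Measurable μ)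
    (hμ : Integrable μ volume) {n : ℝ} (hn : 0 < n) (hsupp : ∀ ξ, n < |ξ| → μ ξ = 0) :
    eLpNorm (evolutionSup μ) 4 volume ≤ strichartzConst ^ (1 / 4 : ℝ) * eLpNorm μ 2 volume := by
  refine (ENNReal.pow_right_strictMono (n := 4) (by norm_num)).le_iff_le.1 ?_
  rw [eLpNorm_four_pow, mul_pow, ← ENNReal.rpow_natCast (strichartzConst ^ _), ← ENNReal.rpow_mul]
  refine (lintegral_evolutionSup_le hμm hμ hn hsupp).trans (le_of_eq ?_)
  rw [← eLpNorm_two_sq, ← pow_mul]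
  norm_num

/-- The L²-in-space bound is Plancherel. The L⁴L^∞ bound is known for densities truncated in
frequency, where the evolution is an absolutely convergent integral, with a constant independent of
the truncation; it survives the L² limit by lower semicontinuity. -/
theorem strichartzBound_planchIntegral {ν : ℝ → ℂ} (hνm : Measurable ν) (hν : MemLp ν 2 volume) :
    StrichartzBound (fun t ↦ planchIntegral fun β ↦ freePhase t β * ν β)
      (evolutionConst * eLpNorm ν 2 volume) := by
  have haesm : ∀ {μ : ℝ → ℂ}, MemLp μ 2 volume → ∀ t, AEStronglyMeasurable
      (planchIntegral fun β ↦ freePhase t β * μ β) volume := fun {μ} hμ t ↦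
    (isFourierPair_planchIntegral (memLp_freePhase_mul hμ t)).memLp_left.1
  have hcont : ∀ {μ : ℝ → ℂ}, MemLp μ 2 volume → ∀ t₀, Tendsto (fun t ↦ eLpNorm
      ((planchIntegral fun β ↦ freePhase t β * μ β) -
        planchIntegral fun β ↦ freePhase t₀ β * μ β) 2 volume) (𝓝 t₀) (𝓝 0) := fun {μ} hμ t₀ ↦ by
    have h1 := ENNReal.Tendsto.const_mul (a := ENNReal.ofReal √(2 * Real.pi))
      (tendsto_eLpNorm_freePhase_sub_mul hμ t₀) (.inr ENNReal.ofReal_ne_top)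
    rw [mul_zero] at h1
    refine h1.congr fun t ↦ ?_
    rw [eLpNorm_planchIntegral_sub (memLp_freePhase_mul hμ t) (memLp_freePhase_mul hμ t₀)]
    congr 2
    funext β
    simp only [Pi.sub_apply]
    ring
  refine ⟨haesm hν, hcont hν, fun t ↦ ?_, ?_⟩
  · rw [eLpNorm_planchIntegral (memLp_freePhase_mul hν t), eLpNorm_freePhase_mul]
    gcongr
    exact le_self_add
  · set S : ℕ → Set ℝ := fun n ↦ Icc (-(n : ℝ)) n with hS
    have hμ2 : ∀ n, MemLp ((S n).indicator ν) 2 volume := fun n ↦ hν.indicator measurableSet_Icc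
    refine eLpNorm_four_le_of_tendsto
      (f := fun n t ↦ planchIntegral fun β ↦ freePhase t β * (S n).indicator ν β)
      (fun n t ↦ haesm (hμ2 n) t) (haesm hν)
      (fun n ↦ measurable_eLpNorm_of_continuous (haesm (hμ2 n)) (hcont (hμ2 n)) ⊤)
      (fun t ↦ ?_) fun n ↦ ?_
    · have h1 := ENNReal.Tendsto.const_mul (a := ENNReal.ofReal √(2 * Real.pi))
        (tendsto_eLpNorm_indicator_sub hν (S := S) (fun n ↦ measurableSet_Icc)
          (.of_forall fun β ↦ ?_)) (.inr ENNReal.ofReal_ne_top)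
      · rw [mul_zero] at h1
        refine h1.congr fun n ↦ ?_
        rw [eLpNorm_planchIntegral_sub (memLp_freePhase_mul (hμ2 n) t) (memLp_freePhase_mul hν t)]
        rw [← eLpNorm_freePhase_mul _ 2 t]
        congr 2
        funext β
        simp only [Pi.sub_apply]
        ring
      · obtain ⟨N, hN⟩ := exists_nat_ge |β|
        filter_upwards [eventually_ge_atTop N] with n hn
        exact abs_le.1 (hN.trans (by exact_mod_cast hn))
    · have hi := integrable_indicator_Icc hν (-(n : ℝ)) n
      calc eLpNorm (fun t ↦ eLpNorm (planchIntegral fun β ↦ freePhase t β * (S n).indicator ν β)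
            ⊤ volume) 4 volume ≤ eLpNorm (evolutionSup ((S n).indicator ν)) 4 volume := by
            refine eLpNorm_mono_enorm fun t ↦ ?_
            simp only [enorm_eq_self]
            rw [eLpNorm_congr_ae (planchIntegral_freePhase_ae_eq (hμ2 n) hi t),
              eLpNorm_exponent_top]
            exact eLpNormEssSup_le_of_ae_enorm_bound (.of_forall fun x ↦
              enorm_schrodingerEvolution_le_evolutionSup hi t x)
        _ ≤ strichartzConst ^ (1 / 4 : ℝ) * eLpNorm ((S n).indicator ν) 2 volume := by
            refine eLpNorm_four_evolutionSup_le (hνm.indicator measurableSet_Icc) hi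
              -- The radius n + 1 is strictly positive even for n = 0.
              (n := n + 1) (by positivity) fun ξ hξ ↦ indicator_of_notMem (fun h ↦ ?_) _
            have := abs_le.2 h
            linarith
        _ ≤ _ := by
            gcongr
            · exact le_add_self
            · exact eLpNorm_indicator_le ν

/-! ### The curves generated by the free evolution -/

theorem one_le_bracket_div {s : ℝ} (hs : 0 ≤ s) (β : ℝ) : 1 ≤ bracket s (β / (2 * Real.pi)) :=
  one_le_bracket hs _

theorem continuous_bracket_div (s : ℝ) :
    Continuous fun β : ℝ ↦ (bracket s (β / (2 * Real.pi)) : ℂ) :=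
  Complex.continuous_ofReal.comp ((continuous_bracket s).comp (by fun_prop))

theorem memLp_of_memLp_bracket_mul {s : ℝ} (hs : 0 ≤ s) {ν : ℝ → ℂ}
    (hν : AEStronglyMeasurable ν volume)
    (h : MemLp (fun β ↦ bracket s (β / (2 * Real.pi)) * ν β) 2 volume) : MemLp ν 2 volume := by
  refine MemLp.mono h hν (.of_forall fun β ↦ ?_)
  rw [norm_mul, Complex.norm_real, Real.norm_of_nonneg (bracket_pos _ _).le]
  exact le_mul_of_one_le_left (norm_nonneg _) (one_le_bracket_div hs β)

theorem eLpNorm_le_eLpNorm_bracket_div_mul {s : ℝ} (hs : 0 ≤ s) (ν : ℝ → ℂ) (p : ℝ≥0∞) :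
    eLpNorm ν p volume ≤ eLpNorm (fun β ↦ bracket s (β / (2 * Real.pi)) * ν β) p volume := by
  refine eLpNorm_mono fun β ↦ ?_
  rw [norm_mul, Complex.norm_real, Real.norm_of_nonneg (bracket_pos _ _).le]
  exact le_mul_of_one_le_left (norm_nonneg _) (one_le_bracket_div hs β)

theorem le_bracket_one (β : ℝ) : |β| ≤ 2 * Real.pi * bracket 1 (β / (2 * Real.pi)) := by
  have : |β / (2 * Real.pi)| ≤ bracket 1 (β / (2 * Real.pi)) := by
    rw [bracket, ← Real.sqrt_eq_rpow]
    exact Real.abs_le_sqrt (by linarith)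
  rw [abs_div, abs_of_pos Real.two_pi_pos, div_le_iff₀ Real.two_pi_pos] at this
  linarith

/-- A curve of functions on the line, with the bounds in `L^∞H^s` and in `L⁴W^{s,∞}` which give
the Strichartz estimates at the order `s`. -/
structure SobolevStrichartz (s : ℝ) (u : ℝ → ℝ → ℂ) (N : ℝ≥0∞) : Prop where
  bound : StrichartzBound u N
  exists_pair : ∃ g : ℝ → ℝ → ℂ, ∀ t, IsFourierPair (u t) (g t) ∧
    MemLp (fun ξ ↦ bracket s ξ * g t ξ) 2 volume ∧
    eLpNorm (fun ξ ↦ bracket s ξ * g t ξ) 2 volume ≤ N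
  exists_bessel : s < 1 → ∃ v g : ℝ → ℝ → ℂ, StrichartzBound v N ∧
    ∀ t, IsFourierPair (u t) (g t) ∧ IsFourierPair (v t) (fun ξ ↦ bracket s ξ * g t ξ)
  exists_deriv : s = 1 → ∃ v : ℝ → ℝ → ℂ, StrichartzBound v N ∧
    ∀ t, MemLp (v t) 2 volume ∧ IsWeakDeriv (u t) (v t)

theorem isFourierPair_planchIntegral_freePhase {ν : ℝ → ℂ} (hν : MemLp ν 2 volume) (t : ℝ) :
    IsFourierPair (planchIntegral fun β ↦ freePhase t β * ν β) (fun ξ ↦ ((2 * Real.pi : ℝ) : ℂ) *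
      (freePhase t (2 * Real.pi * ξ) * ν (2 * Real.pi * ξ))) :=
  isFourierPair_planchIntegral (memLp_freePhase_mul hν t)

/-- Fourier multipliers commute with the evolution, so the Bessel potential of the curve is the
evolution of the weighted density. At s = 1 the derivative is the evolution of iβν, and |β| is at
most 2π times the weight, whence the factor 2π in the constant. -/
theorem sobolevStrichartz_planchIntegral {s : ℝ} (hs : 0 ≤ s) {ν : ℝ → ℂ} (hνm : Measurable ν)
    (hν : MemLp (fun β ↦ bracket s (β / (2 * Real.pi)) * ν β) 2 volume) :
    SobolevStrichartz s (fun t ↦ planchIntegral fun β ↦ freePhase t β * ν β)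
      (2 * ENNReal.ofReal Real.pi * evolutionConst *
        eLpNorm (fun β ↦ bracket s (β / (2 * Real.pi)) * ν β) 2 volume) := by
  set w : ℝ → ℂ := fun β ↦ bracket s (β / (2 * Real.pi)) * ν β with hw
  have hν2 := memLp_of_memLp_bracket_mul hs hνm.aestronglyMeasurable hν
  have hwm : Measurable w := (continuous_bracket_div s).measurable.mul hνm
  have hpi : (1 : ℝ≥0∞) ≤ 2 * ENNReal.ofReal Real.pi := by
    have : (1 : ℝ≥0∞) ≤ ENNReal.ofReal Real.pi := by
      rw [ENNReal.one_le_ofReal]; linarith [Real.pi_gt_three]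
    exact this.trans (by rw [two_mul]; exact le_self_add)
  have hN : evolutionConst * eLpNorm w 2 volume ≤
      2 * ENNReal.ofReal Real.pi * evolutionConst * eLpNorm w 2 volume := by
    rw [mul_assoc]
    exact le_mul_of_one_le_left zero_le hpi
  have hv := strichartzBound_planchIntegral hwm hν
  have hpair : ∀ t, IsFourierPair (planchIntegral fun β ↦ freePhase t β * w β)
      (fun ξ ↦ bracket s ξ * (((2 * Real.pi : ℝ) : ℂ) *
        (freePhase t (2 * Real.pi * ξ) * ν (2 * Real.pi * ξ)))) := fun t ↦ by
    refine (isFourierPair_planchIntegral_freePhase hν t).congr .rfl (.of_forall fun ξ ↦ ?_)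
    simp only [hw, mul_div_cancel_left₀ ξ Real.two_pi_pos.ne']
    ring
  refine ⟨(strichartzBound_planchIntegral hνm hν2).mono ?_, ⟨_, fun t ↦
    ⟨isFourierPair_planchIntegral_freePhase hν2 t, (hpair t).memLp_right, ?_⟩⟩, fun _ ↦
    ⟨_, _, hv.mono hN, fun t ↦ ⟨isFourierPair_planchIntegral_freePhase hν2 t, hpair t⟩⟩,
    fun hs1 ↦ ?_⟩
  · refine le_trans ?_ hN
    gcongr
    exact eLpNorm_le_eLpNorm_bracket_div_mul hs ν 2
  · rw [← (hpair t).eLpNorm_eq]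
    exact (hv.two_le t).trans hN
  · subst hs1
    set w' : ℝ → ℂ := fun β ↦ Complex.I * β * ν β with hw'
    have hle : ∀ β, ‖w' β‖ ≤ 2 * Real.pi * ‖w β‖ := fun β ↦ by
      have h1 := le_bracket_one β
      simp only [hw', hw, norm_mul, Complex.norm_I, one_mul, Complex.norm_real,
        Real.norm_of_nonneg (bracket_pos _ _).le, Real.norm_eq_abs, ← mul_assoc]
      gcongr
    have hw'm : Measurable w' := by fun_prop
    have hw'2 : MemLp w' 2 volume := by
      refine MemLp.of_le_mul (c := 2 * Real.pi) hν hw'm.aestronglyMeasurable (.of_forall hle)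
    refine ⟨_, (strichartzBound_planchIntegral hw'm hw'2).mono ?_, fun t ↦
      ⟨(isFourierPair_planchIntegral_freePhase hw'2 t).memLp_left,
      isWeakDeriv_of_isFourierPair (isFourierPair_planchIntegral_freePhase hν2 t) <|
      (isFourierPair_planchIntegral_freePhase hw'2 t).congr .rfl (.of_forall fun ξ ↦ ?_)⟩⟩
    · have := eLpNorm_le_mul_eLpNorm_of_ae_le_mul (p := 2) (μ := volume) (.of_forall hle)
      rw [ENNReal.ofReal_mul zero_le_two, ENNReal.ofReal_ofNat] at this
      rw [mul_comm (2 * ENNReal.ofReal Real.pi), mul_assoc]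
      gcongr
    · simp only [hw']
      push_cast
      ring

theorem integrable_mul_of_hasCompactSupport {f ψ : ℝ → ℂ} (hf : LocallyIntegrable f volume)
    (hψ : Continuous ψ) (hc : HasCompactSupport ψ) : Integrable (fun x ↦ f x * ψ x) volume := by
  simpa [mul_comm] using hf.integrable_smul_left_of_hasCompactSupport hψ hc

theorem IsWeakDeriv.add {f g f' g' : ℝ → ℂ} (h : IsWeakDeriv f g) (h' : IsWeakDeriv f' g')
    (hf : LocallyIntegrable f volume) (hf' : LocallyIntegrable f' volume)
    (hg : LocallyIntegrable g volume) (hg' : LocallyIntegrable g' volume) :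
    IsWeakDeriv (f + f') (g + g') := fun φ hφ hc ↦ by
  have hd : Continuous (deriv φ) := hφ.continuous_deriv (by simp)
  simp only [Pi.add_apply, add_mul]
  rw [integral_add (integrable_mul_of_hasCompactSupport hf hd hc.deriv)
    (integrable_mul_of_hasCompactSupport hf' hd hc.deriv),
    integral_add (integrable_mul_of_hasCompactSupport hg hφ.continuous hc)
    (integrable_mul_of_hasCompactSupport hg' hφ.continuous hc), h φ hφ hc, h' φ hφ hc]
  ring

namespace SobolevStrichartz

theorem mono {s : ℝ} {u : ℝ → ℝ → ℂ} {N N' : ℝ≥0∞} (h : SobolevStrichartz s u N) (hN : N ≤ N') :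
    SobolevStrichartz s u N' where
  bound := h.bound.mono hN
  exists_pair := by
    obtain ⟨g, hg⟩ := h.exists_pair
    exact ⟨g, fun t ↦ ⟨(hg t).1, (hg t).2.1, (hg t).2.2.trans hN⟩⟩
  exists_bessel hs := by
    obtain ⟨v, g, hv, hg⟩ := h.exists_bessel hs
    exact ⟨v, g, hv.mono hN, hg⟩
  exists_deriv hs := by
    obtain ⟨v, hv, hd⟩ := h.exists_deriv hs
    exact ⟨v, hv.mono hN, hd⟩

theorem add {s : ℝ} {u u' : ℝ → ℝ → ℂ} {N N' : ℝ≥0∞} (h : SobolevStrichartz s u N)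
    (h' : SobolevStrichartz s u' N') : SobolevStrichartz s (fun t ↦ u t + u' t) (N + N') where
  bound := h.bound.add h'.bound
  exists_pair := by
    obtain ⟨g, hg⟩ := h.exists_pair
    obtain ⟨g', hg'⟩ := h'.exists_pair
    refine ⟨fun t ↦ g t + g' t, fun t ↦ ⟨(hg t).1.add (hg' t).1, ?_⟩⟩
    have : (fun ξ ↦ (bracket s ξ : ℂ) * (g t + g' t) ξ) =
        (fun ξ ↦ (bracket s ξ : ℂ) * g t ξ) + fun ξ ↦ (bracket s ξ : ℂ) * g' t ξ := by
      funext ξ; simp [mul_add]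
    simp only [this]
    exact ⟨(hg t).2.1.add (hg' t).2.1, (eLpNorm_add_le (hg t).2.1.1 (hg' t).2.1.1
      (by norm_num)).trans (add_le_add (hg t).2.2 (hg' t).2.2)⟩
  exists_bessel hs := by
    obtain ⟨v, g, hv, hg⟩ := h.exists_bessel hs
    obtain ⟨v', g', hv', hg'⟩ := h'.exists_bessel hs
    refine ⟨_, fun t ↦ g t + g' t, hv.add hv', fun t ↦ ⟨(hg t).1.add (hg' t).1,
      ((hg t).2.add (hg' t).2).congr .rfl (.of_forall fun ξ ↦ ?_)⟩⟩
    simp [mul_add]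
  exists_deriv hs := by
    obtain ⟨v, hv, hd⟩ := h.exists_deriv hs
    obtain ⟨v', hv', hd'⟩ := h'.exists_deriv hs
    refine ⟨_, hv.add hv', fun t ↦ ⟨(hd t).1.add (hd' t).1, (hd t).2.add (hd' t).2 ?_ ?_ ?_ ?_⟩⟩
    · obtain ⟨g, hg⟩ := h.exists_pair
      exact (hg t).1.memLp_left.locallyIntegrable (by norm_num)
    · obtain ⟨g, hg⟩ := h'.exists_pair
      exact (hg t).1.memLp_left.locallyIntegrable (by norm_num)
    · exact (hd t).1.locallyIntegrable (by norm_num)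
    · exact (hd' t).1.locallyIntegrable (by norm_num)

end SobolevStrichartz

/-! ### `L²` bounds of integral operators with homogeneous kernels -/

theorem setLIntegral_rpow_mul_exp {x : ℝ} (hx : 0 < x) :
    ∫⁻ β in Ioi (0 : ℝ), ENNReal.ofReal (β ^ (-(1 / 2) : ℝ) * Real.exp (-(x * β))) =
      ENNReal.ofReal (√Real.pi * x ^ (-(1 / 2) : ℝ)) := by
  have hi : IntegrableOn (fun β : ℝ ↦ β ^ (-(1 / 2) : ℝ) * Real.exp (-(x * β))) (Ioi 0) volume := by
    simpa using integrableOn_rpow_mul_exp_neg_mul_rpow (s := -(1 / 2)) (p := 1) (b := x)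
      (by norm_num) one_pos hx
  rw [← ofReal_integral_eq_lintegral_ofReal hi]
  · have := Real.integral_rpow_mul_exp_neg_mul_Ioi (a := 1 / 2) (r := x) (by norm_num) hx
    rw [show (1 / 2 - 1 : ℝ) = -(1 / 2) by norm_num, Real.Gamma_one_half_eq] at this
    rw [this, one_div, Real.inv_rpow hx.le, ← Real.rpow_neg hx.le, mul_comm]
  · filter_upwards [ae_restrict_mem measurableSet_Ioi] with β hβ
    have : (0 : ℝ) < β := hβ
    positivity

/-- Schur's test with power weights: the splitting of the kernel by β^(-1/4) and β^(1/4) makes both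
resulting integrals equal to Γ(1/2) = √π times a power, and the two powers cancel. -/
theorem setLIntegral_laplace_sq_le {B : ℝ → ℝ≥0∞} (hB : Measurable B) :
    ∫⁻ x in Ioi (0 : ℝ), (∫⁻ β in Ioi (0 : ℝ), ENNReal.ofReal (Real.exp (-(x * β))) * B β) ^ 2 ≤
      ENNReal.ofReal Real.pi * ∫⁻ β in Ioi (0 : ℝ), B β ^ 2 := by
  have hcs : ∀ x ∈ Ioi (0 : ℝ),
      (∫⁻ β in Ioi (0 : ℝ), ENNReal.ofReal (Real.exp (-(x * β))) * B β) ^ 2 ≤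
      ∫⁻ β in Ioi (0 : ℝ), ENNReal.ofReal (√Real.pi * (x ^ (-(1 / 2) : ℝ) * Real.exp (-(β * x)))) *
        (ENNReal.ofReal (β ^ (1 / 2 : ℝ)) * B β ^ 2) := fun x hx ↦ by
    have hx : 0 < x := hx
    have h1 := lintegral_mul_sq_le (volume.restrict (Ioi (0 : ℝ)))
      (f := fun β ↦ ENNReal.ofReal (β ^ (-(1 / 4) : ℝ) * Real.exp (-(x * β / 2))))
      (g := fun β ↦ ENNReal.ofReal (β ^ (1 / 4 : ℝ) * Real.exp (-(x * β / 2))) * B β)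
      (by fun_prop) (by fun_prop)
    have e1 : ∫⁻ β in Ioi (0 : ℝ), ENNReal.ofReal (Real.exp (-(x * β))) * B β =
        ∫⁻ β in Ioi (0 : ℝ), ENNReal.ofReal (β ^ (-(1 / 4) : ℝ) * Real.exp (-(x * β / 2))) *
          (ENNReal.ofReal (β ^ (1 / 4 : ℝ) * Real.exp (-(x * β / 2))) * B β) := by
      refine setLIntegral_congr_fun measurableSet_Ioi fun β hβ ↦ ?_
      have hβ : 0 < β := hβ
      rw [← mul_assoc, ← ENNReal.ofReal_mul (by positivity)]
      congr 2
      rw [mul_mul_mul_comm, ← Real.rpow_add hβ, ← Real.exp_add]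
      norm_num
      ring
    have e2 : ∫⁻ β in Ioi (0 : ℝ), ENNReal.ofReal (β ^ (-(1 / 4) : ℝ) * Real.exp (-(x * β / 2))) ^ 2 =
        ENNReal.ofReal (√Real.pi * x ^ (-(1 / 2) : ℝ)) := by
      rw [← setLIntegral_rpow_mul_exp hx]
      refine setLIntegral_congr_fun measurableSet_Ioi fun β hβ ↦ ?_
      have hβ : 0 < β := hβ
      rw [← ENNReal.ofReal_pow (by positivity), mul_pow, ← Real.rpow_natCast, ← Real.rpow_mul hβ.le,
        ← Real.exp_nat_mul]
      congr 2
      · norm_num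
      · push_cast; ring_nf
    rw [e1]
    refine h1.trans (le_of_eq ?_)
    rw [e2, ← lintegral_const_mul _ (by fun_prop)]
    refine setLIntegral_congr_fun measurableSet_Ioi fun β hβ ↦ ?_
    have hβ : 0 < β := hβ
    rw [mul_pow, ← mul_assoc, ← mul_assoc, ← ENNReal.ofReal_pow (by positivity),
      ← ENNReal.ofReal_mul (by positivity), ← ENNReal.ofReal_mul (by positivity)]
    congr 2
    rw [mul_pow, ← Real.rpow_natCast, ← Real.rpow_mul hβ.le, ← Real.exp_nat_mul]
    have : ((2 : ℕ) : ℝ) * -(x * β / 2) = -(β * x) := by push_cast; ring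
    rw [this]
    norm_num
    ring
  calc _ ≤ ∫⁻ x in Ioi (0 : ℝ), ∫⁻ β in Ioi (0 : ℝ),
        ENNReal.ofReal (√Real.pi * (x ^ (-(1 / 2) : ℝ) * Real.exp (-(β * x)))) *
          (ENNReal.ofReal (β ^ (1 / 2 : ℝ)) * B β ^ 2) :=
        setLIntegral_mono' measurableSet_Ioi hcs
    _ = ∫⁻ β in Ioi (0 : ℝ), ∫⁻ x in Ioi (0 : ℝ),
        ENNReal.ofReal (√Real.pi * (x ^ (-(1 / 2) : ℝ) * Real.exp (-(β * x)))) *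
          (ENNReal.ofReal (β ^ (1 / 2 : ℝ)) * B β ^ 2) :=
        lintegral_lintegral_swap (Measurable.aemeasurable (by fun_prop))
    _ = ∫⁻ β in Ioi (0 : ℝ), ENNReal.ofReal Real.pi * B β ^ 2 := by
        refine setLIntegral_congr_fun measurableSet_Ioi fun β hβ ↦ ?_
        have hβ : 0 < β := hβ
        rw [lintegral_mul_const _ (by fun_prop)]
        simp only [ENNReal.ofReal_mul (Real.sqrt_nonneg Real.pi)]
        rw [lintegral_const_mul _ (by fun_prop), setLIntegral_rpow_mul_exp hβ,
          ← mul_assoc, ← ENNReal.ofReal_mul (by positivity), ← ENNReal.ofReal_mul (by positivity)]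
        congr 2
        rw [← mul_assoc, Real.mul_self_sqrt Real.pi_pos.le, mul_assoc, ← Real.rpow_add hβ]
        norm_num
    _ = _ := by rw [lintegral_const_mul _ (by fun_prop)]

theorem lintegral_comp_abs (F : ℝ → ℝ≥0∞) :
    ∫⁻ x, F |x| = 2 * ∫⁻ x in Ioi (0 : ℝ), F x := by
  rw [lintegral_eq_Ioi_add_Ioi_neg, two_mul]
  congr 1 <;> refine setLIntegral_congr_fun measurableSet_Ioi fun x hx ↦ ?_
  · simp [abs_of_pos (show (0 : ℝ) < x from hx)]
  · simp [abs_of_pos (show (0 : ℝ) < x from hx)]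

theorem lintegral_laplace_sq_le {B : ℝ → ℝ≥0∞} (hB : Measurable B) :
    ∫⁻ x, (∫⁻ β in Ioi (0 : ℝ), ENNReal.ofReal (Real.exp (-(|x| * β))) * B β) ^ 2 ≤
      2 * ENNReal.ofReal Real.pi * ∫⁻ β in Ioi (0 : ℝ), B β ^ 2 := by
  rw [lintegral_comp_abs fun x ↦
    (∫⁻ β in Ioi (0 : ℝ), ENNReal.ofReal (Real.exp (-(x * β))) * B β) ^ 2, mul_assoc]
  gcongr
  exact setLIntegral_laplace_sq_le hB

theorem setLIntegral_Ioi_comp_mul (F : ℝ → ℝ≥0∞) {c : ℝ} (hc : 0 < c) :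
    ∫⁻ x in Ioi (0 : ℝ), F (c * x) = ENNReal.ofReal c⁻¹ * ∫⁻ x in Ioi (0 : ℝ), F x := by
  rw [← lintegral_indicator measurableSet_Ioi, ← lintegral_indicator measurableSet_Ioi,
    ← abs_of_pos (inv_pos.2 hc), ← lintegral_comp_const_mul _ hc.ne']
  refine lintegral_congr fun x ↦ ?_
  by_cases hx : 0 < x
  · rw [indicator_of_mem (by exact hx), indicator_of_mem (by exact mul_pos hc hx)]
  · rw [indicator_of_notMem (by exact hx),
      indicator_of_notMem (by simpa using mul_nonpos_of_nonneg_of_nonpos hc.le (not_lt.1 hx))]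

/-- Schur's test for a superposition of dilations. -/
theorem lintegral_dilation_sq_le {k B : ℝ → ℝ≥0∞} (hk : Measurable k) (hB : Measurable B) :
    ∫⁻ x, (∫⁻ η in Ioi (0 : ℝ), k η * B (|x| * η)) ^ 2 ≤
      2 * (∫⁻ η in Ioi (0 : ℝ), k η * ENNReal.ofReal (η ^ (-(1 / 2) : ℝ))) ^ 2 *
        ∫⁻ β in Ioi (0 : ℝ), B β ^ 2 := by
  set A := ∫⁻ η in Ioi (0 : ℝ), k η * ENNReal.ofReal (η ^ (-(1 / 2) : ℝ)) with hA
  rw [lintegral_comp_abs fun x ↦ (∫⁻ η in Ioi (0 : ℝ), k η * B (x * η)) ^ 2, mul_assoc]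
  gcongr
  have hcs : ∀ x : ℝ, (∫⁻ η in Ioi (0 : ℝ), k η * B (x * η)) ^ 2 ≤
      A * ∫⁻ η in Ioi (0 : ℝ), k η * ENNReal.ofReal (η ^ (1 / 2 : ℝ)) * B (x * η) ^ 2 := fun x ↦ by
    -- The weights η^(∓1/4) are chosen so that the x-integral of B(xη)², which produces 1/η, leaves
    -- the same integral A as the first Cauchy–Schwarz factor.
    have h1 := lintegral_mul_sq_le (volume.restrict (Ioi (0 : ℝ)))
      (f := fun η ↦ k η ^ (1 / 2 : ℝ) * ENNReal.ofReal (η ^ (-(1 / 4) : ℝ)))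
      (g := fun η ↦ k η ^ (1 / 2 : ℝ) * ENNReal.ofReal (η ^ (1 / 4 : ℝ)) * B (x * η))
      (by fun_prop) (by fun_prop)
    have hk2 : ∀ η, k η ^ (1 / 2 : ℝ) * k η ^ (1 / 2 : ℝ) = k η := fun η ↦ by
      rw [← ENNReal.rpow_add_of_nonneg _ _ (by norm_num) (by norm_num)]; norm_num
    have hr : ∀ η ∈ Ioi (0 : ℝ), ∀ a b c : ℝ, a + b = c →
        ENNReal.ofReal (η ^ a) * ENNReal.ofReal (η ^ b) = ENNReal.ofReal (η ^ c) :=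
      fun η hη a b c h ↦ by
        have hη : 0 < η := hη
        rw [← ENNReal.ofReal_mul (by positivity), ← Real.rpow_add hη, h]
    convert h1 using 2
    · refine setLIntegral_congr_fun measurableSet_Ioi fun η hη ↦ ?_
      calc k η * B (x * η) = (k η ^ (1 / 2 : ℝ) * k η ^ (1 / 2 : ℝ)) *
            (ENNReal.ofReal (η ^ (-(1 / 4) : ℝ)) * ENNReal.ofReal (η ^ (1 / 4 : ℝ))) *
            B (x * η) := by
            rw [hk2, hr η hη _ _ 0 (by norm_num)]; simp
        _ = _ := by ring
    · refine setLIntegral_congr_fun measurableSet_Ioi fun η hη ↦ ?_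
      rw [mul_pow, sq, sq, hk2, hr η hη _ _ (-(1 / 2)) (by norm_num)]
    · refine setLIntegral_congr_fun measurableSet_Ioi fun η hη ↦ ?_
      rw [mul_pow, mul_pow, sq (k η ^ _), sq (ENNReal.ofReal _), hk2,
        hr η hη _ _ (1 / 2) (by norm_num)]
  calc _ ≤ ∫⁻ x in Ioi (0 : ℝ),
        A * ∫⁻ η in Ioi (0 : ℝ), k η * ENNReal.ofReal (η ^ (1 / 2 : ℝ)) * B (x * η) ^ 2 :=
        lintegral_mono hcs
    _ = A * ∫⁻ η in Ioi (0 : ℝ), ∫⁻ x in Ioi (0 : ℝ),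
          k η * ENNReal.ofReal (η ^ (1 / 2 : ℝ)) * B (x * η) ^ 2 := by
        rw [lintegral_const_mul _ (Measurable.lintegral_prod_right' (f := fun p : ℝ × ℝ ↦
            k p.2 * ENNReal.ofReal (p.2 ^ (1 / 2 : ℝ)) * B (p.1 * p.2) ^ 2) (by fun_prop)),
          lintegral_lintegral_swap (Measurable.aemeasurable (by fun_prop))]
    _ = A * ∫⁻ η in Ioi (0 : ℝ), k η * ENNReal.ofReal (η ^ (-(1 / 2) : ℝ)) *
          ∫⁻ β in Ioi (0 : ℝ), B β ^ 2 := by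
        congr 1
        refine setLIntegral_congr_fun measurableSet_Ioi fun η hη ↦ ?_
        have hη : 0 < η := hη
        rw [lintegral_const_mul _ (by fun_prop)]
        simp only [mul_comm _ η]
        rw [setLIntegral_Ioi_comp_mul (fun x ↦ B x ^ 2) hη, ← mul_assoc, mul_assoc (k η),
          ← ENNReal.ofReal_mul (by positivity), ← Real.rpow_neg_one η, ← Real.rpow_add hη]
        norm_num
    _ = _ := by rw [lintegral_mul_const _ (by fun_prop), sq, mul_assoc]

/-! ### Laplace integrals on the line and their Fourier transforms -/

theorem lintegral_eq_setLIntegral_Ioi {F : ℝ → ℝ≥0∞} (h : ∀ β ≤ 0, F β = 0) :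
    ∫⁻ β, F β = ∫⁻ β in Ioi (0 : ℝ), F β := by
  rw [← lintegral_indicator measurableSet_Ioi]
  refine lintegral_congr fun β ↦ ?_
  by_cases hβ : 0 < β
  · rw [indicator_of_mem (by exact hβ)]
  · rw [indicator_of_notMem (by exact hβ), h β (not_lt.1 hβ)]

/-- Cauchy–Schwarz in x against the L² bound of the positive kernel gives the absolute integrability
behind every exchange of integrals for Laplace and Poisson integrals. -/
theorem integrable_kernel_mul {a ν : ℝ → ℂ} {K : ℝ → ℝ → ℝ} (ham : Measurable a)
    (ha : MemLp a 2 volume) (hνm : Measurable ν) (hK : Measurable fun p : ℝ × ℝ ↦ K p.1 p.2)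
    (h : ∫⁻ x, (∫⁻ β, ‖K x β‖ₑ * ‖ν β‖ₑ) ^ 2 < ⊤) :
    Integrable (fun p : ℝ × ℝ ↦ a p.1 * (K p.1 p.2 * ν p.2)) (volume.prod volume) := by
  refine ⟨Measurable.aestronglyMeasurable (by fun_prop), ?_⟩
  have hm : Measurable fun x ↦ ∫⁻ β, ‖K x β‖ₑ * ‖ν β‖ₑ :=
    Measurable.lintegral_prod_right' (f := fun p : ℝ × ℝ ↦ ‖K p.1 p.2‖ₑ * ‖ν p.2‖ₑ) (by fun_prop)
  rw [HasFiniteIntegral, lintegral_prod _ (Measurable.aemeasurable (by fun_prop))]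
  have e1 : ∫⁻ x, ∫⁻ β, ‖a x * (K x β * ν β)‖ₑ = ∫⁻ x, ‖a x‖ₑ * ∫⁻ β, ‖K x β‖ₑ * ‖ν β‖ₑ := by
    refine lintegral_congr fun x ↦ ?_
    rw [← lintegral_const_mul _ (by fun_prop)]
    refine lintegral_congr fun β ↦ ?_
    rw [enorm_mul, enorm_mul]
    congr 2
    rw [← ofReal_norm, Complex.norm_real, ofReal_norm]
  rw [e1]
  have h1 := lintegral_mul_sq_le volume (f := fun x ↦ ‖a x‖ₑ) (by fun_prop) hm.aemeasurable
  rw [← eLpNorm_two_sq] at h1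
  by_contra hcon
  rw [not_lt, top_le_iff] at hcon
  rw [hcon] at h1
  exact absurd (h1.trans_lt (ENNReal.mul_lt_top (ENNReal.pow_lt_top ha.2) h)) (by simp)

theorem integral_kernel_swap {a ν : ℝ → ℂ} {K : ℝ → ℝ → ℝ} (ham : Measurable a)
    (ha : MemLp a 2 volume) (hνm : Measurable ν) (hK : Measurable fun p : ℝ × ℝ ↦ K p.1 p.2)
    (h : ∫⁻ x, (∫⁻ β, ‖K x β‖ₑ * ‖ν β‖ₑ) ^ 2 < ⊤) :
    ∫ x, a x * ∫ β, K x β * ν β = ∫ β, ν β * ∫ x, a x * K x β := by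
  simp only [← integral_const_mul]
  rw [integral_integral_swap (integrable_kernel_mul ham ha hνm hK h)]
  refine integral_congr_ae (.of_forall fun β ↦ integral_congr_ae (.of_forall fun x ↦ ?_))
  simp only
  ring

/-- The integral `∫ e^{-β|x|} ν(β) dβ`. -/
def laplaceEven (ν : ℝ → ℂ) (x : ℝ) : ℂ := ∫ β, (Real.exp (-(|x| * β)) : ℂ) * ν β

/-- The Poisson kernel: the Fourier transform of `e^{-β|x|}`. -/
def poissonKernel (ξ β : ℝ) : ℝ := 2 * β / (β ^ 2 + (2 * Real.pi * ξ) ^ 2)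

/-- The Fourier transform of `laplaceEven ν`. -/
def poissonTransform (ν : ℝ → ℂ) (ξ : ℝ) : ℂ := ∫ β, (poissonKernel ξ β : ℂ) * ν β

theorem measurable_poissonKernel : Measurable fun p : ℝ × ℝ ↦ poissonKernel p.1 p.2 := by
  unfold poissonKernel; fun_prop

theorem measurable_kernel_integral {ν : ℝ → ℂ} (hν : Measurable ν) {K : ℝ → ℝ → ℝ}
    (hK : Measurable fun p : ℝ × ℝ ↦ K p.1 p.2) :
    Measurable fun x ↦ ∫ β, (K x β : ℂ) * ν β := by
  have : StronglyMeasurable (Function.uncurry fun x β ↦ (K x β : ℂ) * ν β) := by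
    refine Measurable.stronglyMeasurable ?_
    change Measurable fun p : ℝ × ℝ ↦ (K p.1 p.2 : ℂ) * ν p.2
    fun_prop
  exact this.integral_prod_right.measurable

theorem measurable_laplaceEven {ν : ℝ → ℂ} (hν : Measurable ν) : Measurable (laplaceEven ν) :=
  measurable_kernel_integral hν (K := fun x β ↦ Real.exp (-(|x| * β))) (by fun_prop)

theorem measurable_poissonTransform {ν : ℝ → ℂ} (hν : Measurable ν) :
    Measurable (poissonTransform ν) :=
  measurable_kernel_integral hν measurable_poissonKernel

theorem lintegral_laplaceEven_sq_le {ν : ℝ → ℂ} (hν : Measurable ν) (hs : ∀ β ≤ 0, ν β = 0) :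
    ∫⁻ x, (∫⁻ β, ‖Real.exp (-(|x| * β))‖ₑ * ‖ν β‖ₑ) ^ 2 ≤
      2 * ENNReal.ofReal Real.pi * ∫⁻ β, ‖ν β‖ₑ ^ 2 := by
  rw [lintegral_eq_setLIntegral_Ioi (F := fun β ↦ ‖ν β‖ₑ ^ 2) fun β hβ ↦ by simp [hs β hβ]]
  refine le_of_eq_of_le (lintegral_congr fun x ↦ ?_)
    (lintegral_laplace_sq_le (B := fun β ↦ ‖ν β‖ₑ) (by fun_prop))
  rw [lintegral_eq_setLIntegral_Ioi fun β hβ ↦ by simp [hs β hβ]]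
  simp only [Real.enorm_of_nonneg (Real.exp_pos _).le]

theorem enorm_kernel_integral_le (ν : ℝ → ℂ) (K : ℝ → ℝ) :
    ‖∫ β, (K β : ℂ) * ν β‖ₑ ≤ ∫⁻ β, ‖K β‖ₑ * ‖ν β‖ₑ := by
  refine (enorm_integral_le_lintegral_enorm _).trans (le_of_eq (lintegral_congr fun β ↦ ?_))
  rw [enorm_mul]
  congr 1
  rw [← ofReal_norm, Complex.norm_real, ofReal_norm]

theorem eLpNorm_laplaceEven_sq_le {ν : ℝ → ℂ} (hν : Measurable ν) (hs : ∀ β ≤ 0, ν β = 0) :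
    eLpNorm (laplaceEven ν) 2 volume ^ 2 ≤
      2 * ENNReal.ofReal Real.pi * eLpNorm ν 2 volume ^ 2 := by
  rw [eLpNorm_two_sq, eLpNorm_two_sq]
  refine le_trans (lintegral_mono fun x ↦ ?_) (lintegral_laplaceEven_sq_le hν hs)
  exact pow_le_pow_left₀ zero_le (enorm_kernel_integral_le ν _) 2

theorem memLp_of_eLpNorm_sq_le {f : ℝ → ℂ} (hf : AEStronglyMeasurable f volume) {c : ℝ≥0∞}
    (h : eLpNorm f 2 volume ^ 2 ≤ c) (hc : c ≠ ⊤) : MemLp f 2 volume :=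
  ⟨hf, by
    by_contra hcon
    rw [not_lt, top_le_iff] at hcon
    rw [hcon] at h
    exact hc (top_le_iff.1 (le_of_eq_of_le (by simp) h))⟩

theorem memLp_laplaceEven {ν : ℝ → ℂ} (hνm : Measurable ν) (hs : ∀ β ≤ 0, ν β = 0)
    (hν : MemLp ν 2 volume) : MemLp (laplaceEven ν) 2 volume :=
  memLp_of_eLpNorm_sq_le (measurable_laplaceEven hνm).aestronglyMeasurable
    (eLpNorm_laplaceEven_sq_le hνm hs) (ENNReal.mul_ne_top (by finiteness)
      (ENNReal.pow_ne_top hν.2.ne))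

/-- The kernel of the weighted `L²` bound of the Poisson transform. -/
def schurKernel (η : ℝ) : ℝ≥0∞ := ENNReal.ofReal ((1 + 1 / η) * (2 * η / (1 + η ^ 2)))

/-- The constant of the weighted `L²` bound of the Poisson transform. -/
def schurConst : ℝ≥0∞ :=
  2 * ∫⁻ η in Ioi (0 : ℝ), schurKernel η * ENNReal.ofReal (η ^ (-(1 / 2) : ℝ))

/-- The kernel equals 2(1+η)/(1+η²): bounded near 0 and of order 1/η at infinity, so the extra
factor η^(-1/2) leaves both ends integrable. -/
theorem schurConst_ne_top : schurConst ≠ ⊤ := by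
  refine ENNReal.mul_ne_top (by norm_num) ?_
  rw [← Ioc_union_Ioi_eq_Ioi (zero_le_one' ℝ)]
  refine ne_top_of_le_ne_top ?_ (lintegral_union_le _ _ _)
  refine ENNReal.add_ne_top.2 ⟨?_, ?_⟩
  · refine ne_top_of_le_ne_top (b := ∫⁻ η in Ioc (0 : ℝ) 1, 4 * ENNReal.ofReal (η ^ (-(1 / 2) : ℝ)))
      ?_ (setLIntegral_mono' measurableSet_Ioc fun η hη ↦ ?_)
    · rw [lintegral_const_mul _ (by fun_prop), setLIntegral_Ioc_rpow (by norm_num) zero_le_one]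
      finiteness
    · gcongr
      refine ENNReal.ofReal_le_of_le_toReal ?_
      have hη0 : 0 < η := hη.1
      have h1 : (1 + 1 / η) * (2 * η / (1 + η ^ 2)) = 2 * (1 + η) / (1 + η ^ 2) := by
        field_simp; ring
      rw [h1, div_le_iff₀ (by positivity)]
      norm_num
      nlinarith [hη.2]
  · refine ne_top_of_le_ne_top (b := ∫⁻ η in Ioi (1 : ℝ), 4 * ENNReal.ofReal (η ^ (-(3 / 2) : ℝ)))
      ?_ (setLIntegral_mono' measurableSet_Ioi fun η hη ↦ ?_)
    · rw [lintegral_const_mul _ (by fun_prop), setLIntegral_Ioi_rpow (by norm_num) one_pos]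
      finiteness
    · have hη1 : 1 < η := hη
      have hη0 : 0 < η := by linarith
      have h1 : (1 + 1 / η) * (2 * η / (1 + η ^ 2)) ≤ 4 * η ^ (-1 : ℝ) := by
        rw [Real.rpow_neg_one, ← div_eq_mul_inv]
        have h1 : (1 + 1 / η) * (2 * η / (1 + η ^ 2)) = 2 * (1 + η) / (1 + η ^ 2) := by
          field_simp; ring
        rw [h1, div_le_div_iff₀ (by positivity) hη0]
        nlinarith
      calc schurKernel η * ENNReal.ofReal (η ^ (-(1 / 2) : ℝ))
          ≤ ENNReal.ofReal (4 * η ^ (-1 : ℝ)) * ENNReal.ofReal (η ^ (-(1 / 2) : ℝ)) := by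
            gcongr
            exact ENNReal.ofReal_le_ofReal h1
        _ = 4 * ENNReal.ofReal (η ^ (-(3 / 2) : ℝ)) := by
            rw [← ENNReal.ofReal_mul (by positivity), mul_assoc, ← Real.rpow_add hη0,
              ENNReal.ofReal_mul (by norm_num)]
            norm_num

/-- Moving the Sobolev weight from ξ to the density variable |ξ|η costs at most 1 + 1/η when s ≤ 1,
which is the extra factor in `schurKernel`. -/
theorem bracket_le_mul_bracket {s : ℝ} (h0 : 0 ≤ s) (h1 : s ≤ 1) (ξ : ℝ) {η : ℝ} (hη : 0 < η) :
    bracket s ξ ≤ (1 + 1 / η) * bracket s (|ξ| * η) := by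
  have h2 : 1 + ξ ^ 2 ≤ (1 + 1 / η) ^ 2 * (1 + (|ξ| * η) ^ 2) := by
    rw [mul_pow, sq_abs]
    have e : (1 + 1 / η) ^ 2 * (1 + ξ ^ 2 * η ^ 2) =
        (1 + 1 / η) ^ 2 + ξ ^ 2 * (η + 1) ^ 2 := by field_simp
    rw [e]
    have : 0 < 1 / η := by positivity
    nlinarith [mul_nonneg (sq_nonneg ξ) hη.le, mul_nonneg (sq_nonneg ξ) (sq_nonneg η)]
  calc bracket s ξ ≤ ((1 + 1 / η) ^ 2 * (1 + (|ξ| * η) ^ 2)) ^ (s / 2) :=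
        Real.rpow_le_rpow (by positivity) h2 (by linarith)
    _ = (1 + 1 / η) ^ s * bracket s (|ξ| * η) := by
        rw [Real.mul_rpow (by positivity) (by positivity), ← Real.rpow_natCast,
          ← Real.rpow_mul (by positivity), bracket]
        congr 2
        push_cast; ring
    _ ≤ _ := by
        gcongr
        · exact (bracket_pos _ _).le
        · have h3 : (1 : ℝ) ≤ 1 + 1 / η := by
            have : 0 < 1 / η := by positivity
            linarith
          calc (1 + 1 / η) ^ s ≤ (1 + 1 / η) ^ (1 : ℝ) := Real.rpow_le_rpow_of_exponent_le h3 h1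
            _ = _ := Real.rpow_one _

/-- The Poisson kernel is homogeneous of degree -1 in (2πξ, β), so β = 2π|ξ|η turns the transform
into a superposition of dilations with kernel 2η/(1+η²), to which Schur's test applies once the
weight has been moved to ν. -/
theorem lintegral_poissonKernel_sq_le {s : ℝ} (h0 : 0 ≤ s) (h1 : s ≤ 1) {ν : ℝ → ℂ}
    (hν : Measurable ν) (hs : ∀ β ≤ 0, ν β = 0) :
    ∫⁻ ξ, (∫⁻ β, ‖bracket s ξ * poissonKernel ξ β‖ₑ * ‖ν β‖ₑ) ^ 2 ≤
      schurConst ^ 2 * ∫⁻ β, ‖(bracket s (β / (2 * Real.pi)) : ℂ) * ν β‖ₑ ^ 2 := by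
  have hp := Real.two_pi_pos
  have hbm : Measurable fun β : ℝ ↦ (bracket s (β / (2 * Real.pi)) : ℂ) * ν β :=
    (continuous_bracket_div s).measurable.mul hν
  set B : ℝ → ℝ≥0∞ := fun x ↦
    ‖(bracket s (2 * Real.pi * x / (2 * Real.pi)) : ℂ) * ν (2 * Real.pi * x)‖ₑ with hB
  have hBm : Measurable B := (hbm.comp (measurable_const_mul (2 * Real.pi))).enorm
  have hkm : Measurable schurKernel := by unfold schurKernel; fun_prop
  have key : ∀ ξ : ℝ, ξ ≠ 0 → ∫⁻ β, ‖bracket s ξ * poissonKernel ξ β‖ₑ * ‖ν β‖ₑ ≤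
      ∫⁻ η in Ioi (0 : ℝ), schurKernel η * B (|ξ| * η) := fun ξ hξ ↦ by
    have hc : 0 < 2 * Real.pi * |ξ| := by positivity
    rw [lintegral_eq_setLIntegral_Ioi fun β hβ ↦ by simp [hs β hβ]]
    have e1 := setLIntegral_Ioi_comp_mul
      (fun β ↦ ‖bracket s ξ * poissonKernel ξ β‖ₑ * ‖ν β‖ₑ) hc
    have e2 : ∫⁻ β in Ioi (0 : ℝ), ‖bracket s ξ * poissonKernel ξ β‖ₑ * ‖ν β‖ₑ =
        ENNReal.ofReal (2 * Real.pi * |ξ|) * ∫⁻ η in Ioi (0 : ℝ),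
          ‖bracket s ξ * poissonKernel ξ (2 * Real.pi * |ξ| * η)‖ₑ *
            ‖ν (2 * Real.pi * |ξ| * η)‖ₑ := by
      rw [e1, ← mul_assoc, ← ENNReal.ofReal_mul hc.le, mul_inv_cancel₀ hc.ne']
      simp
    rw [e2, ← lintegral_const_mul' _ _ (by finiteness)]
    refine setLIntegral_mono' measurableSet_Ioi fun η hη ↦ ?_
    have hη : 0 < η := hη
    have e3 : poissonKernel ξ (2 * Real.pi * |ξ| * η) =
        (2 * Real.pi * |ξ|)⁻¹ * (2 * η / (1 + η ^ 2)) := by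
      have : (2 * Real.pi * ξ) ^ 2 = (2 * Real.pi * |ξ|) ^ 2 := by simp [mul_pow]
      rw [poissonKernel, this]
      field_simp
      ring
    simp only [hB]
    rw [schurKernel, ← mul_assoc (2 * Real.pi) |ξ| η, enorm_mul (bracket s _ : ℂ), ← mul_assoc,
      ← mul_assoc]
    gcongr ?_ * _
    rw [e3, Real.enorm_of_nonneg (mul_nonneg (bracket_pos _ _).le (by positivity)),
      ← ofReal_norm, Complex.norm_real, Real.norm_of_nonneg (bracket_pos _ _).le,
      ← ENNReal.ofReal_mul hc.le, ← ENNReal.ofReal_mul (by positivity)]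
    refine ENNReal.ofReal_le_ofReal ?_
    rw [show 2 * Real.pi * |ξ| * η / (2 * Real.pi) = |ξ| * η by field_simp]
    have h3 := bracket_le_mul_bracket h0 h1 ξ hη
    have h4 : 0 ≤ 2 * η / (1 + η ^ 2) := by positivity
    calc _ = bracket s ξ * (2 * η / (1 + η ^ 2)) := by field_simp
      _ ≤ ((1 + 1 / η) * bracket s (|ξ| * η)) * (2 * η / (1 + η ^ 2)) := by gcongr
      _ = _ := by ring
  calc _ ≤ ∫⁻ ξ, (∫⁻ η in Ioi (0 : ℝ), schurKernel η * B (|ξ| * η)) ^ 2 := by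
        refine lintegral_mono_ae ?_
        filter_upwards [Measure.ae_ne volume (0 : ℝ)] with ξ hξ
        exact pow_le_pow_left₀ zero_le (key ξ hξ) 2
    _ ≤ _ := lintegral_dilation_sq_le hkm hBm
    _ ≤ schurConst ^ 2 * ∫⁻ β in Ioi (0 : ℝ), B β ^ 2 := by
        gcongr
        rw [schurConst, mul_pow]
        gcongr
        norm_num
    _ ≤ _ := by
        refine mul_le_mul_right ?_ _
        have := setLIntegral_Ioi_comp_mul
          (fun β ↦ ‖(bracket s (β / (2 * Real.pi)) : ℂ) * ν β‖ₑ ^ 2) hp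
        rw [hB, this]
        calc _ ≤ 1 * ∫⁻ β in Ioi (0 : ℝ), ‖(bracket s (β / (2 * Real.pi)) : ℂ) * ν β‖ₑ ^ 2 := by
              gcongr
              rw [ENNReal.ofReal_le_one]
              exact inv_le_one_of_one_le₀ (by linarith [Real.pi_gt_three])
          _ ≤ _ := by
              rw [one_mul]
              exact setLIntegral_le_lintegral _ _

theorem ae_integrable_kernel_mul {ν : ℝ → ℂ} {K : ℝ → ℝ → ℝ} (hνm : Measurable ν)
    (hK : Measurable fun p : ℝ × ℝ ↦ K p.1 p.2)
    (h : ∫⁻ x, (∫⁻ β, ‖K x β‖ₑ * ‖ν β‖ₑ) ^ 2 < ⊤) :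
    ∀ᵐ x, Integrable (fun β ↦ (K x β : ℂ) * ν β) volume := by
  have hm : Measurable fun x ↦ ∫⁻ β, ‖K x β‖ₑ * ‖ν β‖ₑ :=
    Measurable.lintegral_prod_right' (f := fun p : ℝ × ℝ ↦ ‖K p.1 p.2‖ₑ * ‖ν p.2‖ₑ) (by fun_prop)
  filter_upwards [ae_lt_top (hm.pow_const 2) h.ne] with x hx
  have hKx : Measurable (K x) := hK.comp (f := fun β : ℝ ↦ (x, β)) (by fun_prop)
  refine ⟨Measurable.aestronglyMeasurable (by fun_prop), ?_⟩
  rw [HasFiniteIntegral]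
  refine lt_of_le_of_lt (lintegral_mono fun β ↦ ?_) ((ENNReal.pow_lt_top_iff).1 hx |>.resolve_right
    (by norm_num))
  rw [enorm_mul, ← ofReal_norm (K x β : ℂ), Complex.norm_real, ofReal_norm]

theorem ae_kernel_integral_sub {ν ν' : ℝ → ℂ} {K : ℝ → ℝ → ℝ} (hνm : Measurable ν)
    (hνm' : Measurable ν') (hK : Measurable fun p : ℝ × ℝ ↦ K p.1 p.2)
    (h : ∫⁻ x, (∫⁻ β, ‖K x β‖ₑ * ‖ν β‖ₑ) ^ 2 < ⊤)
    (h' : ∫⁻ x, (∫⁻ β, ‖K x β‖ₑ * ‖ν' β‖ₑ) ^ 2 < ⊤) :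
    ∀ᵐ x, ∫ β, (K x β : ℂ) * (ν - ν') β = (∫ β, (K x β : ℂ) * ν β) - ∫ β, (K x β : ℂ) * ν' β := by
  filter_upwards [ae_integrable_kernel_mul hνm hK h, ae_integrable_kernel_mul hνm' hK h']
    with x hx hx'
  rw [← integral_sub hx hx']
  simp [mul_sub]

/-- The densities whose Laplace integral lies in `H^s`: measurable, supported in `(0, ∞)`, and
square integrable with a weight. -/
structure IsLaplaceDensity (s : ℝ) (ν : ℝ → ℂ) : Prop where
  nonneg : 0 ≤ s
  le_one : s ≤ 1
  measurable : Measurable ν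
  eq_zero : ∀ β ≤ 0, ν β = 0
  memLp_weight : MemLp (fun β ↦ bracket s (β / (2 * Real.pi)) * ν β) 2 volume

namespace IsLaplaceDensity

variable {s : ℝ} {ν ν' : ℝ → ℂ}

theorem memLp (h : IsLaplaceDensity s ν) : MemLp ν 2 volume :=
  memLp_of_memLp_bracket_mul h.nonneg h.measurable.aestronglyMeasurable h.memLp_weight

theorem zero (h : IsLaplaceDensity s ν) : IsLaplaceDensity 0 ν :=
  ⟨le_rfl, zero_le_one, h.measurable, h.eq_zero, by simpa [bracket] using h.memLp⟩

theorem sub (h : IsLaplaceDensity s ν) (h' : IsLaplaceDensity s ν') :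
    IsLaplaceDensity s (ν - ν') :=
  ⟨h.nonneg, h.le_one, h.measurable.sub h'.measurable,
    fun β hβ ↦ by simp [h.eq_zero β hβ, h'.eq_zero β hβ], by
    convert h.memLp_weight.sub h'.memLp_weight using 1
    funext β
    simp [mul_sub]⟩

theorem indicator (h : IsLaplaceDensity s ν) {S : Set ℝ} (hS : MeasurableSet S) :
    IsLaplaceDensity s (S.indicator ν) :=
  ⟨h.nonneg, h.le_one, h.measurable.indicator hS,
    fun β hβ ↦ by by_cases hb : β ∈ S <;> simp [hb, h.eq_zero β hβ], by
    refine (memLp_congr_ae (.of_forall fun β ↦ ?_)).1 (h.memLp_weight.indicator hS)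
    by_cases hb : β ∈ S <;> simp [hb]⟩

theorem freePhase_mul (h : IsLaplaceDensity s ν) (t : ℝ) :
    IsLaplaceDensity s (fun β ↦ freePhase t β * ν β) :=
  ⟨h.nonneg, h.le_one, (continuous_freePhase_right t).measurable.mul h.measurable,
    fun β hβ ↦ by simp [h.eq_zero β hβ], by
    convert memLp_freePhase_mul h.memLp_weight t using 1
    funext β
    ring⟩

theorem lintegral_kernel_lt_top (h : IsLaplaceDensity s ν) :
    ∫⁻ ξ, (∫⁻ β, ‖bracket s ξ * poissonKernel ξ β‖ₑ * ‖ν β‖ₑ) ^ 2 < ⊤ := by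
  refine (lintegral_poissonKernel_sq_le h.nonneg h.le_one h.measurable h.eq_zero).trans_lt ?_
  rw [← eLpNorm_two_sq]
  exact ENNReal.mul_lt_top (ENNReal.pow_lt_top schurConst_ne_top.lt_top)
    (ENNReal.pow_lt_top h.memLp_weight.2)

theorem lintegral_poissonKernel_lt_top (h : IsLaplaceDensity s ν) :
    ∫⁻ ξ, (∫⁻ β, ‖poissonKernel ξ β‖ₑ * ‖ν β‖ₑ) ^ 2 < ⊤ := by
  simpa [bracket] using h.zero.lintegral_kernel_lt_top

theorem lintegral_exp_lt_top (h : IsLaplaceDensity s ν) :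
    ∫⁻ x, (∫⁻ β, ‖Real.exp (-(|x| * β))‖ₑ * ‖ν β‖ₑ) ^ 2 < ⊤ := by
  refine (lintegral_laplaceEven_sq_le h.measurable h.eq_zero).trans_lt ?_
  rw [← eLpNorm_two_sq]
  exact ENNReal.mul_lt_top (by finiteness) (ENNReal.pow_lt_top h.memLp.2)

theorem eLpNorm_bracket_poissonTransform_le (h : IsLaplaceDensity s ν) :
    eLpNorm (fun ξ ↦ bracket s ξ * poissonTransform ν ξ) 2 volume ≤
      schurConst * eLpNorm (fun β ↦ bracket s (β / (2 * Real.pi)) * ν β) 2 volume := by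
  refine (ENNReal.pow_right_strictMono (n := 2) (by norm_num)).le_iff_le.1 ?_
  rw [mul_pow, eLpNorm_two_sq, eLpNorm_two_sq]
  refine le_trans (lintegral_mono fun ξ ↦ pow_le_pow_left₀ zero_le ?_ 2)
    (lintegral_poissonKernel_sq_le h.nonneg h.le_one h.measurable h.eq_zero)
  refine le_of_eq_of_le ?_ (enorm_kernel_integral_le ν fun β ↦ bracket s ξ * poissonKernel ξ β)
  rw [poissonTransform, ← integral_const_mul]
  simp [mul_assoc]

theorem memLp_bracket_poissonTransform (h : IsLaplaceDensity s ν) :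
    MemLp (fun ξ ↦ bracket s ξ * poissonTransform ν ξ) 2 volume :=
  ⟨((Complex.continuous_ofReal.comp (continuous_bracket s)).measurable.mul
    (measurable_poissonTransform h.measurable)).aestronglyMeasurable,
    h.eLpNorm_bracket_poissonTransform_le.trans_lt
      (ENNReal.mul_lt_top schurConst_ne_top.lt_top h.memLp_weight.2)⟩

theorem memLp_poissonTransform (h : IsLaplaceDensity s ν) :
    MemLp (poissonTransform ν) 2 volume := by
  simpa [bracket] using h.zero.memLp_bracket_poissonTransform

end IsLaplaceDensity

theorem integrableOn_exp_neg_abs {β : ℝ} (hβ : 0 < β) (ξ : ℝ) :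
    IntegrableOn (fun v : ℝ ↦ Complex.exp (((-2 * Real.pi * (v * ξ) : ℝ) : ℂ) * Complex.I) *
      (Real.exp (-(|v| * β)) : ℂ)) (Iic 0) volume ∧
    IntegrableOn (fun v : ℝ ↦ Complex.exp (((-2 * Real.pi * (v * ξ) : ℝ) : ℂ) * Complex.I) *
      (Real.exp (-(|v| * β)) : ℂ)) (Ioi 0) volume ∧
    ∫ v : ℝ, Complex.exp (((-2 * Real.pi * (v * ξ) : ℝ) : ℂ) * Complex.I) *
      (Real.exp (-(|v| * β)) : ℂ) = poissonKernel ξ β := by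
  set F := fun v : ℝ ↦ Complex.exp (((-2 * Real.pi * (v * ξ) : ℝ) : ℂ) * Complex.I) *
      (Real.exp (-(|v| * β)) : ℂ) with hF
  set a : ℂ := -β - 2 * Real.pi * ξ * Complex.I with ha
  set b : ℂ := β - 2 * Real.pi * ξ * Complex.I with hb
  have hare : a.re < 0 := by simp [ha, hβ]
  have hbre : 0 < b.re := by simp [hb, hβ]
  have ea : ∀ v ∈ Ioi (0 : ℝ), F v = Complex.exp (a * v) := fun v hv ↦ by
    simp only [hF]
    rw [abs_of_pos hv, Complex.ofReal_exp, ← Complex.exp_add, ha]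
    congr 1
    push_cast; ring
  have eb : ∀ v ∈ Iic (0 : ℝ), F v = Complex.exp (b * v) := fun v hv ↦ by
    simp only [hF]
    rw [abs_of_nonpos hv, Complex.ofReal_exp, ← Complex.exp_add, hb]
    congr 1
    push_cast; ring
  have i1 : IntegrableOn F (Iic 0) volume :=
    (integrableOn_congr_fun eb measurableSet_Iic).2 (integrableOn_exp_mul_complex_Iic hbre 0)
  have i2 : IntegrableOn F (Ioi 0) volume :=
    (integrableOn_congr_fun ea measurableSet_Ioi).2 (integrableOn_exp_mul_complex_Ioi hare 0)
  refine ⟨i1, i2, ?_⟩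
  rw [← intervalIntegral.integral_Iic_add_Ioi i1 i2, setIntegral_congr_fun measurableSet_Iic eb,
    setIntegral_congr_fun measurableSet_Ioi ea, integral_exp_mul_complex_Ioi hare,
    integral_exp_mul_complex_Iic hbre]
  have ha0 : a ≠ 0 := fun h ↦ by simp [h] at hare
  have hb0 : b ≠ 0 := fun h ↦ by simp [h] at hbre
  have hab : a * b = -((β ^ 2 + (2 * Real.pi * ξ) ^ 2 : ℝ) : ℂ) := by
    rw [ha, hb]
    push_cast
    ring_nf
    simp
    ring
  have hne : ((β ^ 2 + (2 * Real.pi * ξ) ^ 2 : ℝ) : ℂ) ≠ 0 := by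
    exact_mod_cast (by positivity : β ^ 2 + (2 * Real.pi * ξ) ^ 2 ≠ 0)
  have e1 : Complex.exp (b * (0 : ℝ)) / b + -Complex.exp (a * (0 : ℝ)) / a = (a - b) / (a * b) := by
    simp only [Complex.ofReal_zero, mul_zero, Complex.exp_zero]
    field_simp
    ring
  rw [e1, hab, poissonKernel, Complex.ofReal_div, ha, hb, div_neg, ← neg_div]
  congr 1
  push_cast; ring

theorem integrable_exp_neg_abs {β : ℝ} (hβ : 0 < β) :
    Integrable (fun v : ℝ ↦ (Real.exp (-(|v| * β)) : ℂ)) volume := by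
  obtain ⟨h1, h2, -⟩ := integrableOn_exp_neg_abs hβ 0
  have := integrableOn_union.2 ⟨h1, h2⟩
  rw [Iic_union_Ioi, integrableOn_univ] at this
  simpa using this

theorem fourier_exp_neg_abs {β : ℝ} (hβ : 0 < β) (ξ : ℝ) :
    𝓕 (fun v : ℝ ↦ (Real.exp (-(|v| * β)) : ℂ)) ξ = poissonKernel ξ β := by
  rw [Real.fourier_eq', ← (integrableOn_exp_neg_abs hβ ξ).2.2]
  refine integral_congr_ae (.of_forall fun v ↦ ?_)
  simp only [smul_eq_mul]
  congr 4
  simp [mul_comm]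

namespace IsLaplaceDensity

variable {s : ℝ} {ν ν' : ℝ → ℂ}

/-- Tested against a Schwartz function, both sides can be integrated first in the space or frequency
variable; what remains for each β > 0 is the transform of e^{-β|x|}. -/
theorem isFourierPair (h : IsLaplaceDensity s ν) :
    IsFourierPair (laplaceEven ν) (poissonTransform ν) := by
  refine IsFourierPair.of_integral (memLp_laplaceEven h.measurable h.eq_zero h.memLp)
    h.memLp_poissonTransform fun φ ↦ ?_
  have e1 := integral_kernel_swap (a := ⇑(𝓕 φ : 𝓢(ℝ, ℂ))) (ν := ν) (K := fun x β ↦ Real.exp (-(|x| * β)))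
    (𝓕 φ : 𝓢(ℝ, ℂ)).continuous.measurable ((𝓕 φ : 𝓢(ℝ, ℂ)).memLp 2 volume) h.measurable (by fun_prop)
    h.lintegral_exp_lt_top
  have e2 := integral_kernel_swap (a := φ) (ν := ν) (K := poissonKernel)
    φ.continuous.measurable (φ.memLp 2 volume) h.measurable measurable_poissonKernel
    h.lintegral_poissonKernel_lt_top
  simp only [laplaceEven, poissonTransform]
  rw [e1, e2]
  refine integral_congr_ae (.of_forall fun β ↦ ?_)
  simp only
  rcases le_or_gt β 0 with hβ | hβ
  · simp [h.eq_zero β hβ]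
  · congr 1
    rw [SchwartzMap.fourier_coe, IsFourierPair.integral_fourier_mul_flip φ.integrable
      (integrable_exp_neg_abs hβ)]
    simp only [fourier_exp_neg_abs hβ]

theorem poissonTransform_sub (h : IsLaplaceDensity s ν) (h' : IsLaplaceDensity s ν') :
    poissonTransform (ν - ν') =ᵐ[volume] poissonTransform ν - poissonTransform ν' :=
  ae_kernel_integral_sub h.measurable h'.measurable measurable_poissonKernel
    h.lintegral_poissonKernel_lt_top h'.lintegral_poissonKernel_lt_top

end IsLaplaceDensity

/-! ### Bessel potentials of Laplace integrals -/

open Classical in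
/-- The Bessel potential of order `s` of `laplaceEven ν`. -/
def besselLaplace (s : ℝ) (ν : ℝ → ℂ) : ℝ → ℂ :=
  if h : MemLp (fun ξ ↦ bracket s ξ * poissonTransform ν ξ) 2 volume then
    (𝓕⁻ (h.toLp _) : Lp ℂ 2 (volume : Measure ℝ)) else 0

namespace IsLaplaceDensity

variable {s : ℝ} {ν ν' : ℝ → ℂ}

theorem isFourierPair_besselLaplace (h : IsLaplaceDensity s ν) :
    IsFourierPair (besselLaplace s ν) (fun ξ ↦ bracket s ξ * poissonTransform ν ξ) := by
  rw [besselLaplace, dif_pos h.memLp_bracket_poissonTransform]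
  exact .of_memLp_right _

theorem eLpNorm_besselLaplace_le (h : IsLaplaceDensity s ν) :
    eLpNorm (besselLaplace s ν) 2 volume ≤
      schurConst * eLpNorm (fun β ↦ bracket s (β / (2 * Real.pi)) * ν β) 2 volume := by
  rw [h.isFourierPair_besselLaplace.eLpNorm_eq]
  exact h.eLpNorm_bracket_poissonTransform_le

theorem eLpNorm_besselLaplace_sub_le (h : IsLaplaceDensity s ν) (h' : IsLaplaceDensity s ν') :
    eLpNorm (besselLaplace s ν - besselLaplace s ν') 2 volume ≤
      schurConst * eLpNorm (fun β ↦ bracket s (β / (2 * Real.pi)) * (ν - ν') β) 2 volume := by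
  refine le_of_eq_of_le (eLpNorm_congr_ae ?_) (h.sub h').eLpNorm_besselLaplace_le
  refine (h.isFourierPair_besselLaplace.sub h'.isFourierPair_besselLaplace).ae_eq_left
    ((h.sub h').isFourierPair_besselLaplace.congr .rfl ?_)
  filter_upwards [h.poissonTransform_sub h'] with ξ hξ
  simp only [hξ, Pi.sub_apply]
  ring

theorem besselLaplace_zero (h : IsLaplaceDensity s ν) :
    besselLaplace 0 ν =ᵐ[volume] laplaceEven ν := by
  refine h.zero.isFourierPair_besselLaplace.ae_eq_left (h.isFourierPair.congr .rfl ?_)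
  exact .of_forall fun ξ ↦ by simp [bracket]

end IsLaplaceDensity

/-! ### The `L⁴L^∞` bound of the Laplace integrals -/

/-- This is Jensen's inequality for the measure with density k, obtained from two applications of
Cauchy–Schwarz. -/
theorem lintegral_mul_pow_four_le {α : Type*} {m : MeasurableSpace α} (μ : Measure α)
    {k B : α → ℝ≥0∞} (hk : Measurable k) (hB : Measurable B) :
    (∫⁻ x, k x * B x ∂μ) ^ 4 ≤ (∫⁻ x, k x ∂μ) ^ 3 * ∫⁻ x, k x * B x ^ 4 ∂μ := by
  have key : ∀ B : α → ℝ≥0∞, Measurable B →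
      (∫⁻ x, k x * B x ∂μ) ^ 2 ≤ (∫⁻ x, k x ∂μ) * ∫⁻ x, k x * B x ^ 2 ∂μ := fun B hB ↦ by
    have hk2 : ∀ x, k x ^ (1 / 2 : ℝ) * k x ^ (1 / 2 : ℝ) = k x := fun x ↦ by
      rw [← ENNReal.rpow_add_of_nonneg _ _ (by norm_num) (by norm_num)]; norm_num
    have h1 := lintegral_mul_sq_le μ (f := fun x ↦ k x ^ (1 / 2 : ℝ))
      (g := fun x ↦ k x ^ (1 / 2 : ℝ) * B x) (by fun_prop) (by fun_prop)
    simpa only [mul_pow, ← mul_assoc, hk2, sq (k _ ^ (1 / 2 : ℝ))] using h1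
  calc (∫⁻ x, k x * B x ∂μ) ^ 4 = ((∫⁻ x, k x * B x ∂μ) ^ 2) ^ 2 := by rw [← pow_mul]
    _ ≤ ((∫⁻ x, k x ∂μ) * ∫⁻ x, k x * B x ^ 2 ∂μ) ^ 2 := pow_le_pow_left₀ zero_le (key B hB) 2
    _ = (∫⁻ x, k x ∂μ) ^ 2 * (∫⁻ x, k x * B x ^ 2 ∂μ) ^ 2 := mul_pow _ _ 2
    _ ≤ (∫⁻ x, k x ∂μ) ^ 2 * ((∫⁻ x, k x ∂μ) * ∫⁻ x, k x * (B x ^ 2) ^ 2 ∂μ) := by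
        gcongr
        exact key _ (hB.pow_const 2)
    _ = _ := by simp only [← pow_mul]; ring

/-- The weight `(1 + η²)^{s/2} / (π (1 + η²))`. -/
def cauchyWeight (s η : ℝ) : ℝ := bracket s η / (Real.pi * (1 + η ^ 2))

theorem cauchyWeight_nonneg (s η : ℝ) : 0 ≤ cauchyWeight s η := by
  have := bracket_pos s η
  unfold cauchyWeight
  positivity

theorem continuous_cauchyWeight (s : ℝ) : Continuous (cauchyWeight s) := by
  unfold cauchyWeight
  exact (continuous_bracket s).div (by fun_prop) fun η ↦ by positivity

/-- The weight decays like |η|^(s-2), which is integrable exactly when s < 1; this is why the order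
s = 1 takes a separate route through the derivative. -/
theorem integrable_cauchyWeight {s : ℝ} (hs : s < 1) : Integrable (cauchyWeight s) volume := by
  have h1 := (integrable_rpow_neg_one_add_norm_sq (E := ℝ) (μ := volume) (r := 2 - s)
    (by simp; linarith)).const_mul Real.pi⁻¹
  refine h1.congr (.of_forall fun η ↦ ?_)
  have h2 : (0 : ℝ) < 1 + η ^ 2 := by positivity
  simp only [cauchyWeight, bracket, Real.norm_eq_abs, sq_abs]
  rw [show -(2 - s) / 2 = s / 2 - 1 by ring, Real.rpow_sub h2, Real.rpow_one]
  field_simp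

theorem bracket_mul_le {s : ℝ} (hs : 0 ≤ s) (x y : ℝ) :
    bracket s (x * y) ≤ bracket s x * bracket s y := by
  unfold bracket
  rw [← Real.mul_rpow (by positivity) (by positivity)]
  refine Real.rpow_le_rpow (by positivity) ?_ (by linarith)
  nlinarith [sq_nonneg x, sq_nonneg y]

/-- With ξ = βη/(2π), the Jacobian β/(2π) times the Poisson kernel is the Cauchy density
1/(π(1+η²)), independent of β. The quotient of brackets is kept with ν, where submultiplicativity
bounds it uniformly in η. -/
theorem bracket_mul_poissonKernel {β : ℝ} (hβ : 0 < β) (s η : ℝ) :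
    β / (2 * Real.pi) * (bracket s (β / (2 * Real.pi) * η) *
      poissonKernel (β / (2 * Real.pi) * η) β) =
      cauchyWeight s η * (bracket s (β / (2 * Real.pi) * η) / bracket s η) := by
  have := (bracket_pos s η).ne'
  have h1 : 2 * Real.pi * (β / (2 * Real.pi) * η) = β * η := by field_simp
  rw [poissonKernel, cauchyWeight, h1]
  field_simp

/-- The frequency density at the dilation parameter `η` in the Cauchy representation of the Laplace
integral. -/
def dilatedDensity (s : ℝ) (ν : ℝ → ℂ) (η β : ℝ) : ℂ :=
  (bracket s (β / (2 * Real.pi) * η) / bracket s η : ℝ) * ν β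

theorem norm_dilatedDensity_le {s : ℝ} (hs : 0 ≤ s) (ν : ℝ → ℂ) (η β : ℝ) :
    ‖dilatedDensity s ν η β‖ ≤ ‖(bracket s (β / (2 * Real.pi)) : ℂ) * ν β‖ := by
  have h1 := bracket_pos s η
  have h2 := bracket_pos s (β / (2 * Real.pi) * η)
  rw [dilatedDensity, norm_mul, norm_mul, Complex.norm_real, Complex.norm_real,
    Real.norm_of_nonneg (by positivity), Real.norm_of_nonneg (bracket_pos _ _).le]
  gcongr
  rw [div_le_iff₀ h1]
  exact bracket_mul_le hs _ _

theorem measurable_dilatedDensity (s : ℝ) {ν : ℝ → ℂ} (hν : Measurable ν) :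
    Measurable fun p : ℝ × ℝ ↦ dilatedDensity s ν p.1 p.2 := by
  have := continuous_bracket s
  unfold dilatedDensity
  fun_prop

namespace IsLaplaceDensity

variable {s : ℝ} {ν : ℝ → ℂ}

theorem integrable_cauchyWeight_mul (h : IsLaplaceDensity s ν) (hs : s < 1)
    (hi : Integrable (fun β ↦ bracket s (β / (2 * Real.pi)) * ν β) volume) :
    Integrable (fun p : ℝ × ℝ ↦ (cauchyWeight s p.2 : ℂ) * dilatedDensity s ν p.2 p.1)
      (volume.prod volume) := by
  have hm := measurable_dilatedDensity s h.measurable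
  refine (hi.mul_prod ((integrable_cauchyWeight hs).ofReal (𝕜 := ℂ))).mono
    (Measurable.aestronglyMeasurable ?_) (.of_forall fun p ↦ ?_)
  · have h1 : Measurable fun p : ℝ × ℝ ↦ dilatedDensity s ν p.2 p.1 :=
      hm.comp (f := fun p : ℝ × ℝ ↦ (p.2, p.1)) (by fun_prop)
    have := (continuous_cauchyWeight s).measurable
    fun_prop
  · rw [norm_mul, norm_mul, mul_comm]
    refine mul_le_mul_of_nonneg_right ?_ (norm_nonneg _)
    exact norm_dilatedDensity_le h.nonneg ν _ _

theorem integral_bracket_poissonKernel {β : ℝ} (hβ : 0 < β) (s x : ℝ) :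
    ∫ ξ : ℝ, Complex.exp (((2 * Real.pi * (ξ * x) : ℝ) : ℂ) * Complex.I) *
      ((bracket s ξ * poissonKernel ξ β : ℝ) : ℂ) =
    ∫ η : ℝ, Complex.exp (Complex.I * (β * η * x : ℝ)) *
      ((cauchyWeight s η * (bracket s (β / (2 * Real.pi) * η) / bracket s η) : ℝ) : ℂ) := by
  have hc : 0 < β / (2 * Real.pi) := by positivity
  have h1 := Measure.integral_comp_mul_left (fun ξ : ℝ ↦
    Complex.exp (((2 * Real.pi * (ξ * x) : ℝ) : ℂ) * Complex.I) *
      ((bracket s ξ * poissonKernel ξ β : ℝ) : ℂ)) (β / (2 * Real.pi))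
  rw [abs_of_pos (inv_pos.2 hc), Complex.real_smul] at h1
  have h2 : ∀ y : ℂ, y = ((β / (2 * Real.pi) : ℝ) : ℂ) * ((((β / (2 * Real.pi))⁻¹ : ℝ) : ℂ) * y) :=
    fun y ↦ by rw [← mul_assoc, ← Complex.ofReal_mul, mul_inv_cancel₀ hc.ne']; simp
  rw [h2 (∫ ξ : ℝ, _), ← h1, ← integral_const_mul]
  refine integral_congr_ae (.of_forall fun η ↦ ?_)
  simp only
  rw [← bracket_mul_poissonKernel hβ, mul_left_comm, ← Complex.ofReal_mul]
  congr 2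
  rw [mul_comm]
  congr 2
  field_simp

theorem integrable_bracket_poissonKernel (h : IsLaplaceDensity s ν) (hs : s < 1)
    (hi : Integrable (fun β ↦ bracket s (β / (2 * Real.pi)) * ν β) volume) :
    Integrable (fun p : ℝ × ℝ ↦ ((bracket s p.1 * poissonKernel p.1 p.2 : ℝ) : ℂ) * ν p.2)
      (volume.prod volume) := by
  have hbm := (continuous_bracket s).measurable
  have hpm := measurable_poissonKernel
  have hνm := h.measurable
  have hm : Measurable fun p : ℝ × ℝ ↦
      ((bracket s p.1 * poissonKernel p.1 p.2 : ℝ) : ℂ) * ν p.2 := by fun_prop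
  refine ⟨hm.aestronglyMeasurable, ?_⟩
  rw [HasFiniteIntegral, lintegral_prod_symm _ hm.enorm.aemeasurable]
  have hW : ∫⁻ η, ENNReal.ofReal (cauchyWeight s η) < ⊤ :=
    (integrable_cauchyWeight hs).lintegral_lt_top
  refine lt_of_le_of_lt (b := ∫⁻ β, ‖(bracket s (β / (2 * Real.pi)) : ℂ) * ν β‖ₑ *
    ∫⁻ η, ENNReal.ofReal (cauchyWeight s η)) (lintegral_mono fun β ↦ ?_) ?_
  · rcases le_or_gt β 0 with hβ | hβ
    · simp [h.eq_zero β hβ]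
    have hc : 0 < β / (2 * Real.pi) := by positivity
    have h1 := lintegral_comp_const_mul
      (fun ξ ↦ ‖((bracket s ξ * poissonKernel ξ β : ℝ) : ℂ) * ν β‖ₑ) hc.ne'
    rw [abs_of_pos (inv_pos.2 hc)] at h1
    calc ∫⁻ ξ, ‖((bracket s ξ * poissonKernel ξ β : ℝ) : ℂ) * ν β‖ₑ
        = ENNReal.ofReal (β / (2 * Real.pi)) * ∫⁻ η,
            ‖((bracket s (β / (2 * Real.pi) * η) *
              poissonKernel (β / (2 * Real.pi) * η) β : ℝ) : ℂ) * ν β‖ₑ := by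
          rw [h1, ← mul_assoc, ← ENNReal.ofReal_mul hc.le, mul_inv_cancel₀ hc.ne']
          simp
      _ = ∫⁻ η, ENNReal.ofReal (cauchyWeight s η) * ‖dilatedDensity s ν η β‖ₑ := by
          rw [← lintegral_const_mul' _ _ (by finiteness)]
          refine lintegral_congr fun η ↦ ?_
          rw [← Real.enorm_of_nonneg hc.le, ← Real.enorm_of_nonneg (cauchyWeight_nonneg s η),
            dilatedDensity, enorm_mul, enorm_mul, ← mul_assoc, ← mul_assoc,
            ← ofReal_norm (Complex.ofReal _), ← ofReal_norm (Complex.ofReal _), Complex.norm_real,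
            Complex.norm_real, ofReal_norm, ofReal_norm, ← enorm_mul, ← enorm_mul,
            bracket_mul_poissonKernel hβ]
      _ ≤ ∫⁻ η, ENNReal.ofReal (cauchyWeight s η) *
            ‖(bracket s (β / (2 * Real.pi)) : ℂ) * ν β‖ₑ := by
          refine lintegral_mono fun η ↦ mul_le_mul_right ?_ _
          exact enorm_le_iff_norm_le.2 (norm_dilatedDensity_le h.nonneg ν η β)
      _ = _ := by
          rw [lintegral_mul_const' _ _ (by finiteness), mul_comm]
  · rw [lintegral_mul_const' _ _ hW.ne]
    exact ENNReal.mul_lt_top hi.2 hW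

/-- Fourier inversion is followed by Fubini and, for each β, by the substitution ξ = βη/(2π). The
outcome is an average over η of Fourier integrals in β evaluated at ηx, the form in which the free
Strichartz estimate can be used. -/
theorem besselLaplace_ae_eq (h : IsLaplaceDensity s ν) (hs : s < 1)
    (hi : Integrable (fun β ↦ bracket s (β / (2 * Real.pi)) * ν β) volume) :
    besselLaplace s ν =ᵐ[volume] fun x ↦ ∫ η, (cauchyWeight s η : ℂ) *
      ∫ β, Complex.exp (Complex.I * (β * η * x : ℝ)) * dilatedDensity s ν η β := by
  have hI := h.integrable_bracket_poissonKernel hs hi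
  have hB : (fun ξ ↦ bracket s ξ * poissonTransform ν ξ) = fun ξ ↦
      ∫ β, ((bracket s ξ * poissonKernel ξ β : ℝ) : ℂ) * ν β := by
    funext ξ
    rw [poissonTransform, ← integral_const_mul]
    simp [mul_assoc]
  have hB1 : Integrable (fun ξ ↦ bracket s ξ * poissonTransform ν ξ) volume := by
    rw [hB]; exact hI.integral_prod_left
  refine (h.isFourierPair_besselLaplace.ae_eq_left
    (.of_integrable_right hB1 h.memLp_bracket_poissonTransform)).trans (.of_forall fun x ↦ ?_)
  simp only
  rw [Real.fourierInv_eq']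
  simp only [fun ξ ↦ congrFun hB ξ]
  have hphase : ∀ {μ : Measure (ℝ × ℝ)} {F : ℝ × ℝ → ℂ} {θ : ℝ × ℝ → ℝ}, Continuous θ →
      Integrable F μ → Integrable (fun p ↦ Complex.exp (Complex.I * (θ p : ℂ)) * F p) μ :=
    fun {μ F θ} hθ hF ↦ (hF.norm).mono'
      ((Continuous.aestronglyMeasurable (by fun_prop)).mul hF.1) (.of_forall fun p ↦ by
        rw [norm_mul, mul_comm Complex.I, Complex.norm_exp_ofReal_mul_I, one_mul])
  have hI1 := hphase (θ := fun p ↦ 2 * Real.pi * (p.1 * x)) (by fun_prop) hI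
  have hI2 := hphase (θ := fun p ↦ p.1 * p.2 * x) (by fun_prop)
    (h.integrable_cauchyWeight_mul hs hi)
  calc _ = ∫ ξ, ∫ β, Complex.exp (Complex.I * (2 * Real.pi * (ξ * x) : ℝ)) *
          (((bracket s ξ * poissonKernel ξ β : ℝ) : ℂ) * ν β) := by
        refine integral_congr_ae (.of_forall fun ξ ↦ ?_)
        simp only [smul_eq_mul]
        rw [← integral_const_mul]
        congr 3
        funext β
        rw [mul_comm Complex.I]
        congr 4
        simp [mul_comm]
    _ = ∫ β, ∫ ξ, Complex.exp (Complex.I * (2 * Real.pi * (ξ * x) : ℝ)) *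
          (((bracket s ξ * poissonKernel ξ β : ℝ) : ℂ) * ν β) := integral_integral_swap hI1
    _ = ∫ β, ∫ η, Complex.exp (Complex.I * (β * η * x : ℝ)) *
          ((cauchyWeight s η : ℂ) * dilatedDensity s ν η β) := by
        refine integral_congr_ae (.of_forall fun β ↦ ?_)
        simp only
        rcases le_or_gt β 0 with hβ | hβ
        · simp [dilatedDensity, h.eq_zero β hβ]
        · simp only [← mul_assoc, dilatedDensity]
          rw [integral_mul_const, integral_mul_const]
          congr 1
          have := integral_bracket_poissonKernel hβ s x
          simp only [mul_comm _ Complex.I, Complex.ofReal_mul (cauchyWeight s _),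
            ← mul_assoc] at this
          exact this
    _ = ∫ η, ∫ β, Complex.exp (Complex.I * (β * η * x : ℝ)) *
          ((cauchyWeight s η : ℂ) * dilatedDensity s ν η β) := integral_integral_swap hI2
    _ = _ := by
        refine integral_congr_ae (.of_forall fun η ↦ ?_)
        simp only
        rw [← integral_const_mul]
        refine integral_congr_ae (.of_forall fun β ↦ ?_)
        simp only
        ring

end IsLaplaceDensity

/-- The constant of the Strichartz estimates for the Laplace integrals. -/
def laplaceConst (s : ℝ) : ℝ≥0∞ :=
  schurConst + (∫⁻ η, ENNReal.ofReal (cauchyWeight s η)) * strichartzConst ^ (1 / 4 : ℝ)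

theorem laplaceConst_ne_top {s : ℝ} (hs : s < 1) : laplaceConst s ≠ ⊤ :=
  ENNReal.add_ne_top.2 ⟨schurConst_ne_top, ENNReal.mul_ne_top
    (integrable_cauchyWeight hs).lintegral_lt_top.ne
    (ENNReal.rpow_ne_top_of_nonneg (by norm_num) strichartzConst_ne_top)⟩

namespace IsLaplaceDensity

variable {s : ℝ} {ν : ℝ → ℂ}

theorem dilatedDensity_freePhase_mul (s : ℝ) (ν : ℝ → ℂ) (t x η β : ℝ) :
    Complex.exp (Complex.I * (β * η * x : ℝ)) * dilatedDensity s (fun β ↦ freePhase (-t) β * ν β) η β =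
      schrodingerPhase (-t) (η * x) β * dilatedDensity s ν η β := by
  simp only [dilatedDensity, freePhase, schrodingerPhase]
  rw [mul_left_comm (_ : ℂ) (Complex.exp _) (ν β), ← mul_assoc, ← Complex.exp_add]
  congr 2
  push_cast
  ring

/-- For each η the inner integral is a free evolution at time -t and position ηx. The supremum over
all positions removes the dilation. -/
theorem enorm_besselLaplace_le (h : IsLaplaceDensity s ν) (hs : s < 1)
    (hi : Integrable (fun β ↦ bracket s (β / (2 * Real.pi)) * ν β) volume) (t : ℝ) :
    eLpNorm (besselLaplace s fun β ↦ freePhase (-t) β * ν β) ⊤ volume ≤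
      ∫⁻ η, ENNReal.ofReal (cauchyWeight s η) * evolutionSup (dilatedDensity s ν η) (-t) := by
  have hi' : Integrable (fun β ↦ bracket s (β / (2 * Real.pi)) * (freePhase (-t) β * ν β)) volume := by
    have := memLp_one_iff_integrable.1 (memLp_freePhase_mul (memLp_one_iff_integrable.2 hi) (-t))
    refine this.congr (.of_forall fun β ↦ ?_)
    simp only
    ring
  rw [eLpNorm_congr_ae ((h.freePhase_mul (-t)).besselLaplace_ae_eq hs hi'), eLpNorm_exponent_top]
  refine eLpNormEssSup_le_of_ae_enorm_bound (.of_forall fun x ↦ ?_)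
  refine (enorm_integral_le_lintegral_enorm _).trans (lintegral_mono fun η ↦ ?_)
  rw [enorm_mul, ← ofReal_norm (Complex.ofReal _), Complex.norm_real,
    Real.norm_of_nonneg (cauchyWeight_nonneg s η)]
  refine mul_le_mul_right ?_ _
  simp only [dilatedDensity_freePhase_mul]
  refine enorm_schrodingerEvolution_le_evolutionSup ?_ (-t) (η * x)
  exact hi.mono ((measurable_dilatedDensity s h.measurable).comp
    (f := fun β : ℝ ↦ (η, β)) (by fun_prop)).aestronglyMeasurable
    (.of_forall fun β ↦ norm_dilatedDensity_le h.nonneg ν η β)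

theorem measurable_evolutionSup_dilatedDensity (s : ℝ) (hν : Measurable ν) :
    Measurable fun p : ℝ × ℝ ↦ evolutionSup (dilatedDensity s ν p.1) (-p.2) := by
  refine Measurable.iSup fun i ↦ Measurable.enorm ?_
  have h1 : Measurable fun p : (ℝ × ℝ) × ℝ ↦ schrodingerPhase (-p.1.2)
      (TopologicalSpace.denseSeq ℝ i) p.2 * dilatedDensity s ν p.1.1 p.2 := by
    refine Measurable.mul (measurable_schrodingerPhase_comp (by fun_prop) (by fun_prop)
      (by fun_prop)) ?_
    exact (measurable_dilatedDensity s hν).comp (f := fun p : (ℝ × ℝ) × ℝ ↦ (p.1.1, p.2))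
      (by fun_prop)
  exact h1.stronglyMeasurable.integral_prod_right'.measurable

/-- Jensen moves the fourth power inside the average over η, Tonelli brings the time integral
innermost, and the free estimate holds for each η with a bound independent of η. Time reversal does
not change the integral. -/
theorem eLpNorm_four_besselLaplace_le (h : IsLaplaceDensity s ν) (hs : s < 1)
    (hi : Integrable (fun β ↦ bracket s (β / (2 * Real.pi)) * ν β) volume) {n : ℝ} (hn : 0 < n)
    (hsupp : ∀ ξ, n < |ξ| → ν ξ = 0) :
    eLpNorm (fun t ↦ eLpNorm (besselLaplace s fun β ↦ freePhase (-t) β * ν β) ⊤ volume) 4 volume ≤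
      (∫⁻ η, ENNReal.ofReal (cauchyWeight s η)) * strichartzConst ^ (1 / 4 : ℝ) *
        eLpNorm (fun β ↦ bracket s (β / (2 * Real.pi)) * ν β) 2 volume := by
  set A := ∫⁻ η, ENNReal.ofReal (cauchyWeight s η) with hA
  have hkm : Measurable fun η ↦ ENNReal.ofReal (cauchyWeight s η) :=
    (continuous_cauchyWeight s).measurable.ennreal_ofReal
  have hEm := measurable_evolutionSup_dilatedDensity s h.measurable
  have hEm1 : ∀ t, Measurable fun η ↦ evolutionSup (dilatedDensity s ν η) (-t) := fun t ↦
    hEm.comp (f := fun η : ℝ ↦ (η, t)) (by fun_prop)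
  refine (ENNReal.pow_right_strictMono (n := 4) (by norm_num)).le_iff_le.1 ?_
  rw [eLpNorm_four_pow]
  calc ∫⁻ t, eLpNorm (besselLaplace s fun β ↦ freePhase (-t) β * ν β) ⊤ volume ^ 4
      ≤ ∫⁻ t, A ^ 3 * ∫⁻ η, ENNReal.ofReal (cauchyWeight s η) *
          evolutionSup (dilatedDensity s ν η) (-t) ^ 4 :=
        lintegral_mono fun t ↦ (pow_le_pow_left₀ zero_le (h.enorm_besselLaplace_le hs hi t) 4).trans
          (lintegral_mul_pow_four_le volume hkm (hEm1 t))
    _ = A ^ 3 * ∫⁻ η, ∫⁻ t, ENNReal.ofReal (cauchyWeight s η) *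
          evolutionSup (dilatedDensity s ν η) (-t) ^ 4 := by
        have hm : Measurable fun p : ℝ × ℝ ↦ ENNReal.ofReal (cauchyWeight s p.1) *
            evolutionSup (dilatedDensity s ν p.1) (-p.2) ^ 4 :=
          (hkm.comp measurable_fst).mul (hEm.pow_const 4)
        rw [lintegral_const_mul _ (Measurable.lintegral_prod_left' hm),
          lintegral_lintegral_swap (f := fun η t ↦ ENNReal.ofReal (cauchyWeight s η) *
            evolutionSup (dilatedDensity s ν η) (-t) ^ 4) hm.aemeasurable]
    _ ≤ A ^ 3 * ∫⁻ η, ENNReal.ofReal (cauchyWeight s η) * (strichartzConst ^ (1 / 4 : ℝ) *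
          eLpNorm (fun β ↦ bracket s (β / (2 * Real.pi)) * ν β) 2 volume) ^ 4 := by
        refine mul_le_mul_right (lintegral_mono fun η ↦ ?_) _
        rw [lintegral_const_mul' _ _ (by finiteness)]
        refine mul_le_mul_right ?_ _
        have hdm : Measurable (dilatedDensity s ν η) :=
          (measurable_dilatedDensity s h.measurable).comp (f := fun β : ℝ ↦ (η, β)) (by fun_prop)
        have hle := fun β ↦ norm_dilatedDensity_le h.nonneg ν η β
        rw [lintegral_neg_eq_self (fun t ↦ evolutionSup (dilatedDensity s ν η) t ^ 4),
          ← eLpNorm_four_pow]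
        refine pow_le_pow_left₀ zero_le ((eLpNorm_four_evolutionSup_le hdm
          (hi.mono hdm.aestronglyMeasurable (.of_forall hle)) hn fun ξ hξ ↦ ?_).trans ?_) 4
        · simp [dilatedDensity, hsupp ξ hξ]
        · exact mul_le_mul_right (eLpNorm_mono hle) _
    _ = _ := by
        rw [lintegral_mul_const' _ _ ?_, ← hA]
        · ring
        · exact ENNReal.pow_ne_top (ENNReal.mul_ne_top (ENNReal.rpow_ne_top_of_nonneg (by norm_num)
            strichartzConst_ne_top) h.memLp_weight.2.ne)

theorem tendsto_besselLaplace (h : IsLaplaceDensity s ν) (t₀ : ℝ) :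
    Tendsto (fun t ↦ eLpNorm ((besselLaplace s fun β ↦ freePhase (-t) β * ν β) -
      besselLaplace s fun β ↦ freePhase (-t₀) β * ν β) 2 volume) (𝓝 t₀) (𝓝 0) := by
  have h1 := ENNReal.Tendsto.const_mul (a := schurConst)
    ((tendsto_eLpNorm_freePhase_sub_mul h.memLp_weight (-t₀)).comp
      (tendsto_id (x := 𝓝 t₀)).neg) (.inr schurConst_ne_top)
  rw [mul_zero] at h1
  refine tendsto_of_tendsto_of_tendsto_of_le_of_le tendsto_const_nhds h1 (fun _ ↦ zero_le)
    fun t ↦ ?_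
  refine ((h.freePhase_mul (-t)).eLpNorm_besselLaplace_sub_le (h.freePhase_mul (-t₀))).trans
    (le_of_eq ?_)
  simp only [Function.comp_def, Pi.sub_apply, id]
  congr 2
  funext β
  ring

/-- Frequency truncation makes the weighted density integrable, so the Cauchy representation holds;
the L² continuity of the Bessel potential of the Laplace integral in its density removes the
truncation. -/
theorem strichartzBound_besselLaplace (h : IsLaplaceDensity s ν) (hs : s < 1) :
    StrichartzBound (fun t ↦ besselLaplace s fun β ↦ freePhase (-t) β * ν β)
      (laplaceConst s * eLpNorm (fun β ↦ bracket s (β / (2 * Real.pi)) * ν β) 2 volume) := by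
  have haesm : ∀ {μ : ℝ → ℂ}, IsLaplaceDensity s μ → ∀ t, AEStronglyMeasurable
      (besselLaplace s fun β ↦ freePhase (-t) β * μ β) volume := fun {μ} hμ t ↦
    (hμ.freePhase_mul (-t)).isFourierPair_besselLaplace.memLp_left.1
  refine ⟨haesm h, h.tendsto_besselLaplace, fun t ↦ ?_, ?_⟩
  · refine (h.freePhase_mul (-t)).eLpNorm_besselLaplace_le.trans ?_
    simp only [mul_left_comm _ (freePhase _ _) _, eLpNorm_freePhase_mul]
    exact mul_le_mul_left le_self_add _
  · set S : ℕ → Set ℝ := fun n ↦ Icc (-(n : ℝ)) n with hS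
    have hS' : ∀ n, MeasurableSet (S n) := fun n ↦ measurableSet_Icc
    have hind : ∀ n, (fun β ↦ (bracket s (β / (2 * Real.pi)) : ℂ) * (S n).indicator ν β) =
        (S n).indicator fun β ↦ (bracket s (β / (2 * Real.pi)) : ℂ) * ν β := fun n ↦ by
      funext β
      by_cases hb : β ∈ S n <;> simp [hb]
    refine eLpNorm_four_le_of_tendsto
      (f := fun n t ↦ besselLaplace s fun β ↦ freePhase (-t) β * (S n).indicator ν β)
      (fun n t ↦ haesm (h.indicator (hS' n)) t) (haesm h)
      (fun n ↦ measurable_eLpNorm_of_continuous (haesm (h.indicator (hS' n)))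
        (h.indicator (hS' n)).tendsto_besselLaplace ⊤)
      (fun t ↦ ?_) fun n ↦ ?_
    · have h1 := ENNReal.Tendsto.const_mul (a := schurConst)
        (tendsto_eLpNorm_indicator_sub h.memLp_weight (S := S) hS'
          (.of_forall fun β ↦ ?_)) (.inr schurConst_ne_top)
      · rw [mul_zero] at h1
        refine tendsto_of_tendsto_of_tendsto_of_le_of_le tendsto_const_nhds h1 (fun _ ↦ zero_le)
          fun n ↦ ?_
        refine (((h.indicator (hS' n)).freePhase_mul (-t)).eLpNorm_besselLaplace_sub_le
          (h.freePhase_mul (-t))).trans (le_of_eq ?_)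
        rw [← hind]
        refine Eq.trans ?_ (congrArg _ (eLpNorm_freePhase_mul _ 2 (-t)))
        congr 2
        funext β
        simp only [Pi.sub_apply]
        ring
      · obtain ⟨N, hN⟩ := exists_nat_ge |β|
        filter_upwards [eventually_ge_atTop N] with n hn
        exact abs_le.1 (hN.trans (by exact_mod_cast hn))
    · refine ((h.indicator (hS' n)).eLpNorm_four_besselLaplace_le hs ?_ (n := n + 1)
        (by positivity) fun ξ hξ ↦ indicator_of_notMem (fun h ↦ ?_) _).trans ?_
      · rw [hind]
        exact integrable_indicator_Icc h.memLp_weight _ _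
      · have := abs_le.2 h
        linarith
      · rw [hind]
        exact mul_le_mul' le_add_self (eLpNorm_indicator_le _)

theorem strichartzBound_laplaceEven (h : IsLaplaceDensity 0 ν) :
    StrichartzBound (fun t ↦ laplaceEven fun β ↦ freePhase (-t) β * ν β)
      (laplaceConst 0 * eLpNorm ν 2 volume) := by
  have h1 := (h.strichartzBound_besselLaplace zero_lt_one).congr fun t ↦
    (h.freePhase_mul (-t)).besselLaplace_zero
  simpa [bracket] using h1

end IsLaplaceDensity

/-! ### The Sobolev bounds of the Laplace integrals -/

/-- The factor `-1` on `(0, ∞)` and `1` on `(-∞, 0]`. -/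
def negSign (x : ℝ) : ℂ := if 0 < x then -1 else 1

theorem norm_negSign (x : ℝ) : ‖negSign x‖ = 1 := by
  unfold negSign; split_ifs <;> simp

theorem measurable_negSign : Measurable negSign :=
  Measurable.ite measurableSet_Ioi measurable_const measurable_const

/-- Integration by parts on each half line; the boundary terms at 0 cancel because e^{-β|x|} is
continuous there. -/
theorem integral_deriv_mul_exp_neg_abs {φ : ℝ → ℂ} (hφ : ContDiff ℝ ∞ φ) (hc : HasCompactSupport φ)
    (β : ℝ) : ∫ x, deriv φ x * (Real.exp (-(|x| * β)) : ℂ) =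
      -(β * ∫ x, negSign x * φ x * (Real.exp (-(|x| * β)) : ℂ)) := by
  have hd : Continuous (deriv φ) := hφ.continuous_deriv (by simp)
  have ibp : ∀ b : ℝ, ∀ x, deriv (fun x : ℝ ↦ φ x * Complex.exp (b * x)) x =
      deriv φ x * Complex.exp (b * x) + b * (φ x * Complex.exp (b * x)) := fun b x ↦ by
    have h1 : HasDerivAt (fun x : ℝ ↦ Complex.exp (b * x)) (Complex.exp (b * x) * b) x := by
      have h2 : HasDerivAt (fun x : ℝ ↦ (b * x : ℂ)) b x := by
        simpa using (Complex.ofRealCLM.hasDerivAt (x := x)).const_mul (b : ℂ)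
      exact h2.cexp
    have h2 := ((hφ.differentiable (by simp)) x).hasDerivAt.mul h1
    exact h2.deriv.trans (by ring)
  have hcd : ∀ b : ℝ, ContDiff ℝ 1 (fun x : ℝ ↦ φ x * Complex.exp (b * x)) := fun b ↦ by
    have h1 : ContDiff ℝ 1 φ := hφ.of_le (by exact_mod_cast le_top)
    have h2 : ContDiff ℝ 1 (fun x : ℝ ↦ (x : ℂ)) := Complex.ofRealCLM.contDiff
    fun_prop
  have hcc : ∀ b : ℝ, HasCompactSupport (fun x : ℝ ↦ φ x * Complex.exp (b * x)) := fun b ↦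
    hc.mul_right
  have i1 : ∀ b : ℝ, Integrable (fun x : ℝ ↦ deriv φ x * Complex.exp (b * x)) volume := fun b ↦
    (by fun_prop : Continuous fun x : ℝ ↦ deriv φ x * Complex.exp (b * x)).integrable_of_hasCompactSupport
      hc.deriv.mul_right
  have i2 : ∀ b : ℝ, Integrable (fun x : ℝ ↦ φ x * Complex.exp (b * x)) volume := fun b ↦
    (hcd b).continuous.integrable_of_hasCompactSupport (hcc b)
  have hexp : Continuous fun x : ℝ ↦ (Real.exp (-(|x| * β)) : ℂ) :=
    Complex.continuous_ofReal.comp (by fun_prop)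
  have j1 : Integrable (fun x ↦ deriv φ x * (Real.exp (-(|x| * β)) : ℂ)) volume :=
    (hd.mul hexp).integrable_of_hasCompactSupport hc.deriv.mul_right
  have j2 : Integrable (fun x ↦ φ x * (Real.exp (-(|x| * β)) : ℂ)) volume :=
    (hφ.continuous.mul hexp).integrable_of_hasCompactSupport hc.mul_right
  have j3 : Integrable (fun x ↦ negSign x * φ x * (Real.exp (-(|x| * β)) : ℂ)) volume :=
    j2.mono ((measurable_negSign.aestronglyMeasurable.mul hφ.continuous.aestronglyMeasurable).mul
      hexp.aestronglyMeasurable) (.of_forall fun x ↦ by simp [norm_negSign])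
  have ep : ∀ x ∈ Ioi (0 : ℝ), (Real.exp (-(|x| * β)) : ℂ) = Complex.exp ((-β : ℝ) * x) :=
    fun x hx ↦ by
      rw [abs_of_pos hx, Complex.ofReal_exp]
      congr 1
      push_cast; ring
  have en : ∀ x ∈ Iic (0 : ℝ), (Real.exp (-(|x| * β)) : ℂ) = Complex.exp (β * x) :=
    fun x hx ↦ by
      rw [abs_of_nonpos hx, Complex.ofReal_exp]
      congr 1
      push_cast; ring
  have hp := (hcc (-β)).integral_Ioi_deriv_eq (hcd (-β)) 0
  have hn := (hcc β).integral_Iic_deriv_eq (hcd β) 0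
  simp only [ibp] at hp hn
  rw [integral_add (i1 _).integrableOn ((i2 _).const_mul _).integrableOn, integral_const_mul] at hp hn
  have k1 : ∫ x in Ioi (0 : ℝ), deriv φ x * (Real.exp (-(|x| * β)) : ℂ) =
      ∫ x in Ioi (0 : ℝ), deriv φ x * Complex.exp ((-β : ℝ) * x) :=
    setIntegral_congr_fun measurableSet_Ioi fun x hx ↦ by simp only [ep x hx]
  have k2 : ∫ x in Iic (0 : ℝ), deriv φ x * (Real.exp (-(|x| * β)) : ℂ) =
      ∫ x in Iic (0 : ℝ), deriv φ x * Complex.exp (β * x) :=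
    setIntegral_congr_fun measurableSet_Iic fun x hx ↦ by simp only [en x hx]
  have k3 : ∫ x in Ioi (0 : ℝ), negSign x * φ x * (Real.exp (-(|x| * β)) : ℂ) =
      -∫ x in Ioi (0 : ℝ), φ x * Complex.exp ((-β : ℝ) * x) := by
    rw [← integral_neg]
    refine setIntegral_congr_fun measurableSet_Ioi fun x hx ↦ ?_
    simp only [ep x hx, negSign, if_pos (show 0 < x from hx)]
    ring
  have k4 : ∫ x in Iic (0 : ℝ), negSign x * φ x * (Real.exp (-(|x| * β)) : ℂ) =
      ∫ x in Iic (0 : ℝ), φ x * Complex.exp (β * x) := by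
    refine setIntegral_congr_fun measurableSet_Iic fun x hx ↦ ?_
    simp only [en x hx, negSign, if_neg (not_lt.2 (show x ≤ 0 from hx))]
    ring
  rw [← intervalIntegral.integral_Iic_add_Ioi (b := 0) j1.integrableOn j1.integrableOn,
    ← intervalIntegral.integral_Iic_add_Ioi (b := 0) j3.integrableOn j3.integrableOn, k1, k2, k3, k4]
  push_cast at hp hn ⊢
  simp only [mul_zero, Complex.exp_zero, mul_one] at hp hn
  linear_combination hp + hn

namespace IsLaplaceDensity

variable {s : ℝ} {ν : ℝ → ℂ}

theorem norm_mul_le (ν : ℝ → ℂ) (β : ℝ) :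
    ‖(β : ℂ) * ν β‖ ≤ 2 * Real.pi * ‖(bracket 1 (β / (2 * Real.pi)) : ℂ) * ν β‖ := by
  rw [norm_mul, norm_mul, Complex.norm_real, Complex.norm_real,
    Real.norm_of_nonneg (bracket_pos _ _).le, Real.norm_eq_abs, ← mul_assoc]
  exact mul_le_mul_of_nonneg_right (le_bracket_one β) (norm_nonneg _)

theorem id_mul (h : IsLaplaceDensity 1 ν) : IsLaplaceDensity 0 (fun β ↦ β * ν β) := by
  have hm : Measurable fun β : ℝ ↦ (β : ℂ) * ν β := by
    have := h.measurable
    fun_prop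
  refine ⟨le_rfl, zero_le_one, hm, fun β hβ ↦ by simp [h.eq_zero β hβ], ?_⟩
  simpa [bracket] using h.memLp_weight.of_le_mul hm.aestronglyMeasurable
    (.of_forall (norm_mul_le ν))

theorem eLpNorm_id_mul_le (ν : ℝ → ℂ) : eLpNorm (fun β : ℝ ↦ (β : ℂ) * ν β) 2 volume ≤
    ENNReal.ofReal (2 * Real.pi) *
      eLpNorm (fun β ↦ bracket 1 (β / (2 * Real.pi)) * ν β) 2 volume :=
  eLpNorm_le_mul_eLpNorm_of_ae_le_mul (.of_forall (norm_mul_le ν)) 2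

/-- Fubini reduces the identity to the weak derivative of a single exponential e^{-β|x|}, which is β
e^{-β|x|} up to sign. -/
theorem isWeakDeriv_laplaceEven (h : IsLaplaceDensity 1 ν) :
    IsWeakDeriv (laplaceEven ν) (fun x ↦ negSign x * laplaceEven (fun β ↦ β * ν β) x) := by
  intro φ hφ hc
  have hd : Continuous (deriv φ) := hφ.continuous_deriv (by simp)
  have hnm : Measurable fun x ↦ negSign x * φ x := measurable_negSign.mul hφ.continuous.measurable
  have hn2 : MemLp (fun x ↦ negSign x * φ x) 2 volume :=
    (memLp_congr_norm hφ.continuous.aestronglyMeasurable hnm.aestronglyMeasurable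
      (.of_forall fun x ↦ by simp [norm_negSign])).1
      (hφ.continuous.memLp_of_hasCompactSupport hc)
  have e1 := integral_kernel_swap (a := deriv φ) (ν := ν) (K := fun x β ↦ Real.exp (-(|x| * β)))
    hd.measurable (hd.memLp_of_hasCompactSupport hc.deriv) h.measurable (by fun_prop)
    h.lintegral_exp_lt_top
  have e2 := integral_kernel_swap (a := fun x ↦ negSign x * φ x) (ν := fun β : ℝ ↦ (β : ℂ) * ν β)
    (K := fun x β ↦ Real.exp (-(|x| * β)))
    hnm hn2 h.id_mul.measurable (by fun_prop) h.id_mul.lintegral_exp_lt_top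
  calc ∫ x, laplaceEven ν x * deriv φ x = ∫ x, deriv φ x * laplaceEven ν x := by
        simp only [mul_comm]
    _ = ∫ β, ν β * ∫ x, deriv φ x * (Real.exp (-(|x| * β)) : ℂ) := e1
    _ = -∫ β : ℝ, (β : ℂ) * ν β * ∫ x, negSign x * φ x * (Real.exp (-(|x| * β)) : ℂ) := by
        rw [← integral_neg]
        refine integral_congr_ae (.of_forall fun β ↦ ?_)
        simp only [integral_deriv_mul_exp_neg_abs hφ hc β]
        ring
    _ = -∫ x, negSign x * φ x * laplaceEven (fun β ↦ β * ν β) x := by rw [← e2]; rfl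
    _ = _ := by
        congr 2
        funext x
        ring

end IsLaplaceDensity

theorem exists_sobolevStrichartz_laplaceEven {s : ℝ} :
    ∃ C : ℝ≥0∞, C ≠ ⊤ ∧ ∀ ν : ℝ → ℂ, IsLaplaceDensity s ν →
      SobolevStrichartz s (fun t ↦ laplaceEven fun β ↦ freePhase (-t) β * ν β)
        (C * eLpNorm (fun β ↦ bracket s (β / (2 * Real.pi)) * ν β) 2 volume) := by
  -- At s = 1 the Cauchy weight is not integrable, so its constant is left out there; the derivative
  -- bound, with constant 2π `laplaceConst 0`, takes its place.
  set D : ℝ≥0∞ := if s < 1 then laplaceConst s else 0 with hD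
  have hD' : D ≠ ⊤ := by
    rw [hD]; split_ifs with hs
    exacts [laplaceConst_ne_top hs, ENNReal.zero_ne_top]
  have h0 := laplaceConst_ne_top zero_lt_one
  have h1 : (1 : ℝ≥0∞) ≤ 1 + ENNReal.ofReal (2 * Real.pi) := le_self_add
  refine ⟨(1 + ENNReal.ofReal (2 * Real.pi)) * laplaceConst 0 + schurConst + D,
    ENNReal.add_ne_top.2 ⟨ENNReal.add_ne_top.2 ⟨by finiteness, schurConst_ne_top⟩, hD'⟩,
    fun ν h ↦ ?_⟩
  refine ⟨(h.zero.strichartzBound_laplaceEven).mono ?_, ⟨_, fun t ↦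
    ⟨(h.freePhase_mul (-t)).isFourierPair,
      (h.freePhase_mul (-t)).memLp_bracket_poissonTransform, ?_⟩⟩, fun hs ↦ ⟨_, _,
    (h.strichartzBound_besselLaplace hs).mono ?_, fun t ↦ ⟨(h.freePhase_mul (-t)).isFourierPair,
      (h.freePhase_mul (-t)).isFourierPair_besselLaplace⟩⟩, fun hs ↦ ?_⟩
  · refine mul_le_mul' ?_ (eLpNorm_le_eLpNorm_bracket_div_mul h.nonneg ν 2)
    exact (le_mul_of_one_le_left zero_le h1).trans (le_self_add.trans le_self_add)
  · refine (h.freePhase_mul (-t)).eLpNorm_bracket_poissonTransform_le.trans ?_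
    simp only [mul_left_comm _ (freePhase _ _) _, eLpNorm_freePhase_mul]
    exact mul_le_mul_left (le_add_self.trans le_self_add) _
  · rw [hD, if_pos hs]
    exact mul_le_mul_left le_add_self _
  · subst hs
    have hcomm : ∀ t, (fun β : ℝ ↦ (β : ℂ) * (freePhase (-t) β * ν β)) =
        fun β ↦ freePhase (-t) β * (β * ν β) := fun t ↦ by funext β; ring
    have hm : ∀ t, Measurable (laplaceEven fun β : ℝ ↦ freePhase (-t) β * (β * ν β)) := fun t ↦
      measurable_laplaceEven (h.id_mul.freePhase_mul (-t)).measurable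
    -- The sign has modulus one and does not depend on t, so the order-zero bound for the density βν
    -- passes to the derivative unchanged.
    refine ⟨fun t x ↦ negSign x * laplaceEven (fun β ↦ freePhase (-t) β * (β * ν β)) x,
      (h.id_mul.strichartzBound_laplaceEven.of_norm_eq
        (fun t ↦ (measurable_negSign.mul (hm t)).aestronglyMeasurable)
        (fun t ↦ .of_forall fun x ↦ by
          rw [Pi.mul_apply, norm_mul, norm_negSign, one_mul])
        fun t t₀ ↦ .of_forall fun x ↦ by
          rw [Pi.mul_apply, Pi.mul_apply, ← mul_sub, norm_mul, norm_negSign, one_mul]).mono ?_, fun t ↦ ⟨?_, ?_⟩⟩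
    · calc _ ≤ laplaceConst 0 * (ENNReal.ofReal (2 * Real.pi) *
            eLpNorm (fun β ↦ bracket 1 (β / (2 * Real.pi)) * ν β) 2 volume) :=
            mul_le_mul_right (IsLaplaceDensity.eLpNorm_id_mul_le ν) _
        _ = ENNReal.ofReal (2 * Real.pi) * laplaceConst 0 *
            eLpNorm (fun β ↦ bracket 1 (β / (2 * Real.pi)) * ν β) 2 volume := by ring
        _ ≤ _ := by
            refine mul_le_mul_left ?_ _
            exact (mul_le_mul_left le_add_self _).trans (le_self_add.trans le_self_add)
    · have h2 := memLp_laplaceEven (h.id_mul.freePhase_mul (-t)).measurable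
        (h.id_mul.freePhase_mul (-t)).eq_zero (h.id_mul.freePhase_mul (-t)).memLp
      exact (memLp_congr_norm h2.1 (measurable_negSign.mul (hm t)).aestronglyMeasurable
        (.of_forall fun x ↦ by
          rw [Pi.mul_apply, norm_mul, norm_negSign, one_mul])).1 h2
    · have := (h.freePhase_mul (-t)).isWeakDeriv_laplaceEven
      rwa [hcomm] at this

/-! ### The densities of the boundary integral operator -/

theorem measurable_planchIntegral (G : ℝ → ℂ) : Measurable (planchIntegral G) := by
  unfold planchIntegral
  by_cases hG : MemLp G 2 volume
  · simp only [dif_pos hG]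
    exact (Lp.stronglyMeasurable _).measurable.comp (by fun_prop)
  · simp only [dif_neg hG]
    exact measurable_const

theorem measurable_laplaceBdry (h : ℝ → ℂ) : Measurable (laplaceBdry h) :=
  (measurable_planchIntegral _).comp measurable_neg

theorem measurable_nuOne (h : ℝ → ℂ) : Measurable (nuOne h) := by
  have := measurable_laplaceBdry h
  exact Measurable.ite measurableSet_Ici (by fun_prop) measurable_const

theorem measurable_nuTwo (h : ℝ → ℂ) : Measurable (nuTwo h) := by
  have := measurable_laplaceBdry h
  exact Measurable.ite measurableSet_Ici (by fun_prop) measurable_const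

theorem IsFourierPair.flip {f g : ℝ → ℂ} (h : IsFourierPair f g) :
    IsFourierPair (fun x ↦ g (-x)) f := by
  refine IsFourierPair.of_integral
    (h.memLp_right.comp_measurePreserving (Measure.measurePreserving_neg volume)) h.memLp_left
    fun φ ↦ ?_
  rw [← h.integral_fourierInv_mul, ← integral_neg_eq_self]
  simp [SchwartzMap.fourier_coe, SchwartzMap.fourierInv_coe, Real.fourierInv_eq_fourier_neg]

/-- The integral with e^{-iτt} is a forward transform, whereas `laplaceBdry` computes it as an
inverse transform at -τ; flipping the Fourier pair reconciles the two. -/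
theorem laplaceBdry_ae_eq {h h' : ℝ → ℂ} (hp : IsFourierPair ((Ioi 0).indicator h) h') :
    laplaceBdry h =ᵐ[volume] fun τ ↦ h' (τ / (2 * Real.pi)) := by
  have h1 := (isFourierPair_planchIntegral hp.memLp_left).ae_eq_left
    (hp.flip.comp_div Real.two_pi_pos)
  have h2 := (Measure.measurePreserving_neg (volume : Measure ℝ)).quasiMeasurePreserving.ae_eq_comp h1
  refine h2.trans (.of_forall fun τ ↦ ?_)
  simp [neg_div]

theorem eLpNorm_bracket_laplaceBdry {σ : ℝ} {h h' : ℝ → ℂ}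
    (hp : IsFourierPair ((Ioi 0).indicator h) h') :
    eLpNorm (fun τ ↦ bracket σ (τ / (2 * Real.pi)) * laplaceBdry h τ) 2 volume ^ 2 =
      ENNReal.ofReal (2 * Real.pi) * eLpNorm (fun ξ ↦ bracket σ ξ * h' ξ) 2 volume ^ 2 := by
  have h1 := eLpNorm_two_comp_const_mul_sq (fun ξ ↦ bracket σ ξ * h' ξ)
    (inv_pos.2 Real.two_pi_pos)
  rw [inv_inv] at h1
  rw [← h1]
  congr 1
  refine eLpNorm_congr_ae ?_
  filter_upwards [laplaceBdry_ae_eq hp] with τ hτ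
  rw [hτ, div_eq_inv_mul]

theorem setLIntegral_Ioi_comp_sq (F : ℝ → ℝ≥0∞) :
    ∫⁻ β in Ioi (0 : ℝ), ENNReal.ofReal (2 * β) * F (β ^ 2) = ∫⁻ τ in Ioi (0 : ℝ), F τ := by
  have himg : (fun β : ℝ ↦ β ^ 2) '' Ioi 0 = Ioi 0 := by
    ext τ
    constructor
    · rintro ⟨β, hβ, rfl⟩
      exact pow_pos (show (0 : ℝ) < β from hβ) 2
    · intro hτ
      exact ⟨√τ, Real.sqrt_pos.2 hτ, Real.sq_sqrt (le_of_lt hτ)⟩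
  have h1 := lintegral_image_eq_lintegral_abs_deriv_mul (s := Ioi (0 : ℝ)) (f := fun β ↦ β ^ 2)
    (f' := fun β ↦ 2 * β) measurableSet_Ioi
    (fun β _ ↦ by simpa using (hasDerivAt_pow 2 β).hasDerivWithinAt)
    (fun a ha b hb hab ↦ (pow_left_inj₀ (le_of_lt ha) (le_of_lt hb) two_ne_zero).1 hab) F
  rw [himg] at h1
  rw [h1]
  refine setLIntegral_congr_fun measurableSet_Ioi fun β hβ ↦ ?_
  have : (0 : ℝ) < β := hβ
  simp only [abs_of_pos (by positivity : 0 < 2 * β)]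

/-- The density `π⁻¹ β ℓ(β²)` on `[0, ∞)`. -/
def squareDensity (ℓ : ℝ → ℂ) (β : ℝ) : ℂ :=
  if 0 ≤ β then (1 / Real.pi : ℂ) * β * ℓ (β ^ 2) else 0

theorem nuTwo_eq (h : ℝ → ℂ) : nuTwo h = squareDensity (laplaceBdry h) := rfl

theorem nuOne_eq (h : ℝ → ℂ) : nuOne h = squareDensity fun τ ↦ laplaceBdry h (-τ) := rfl

theorem squareDensity_of_nonpos (ℓ : ℝ → ℂ) {β : ℝ} (hβ : β ≤ 0) : squareDensity ℓ β = 0 := by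
  rcases hβ.lt_or_eq with h | rfl
  · simp [squareDensity, not_le.2 h]
  · simp [squareDensity]

/-- Both sides grow like y^(s+1/2) = (y²)^((2s+1)/4). This match of exponents, with y of size β², is
the origin of the Sobolev order of the boundary data. -/
theorem weight_le {s y : ℝ} (h0 : 0 ≤ s) (h1 : s ≤ 1) (hy : 0 ≤ y) :
    (1 + y) ^ s * √y ≤ 2 * (1 + y ^ 2) ^ ((2 * s + 1) / 4) := by
  have hy1 : 0 < 1 + y := by linarith
  calc (1 + y) ^ s * √y ≤ (1 + y) ^ s * (1 + y) ^ (1 / 2 : ℝ) := by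
        gcongr
        rw [Real.sqrt_eq_rpow]
        exact Real.rpow_le_rpow hy (by linarith) (by norm_num)
    _ = ((1 + y) ^ 2) ^ ((2 * s + 1) / 4) := by
        rw [← Real.rpow_add hy1, ← Real.rpow_natCast, ← Real.rpow_mul hy1.le]
        congr 1; push_cast; ring
    _ ≤ (2 * (1 + y ^ 2)) ^ ((2 * s + 1) / 4) := by
        refine Real.rpow_le_rpow (by positivity) ?_ (by linarith)
        nlinarith [sq_nonneg (1 - y)]
    _ = 2 ^ ((2 * s + 1) / 4) * (1 + y ^ 2) ^ ((2 * s + 1) / 4) :=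
        Real.mul_rpow (by norm_num) (by positivity)
    _ ≤ _ := by
        gcongr
        calc (2 : ℝ) ^ ((2 * s + 1) / 4) ≤ 2 ^ (1 : ℝ) :=
              Real.rpow_le_rpow_of_exponent_le (by norm_num) (by linarith)
          _ = 2 := Real.rpow_one 2

/-- Under τ = β² the Jacobian 2β uses one of the two factors β of the squared density; the remaining
one, proportional to √y for y = β²/(2π), is absorbed by the weight of order (2s+1)/4. -/
theorem eLpNorm_squareDensity_le {s : ℝ} (h0 : 0 ≤ s) (h1 : s ≤ 1) (ℓ : ℝ → ℂ) :
    eLpNorm (fun β ↦ bracket s (β / (2 * Real.pi)) * squareDensity ℓ β) 2 volume ≤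
      eLpNorm (fun τ ↦ bracket ((2 * s + 1) / 4) (τ / (2 * Real.pi)) * ℓ τ) 2 volume := by
  refine (ENNReal.pow_right_strictMono (n := 2) (by norm_num)).le_iff_le.1 ?_
  rw [eLpNorm_two_sq, eLpNorm_two_sq]
  simp only [enorm_bracket_mul_sq]
  rw [lintegral_eq_setLIntegral_Ioi fun β hβ ↦ by simp [squareDensity_of_nonpos ℓ hβ]]
  calc _ ≤ ∫⁻ β in Ioi (0 : ℝ), ENNReal.ofReal (2 * β) * (ENNReal.ofReal
          ((1 + (β ^ 2 / (2 * Real.pi)) ^ 2) ^ ((2 * s + 1) / 4)) * ‖ℓ (β ^ 2)‖ₑ ^ 2) := by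
        refine setLIntegral_mono' measurableSet_Ioi fun β hβ ↦ ?_
        have hβ : 0 < β := hβ
        have hpi := Real.pi_gt_three
        rw [squareDensity, if_pos hβ.le, enorm_mul, mul_pow, ← mul_assoc, ← mul_assoc]
        refine mul_le_mul_left ?_ _
        have e1 : (1 / Real.pi : ℂ) * β = ((β / Real.pi : ℝ) : ℂ) := by push_cast; ring
        rw [e1, ← ofReal_norm (Complex.ofReal _), Complex.norm_real, ofReal_norm,
          Real.enorm_of_nonneg (by positivity), ← ENNReal.ofReal_pow (by positivity),
          ← ENNReal.ofReal_mul (by positivity), ← ENNReal.ofReal_mul (by positivity)]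
        refine ENNReal.ofReal_le_ofReal ?_
        set y := β ^ 2 / (2 * Real.pi) with hy
        have hy0 : 0 ≤ y := by positivity
        have hβy : β = √(2 * Real.pi) * √y := by
          rw [← Real.sqrt_mul (by positivity), hy, mul_div_cancel₀ _ (by positivity),
            Real.sqrt_sq hβ.le]
        have hle : (1 + (β / (2 * Real.pi)) ^ 2) ^ s ≤ (1 + y) ^ s := by
          refine Real.rpow_le_rpow (by positivity) ?_ h0
          rw [div_pow, hy]
          gcongr
          nlinarith
        have hsq : √(2 * Real.pi) ≤ Real.pi := by
          rw [Real.sqrt_le_left (by positivity)]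
          nlinarith
        calc (1 + (β / (2 * Real.pi)) ^ 2) ^ s * (β / Real.pi) ^ 2
            ≤ (1 + y) ^ s * (β / Real.pi) ^ 2 := by gcongr
          _ = β / Real.pi ^ 2 * √(2 * Real.pi) * ((1 + y) ^ s * √y) := by
              rw [div_pow, sq β]
              nth_rw 2 [hβy]
              ring
          _ ≤ β / Real.pi ^ 2 * Real.pi * (2 * (1 + y ^ 2) ^ ((2 * s + 1) / 4)) := by
              exact mul_le_mul (by gcongr) (weight_le h0 h1 hy0) (by positivity) (by positivity)
          _ = 2 * β * (1 + y ^ 2) ^ ((2 * s + 1) / 4) * (1 / Real.pi) := by field_simp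
          _ ≤ 2 * β * (1 + y ^ 2) ^ ((2 * s + 1) / 4) * 1 := by
              gcongr
              rw [div_le_one Real.pi_pos]
              linarith
          _ = _ := mul_one _
    _ = _ := setLIntegral_Ioi_comp_sq fun τ ↦ ENNReal.ofReal
          ((1 + (τ / (2 * Real.pi)) ^ 2) ^ ((2 * s + 1) / 4)) * ‖ℓ τ‖ₑ ^ 2
    _ ≤ _ := setLIntegral_le_lintegral _ _

theorem eLpNorm_nuTwo_le {s : ℝ} (h0 : 0 ≤ s) (h1 : s ≤ 1) (h : ℝ → ℂ) :
    eLpNorm (fun β ↦ bracket s (β / (2 * Real.pi)) * nuTwo h β) 2 volume ≤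
      eLpNorm (fun τ ↦ bracket ((2 * s + 1) / 4) (τ / (2 * Real.pi)) * laplaceBdry h τ) 2 volume := by
  rw [nuTwo_eq]
  exact eLpNorm_squareDensity_le h0 h1 _

theorem eLpNorm_nuOne_le {s : ℝ} (h0 : 0 ≤ s) (h1 : s ≤ 1) (h : ℝ → ℂ) :
    eLpNorm (fun β ↦ bracket s (β / (2 * Real.pi)) * nuOne h β) 2 volume ≤
      eLpNorm (fun τ ↦ bracket ((2 * s + 1) / 4) (τ / (2 * Real.pi)) * laplaceBdry h τ) 2 volume := by
  have hm : AEStronglyMeasurable (fun τ ↦ (bracket ((2 * s + 1) / 4) (τ / (2 * Real.pi)) : ℂ) *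
      laplaceBdry h τ) volume :=
    ((continuous_bracket_div _).measurable.mul (measurable_laplaceBdry h)).aestronglyMeasurable
  rw [nuOne_eq]
  refine (eLpNorm_squareDensity_le h0 h1 _).trans (le_of_eq ?_)
  rw [← eLpNorm_comp_measurePreserving hm (Measure.measurePreserving_neg volume)]
  congr 1
  funext τ
  simp [bracket, neg_div]

/-! ### Temporal traces -/

theorem integral_mul_squareDensity (k ℓ : ℝ → ℂ) :
    ∫ β, k (β ^ 2) * squareDensity ℓ β =
      (1 / (2 * Real.pi) : ℂ) * ∫ τ in Ioi (0 : ℝ), k τ * ℓ τ := by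
  rw [← setIntegral_eq_integral_of_forall_compl_eq_zero (s := Ioi (0 : ℝ)) fun β hβ ↦ by
    rw [squareDensity_of_nonpos ℓ (not_lt.1 hβ), mul_zero],
    ← integral_comp_rpow_Ioi (fun τ ↦ k τ * ℓ τ) two_ne_zero, ← integral_const_mul]
  refine setIntegral_congr_fun measurableSet_Ioi fun β hβ ↦ ?_
  have hβ : 0 < β := hβ
  have e : β ^ ((2 : ℝ) - 1) = β := by rw [show (2 : ℝ) - 1 = 1 by norm_num, Real.rpow_one]
  have hpi : (Real.pi : ℂ) ≠ 0 := by exact_mod_cast Real.pi_ne_zero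
  simp only [squareDensity, if_pos hβ.le, Real.rpow_two, e, Complex.real_smul]
  push_cast
  rw [abs_of_pos two_pos]
  push_cast
  field_simp

theorem integrableOn_of_integrable_mul_squareDensity {k ℓ : ℝ → ℂ}
    (h : Integrable (fun β ↦ k (β ^ 2) * squareDensity ℓ β) volume) :
    IntegrableOn (fun τ ↦ k τ * ℓ τ) (Ioi 0) volume := by
  rw [← integrableOn_Ioi_comp_rpow_iff _ two_ne_zero]
  refine (integrableOn_congr_fun (fun β hβ ↦ ?_) measurableSet_Ioi).1
    ((h.integrableOn (s := Ioi 0)).const_mul (2 * Real.pi : ℂ))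
  have hβ : 0 < β := hβ
  have e : β ^ ((2 : ℝ) - 1) = β := by rw [show (2 : ℝ) - 1 = 1 by norm_num, Real.rpow_one]
  have hpi : (Real.pi : ℂ) ≠ 0 := by exact_mod_cast Real.pi_ne_zero
  simp only [squareDensity, if_pos hβ.le, Real.rpow_two, e, Complex.real_smul]
  rw [abs_of_pos two_pos]
  push_cast
  field_simp

/-- The Plancherel integral is only an L² class in x, so its averages are computed by Parseval
against the indicator of the interval. This gives a convergent integral over β. -/
theorem setIntegral_planchIntegral {G : ℝ → ℂ} (hG : MemLp G 2 volume) (a b : ℝ) :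
    Integrable (fun β : ℝ ↦ (∫ y in Ioo a b, Complex.exp (Complex.I * (β * y : ℝ))) * G β) volume ∧
    ∫ y in Ioo a b, planchIntegral G y =
      ∫ β : ℝ, (∫ y in Ioo a b, Complex.exp (Complex.I * (β * y : ℝ))) * G β := by
  have hp := Real.two_pi_pos
  set χ : ℝ → ℂ := (Ioo a b).indicator 1 with hχ
  have hχ1 : Integrable χ volume :=
    (integrable_indicator_iff measurableSet_Ioo).2 (integrableOn_const (by simp))
  have hχ2 : MemLp χ 2 volume := memLp_indicator_const 2 measurableSet_Ioo 1 (Or.inr (by simp))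
  have h1 := IsFourierPair.of_integrable_left hχ1 hχ2
  have hK : ∀ β : ℝ, conj (𝓕 χ ((2 * Real.pi)⁻¹ * β)) =
      ∫ y in Ioo a b, Complex.exp (Complex.I * (β * y : ℝ)) := fun β ↦ by
    rw [Real.fourier_eq', ← integral_conj, ← integral_indicator measurableSet_Ioo]
    refine integral_congr_ae (.of_forall fun y ↦ ?_)
    by_cases hy : y ∈ Ioo a b
    · simp only [hχ, indicator_of_mem hy, Pi.one_apply, smul_eq_mul, mul_one, ← Complex.exp_conj]
      congr 1
      simp
      field_simp
    · simp [hχ, hy]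
  have hK2 : MemLp (fun β : ℝ ↦ ∫ y in Ioo a b, Complex.exp (Complex.I * (β * y : ℝ))) 2 volume := by
    have := (HalfLineNLS.MemLp.comp_const_mul h1.memLp_right (inv_ne_zero hp.ne')).star
    refine (memLp_congr_ae (.of_forall fun β ↦ ?_)).1 this
    exact hK β
  refine ⟨hG.integrable_mul hK2 |>.congr (.of_forall fun β ↦ by simp [mul_comm]), ?_⟩
  have h2 := h1.integral_conj_mul (isFourierPair_planchIntegral hG)
  have e1 : ∫ y in Ioo a b, planchIntegral G y = ∫ y, conj (χ y) * planchIntegral G y := by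
    rw [← integral_indicator measurableSet_Ioo]
    refine integral_congr_ae (.of_forall fun y ↦ ?_)
    by_cases hy : y ∈ Ioo a b <;> simp [hχ, hy]
  rw [e1, h2]
  have h3 := Measure.integral_comp_mul_left
    (fun β : ℝ ↦ conj (𝓕 χ ((2 * Real.pi)⁻¹ * β)) * G β) (2 * Real.pi)
  rw [abs_of_pos (inv_pos.2 hp), Complex.real_smul] at h3
  simp only [hK] at h3
  have h4 : ∀ y : ℂ, ((2 * Real.pi : ℝ) : ℂ) * ((((2 * Real.pi)⁻¹ : ℝ) : ℂ) * y) = y := fun y ↦ by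
    rw [← mul_assoc, ← Complex.ofReal_mul, mul_inv_cancel₀ hp.ne']; simp
  rw [← h4 (∫ β : ℝ, (∫ y in Ioo a b, Complex.exp (Complex.I * (β * y : ℝ))) * G β), ← h3,
    ← integral_const_mul]
  refine integral_congr_ae (.of_forall fun ξ ↦ ?_)
  simp only [← hK]
  rw [inv_mul_cancel_left₀ hp.ne']
  ring

theorem setIntegral_laplaceEven {ν : ℝ → ℂ} (h : IsLaplaceDensity 0 ν) (a b : ℝ) :
    Integrable (fun β : ℝ ↦ (∫ y in Ioo a b, (Real.exp (-(|y| * β)) : ℂ)) * ν β) volume ∧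
    ∫ y in Ioo a b, laplaceEven ν y =
      ∫ β : ℝ, (∫ y in Ioo a b, (Real.exp (-(|y| * β)) : ℂ)) * ν β := by
  set χ : ℝ → ℂ := (Ioo a b).indicator 1 with hχ
  have hχm : Measurable χ := measurable_one.indicator measurableSet_Ioo
  have hχ2 : MemLp χ 2 volume := memLp_indicator_const 2 measurableSet_Ioo 1 (Or.inr (by simp))
  have hK : ∀ F : ℝ → ℂ, ∫ y in Ioo a b, F y = ∫ y, χ y * F y := fun F ↦ by
    rw [← integral_indicator measurableSet_Ioo]
    refine integral_congr_ae (.of_forall fun y ↦ ?_)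
    by_cases hy : y ∈ Ioo a b <;> simp [hχ, hy]
  simp only [hK]
  constructor
  · have := (integrable_kernel_mul hχm hχ2 h.measurable
      (K := fun x β ↦ Real.exp (-(|x| * β))) (by fun_prop) h.lintegral_exp_lt_top).integral_prod_right
    refine this.congr (.of_forall fun β ↦ ?_)
    simp only [← mul_assoc]
    rw [integral_mul_const]
  · have := integral_kernel_swap hχm hχ2 h.measurable
      (K := fun x β ↦ Real.exp (-(|x| * β))) (by fun_prop) h.lintegral_exp_lt_top
    refine this.trans (integral_congr_ae (.of_forall fun β ↦ ?_))
    simp only [mul_comm (ν β)]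

/-- The multiplier in the time frequency `τ` of the boundary integral operator at the point `y`. -/
def traceKernel (τ y : ℝ) : ℂ :=
  if 0 < τ then (Real.exp (-(|y| * √τ)) : ℂ) else Complex.exp (Complex.I * (√(-τ) * y : ℝ))

theorem norm_traceKernel_le (τ y : ℝ) : ‖traceKernel τ y‖ ≤ 1 := by
  unfold traceKernel
  split_ifs
  · rw [Complex.norm_real, Real.norm_of_nonneg (Real.exp_pos _).le, Real.exp_le_one_iff]
    simp only [Left.neg_nonpos_iff]
    positivity
  · rw [mul_comm, Complex.norm_exp_ofReal_mul_I]

theorem continuous_traceKernel (τ : ℝ) : Continuous (traceKernel τ) := by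
  unfold traceKernel
  split_ifs <;> fun_prop

theorem measurable_traceKernel : Measurable fun p : ℝ × ℝ ↦ traceKernel p.1 p.2 := by
  unfold traceKernel
  exact Measurable.ite (measurableSet_lt measurable_const measurable_fst) (by fun_prop)
    (by fun_prop)

theorem freePhase_mul_squareDensity (t : ℝ) (ℓ : ℝ → ℂ) (β : ℝ) :
    freePhase t β * squareDensity ℓ β =
      squareDensity (fun τ ↦ Complex.exp (Complex.I * (-t * τ : ℝ)) * ℓ τ) β := by
  unfold squareDensity freePhase
  split_ifs
  · rw [show -Complex.I * (β : ℂ) ^ 2 * t = Complex.I * (-t * β ^ 2 : ℝ) by push_cast; ring]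
    ring
  · simp

theorem wbTwo_eq (h : ℝ → ℂ) (t : ℝ) :
    wbTwo h t = laplaceEven fun β ↦ freePhase (-t) β * nuTwo h β := by
  funext x
  refine integral_congr_ae (.of_forall fun β ↦ ?_)
  simp only [freePhase, Complex.ofReal_exp, ← mul_assoc, ← Complex.exp_add]
  congr 2
  push_cast
  ring

theorem wbOne_eq (h : ℝ → ℂ) (t : ℝ) :
    wbOne h t = planchIntegral fun β ↦ freePhase t β * nuOne h β := rfl

/-- After τ = β², the oscillating half carries e^{-iτt} and the decaying half e^{iτt}. Reflecting
the former to negative frequencies glues the two into one Fourier integral in time. -/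
theorem setIntegral_wBdr {h : ℝ → ℂ} (h1 : MemLp (nuOne h) 2 volume)
    (h2 : IsLaplaceDensity 0 (nuTwo h)) (t a b : ℝ) :
    Integrable (fun τ : ℝ ↦ Complex.exp (Complex.I * (t * τ : ℝ)) *
      ((∫ y in Ioo a b, traceKernel τ y) * laplaceBdry h τ)) volume ∧
    ∫ y in Ioo a b, wBdr h t y = (1 / (2 * Real.pi) : ℂ) *
      ∫ τ : ℝ, Complex.exp (Complex.I * (t * τ : ℝ)) *
        ((∫ y in Ioo a b, traceKernel τ y) * laplaceBdry h τ) := by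
  set F : ℝ → ℂ := fun τ : ℝ ↦ Complex.exp (Complex.I * (t * τ : ℝ)) *
      ((∫ y in Ioo a b, traceKernel τ y) * laplaceBdry h τ) with hF
  obtain ⟨i1, e1⟩ := setIntegral_planchIntegral (memLp_freePhase_mul h1 t) a b
  obtain ⟨i2, e2⟩ := setIntegral_laplaceEven (h2.freePhase_mul (-t)) a b
  simp only [nuOne_eq, nuTwo_eq, freePhase_mul_squareDensity] at i1 e1 i2 e2
  set k1 : ℝ → ℂ := fun τ ↦ ∫ y in Ioo a b, Complex.exp (Complex.I * (√τ * y : ℝ)) with hk1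
  set k2 : ℝ → ℂ := fun τ ↦ ∫ y in Ioo a b, (Real.exp (-(|y| * √τ)) : ℂ) with hk2
  have c1 : ∀ ℓ : ℝ → ℂ, (fun β : ℝ ↦ (∫ y in Ioo a b, Complex.exp (Complex.I * (β * y : ℝ))) *
      squareDensity ℓ β) = fun β ↦ k1 (β ^ 2) * squareDensity ℓ β := fun ℓ ↦ by
    funext β
    rcases le_or_gt β 0 with hβ | hβ
    · simp [squareDensity_of_nonpos ℓ hβ]
    · simp only [hk1, Real.sqrt_sq hβ.le]
  have c2 : ∀ ℓ : ℝ → ℂ, (fun β : ℝ ↦ (∫ y in Ioo a b, (Real.exp (-(|y| * β)) : ℂ)) *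
      squareDensity ℓ β) = fun β ↦ k2 (β ^ 2) * squareDensity ℓ β := fun ℓ ↦ by
    funext β
    rcases le_or_gt β 0 with hβ | hβ
    · simp [squareDensity_of_nonpos ℓ hβ]
    · simp only [hk2, Real.sqrt_sq hβ.le]
  rw [c1] at i1 e1
  rw [c2] at i2 e2
  rw [integral_mul_squareDensity] at e1 e2
  have j1 := integrableOn_of_integrable_mul_squareDensity i1
  have j2 := integrableOn_of_integrable_mul_squareDensity i2
  have f1 : EqOn (fun τ ↦ k1 τ * (Complex.exp (Complex.I * (-t * τ : ℝ)) * laplaceBdry h (-τ)))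
      (fun τ ↦ F (-τ)) (Ioi 0) := fun τ hτ ↦ by
    have : ¬ 0 < -τ := by simpa using (le_of_lt (show (0 : ℝ) < τ from hτ))
    simp only [hF, traceKernel, if_neg this, neg_neg, hk1]
    rw [show t * -τ = -t * τ by ring]
    ring
  have f2 : EqOn (fun τ ↦ k2 τ * (Complex.exp (Complex.I * (- -t * τ : ℝ)) * laplaceBdry h τ))
      F (Ioi 0) := fun τ hτ ↦ by
    simp only [hF, traceKernel, if_pos (show (0 : ℝ) < τ from hτ), neg_neg, hk2]
    ring
  rw [integrableOn_congr_fun f1 measurableSet_Ioi] at j1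
  rw [integrableOn_congr_fun f2 measurableSet_Ioi] at j2
  rw [setIntegral_congr_fun measurableSet_Ioi f1, integral_comp_neg_Ioi, neg_zero] at e1
  rw [setIntegral_congr_fun measurableSet_Ioi f2] at e2
  have j1' : IntegrableOn F (Iic 0) volume := by
    rw [← neg_zero] at j1
    have := IntegrableOn.comp_neg_Iio (c := 0) (f := fun τ ↦ F (-τ)) j1
    rw [integrableOn_Iic_iff_integrableOn_Iio]
    simpa only [neg_neg] using this
  refine ⟨?_, ?_⟩
  · have := integrableOn_union.2 ⟨j1', j2⟩
    rwa [Iic_union_Ioi, integrableOn_univ] at this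
  · rw [← intervalIntegral.integral_Iic_add_Ioi j1' j2, mul_add, ← e1, ← e2, ← integral_add]
    · refine setIntegral_congr_fun measurableSet_Ioo fun y _ ↦ ?_
      simp only [wBdr, wbOne_eq, wbTwo_eq, nuOne_eq, nuTwo_eq, freePhase_mul_squareDensity]
    · have := (isFourierPair_planchIntegral (memLp_freePhase_mul h1 t)).memLp_left
      simp only [nuOne_eq, freePhase_mul_squareDensity] at this
      exact ((this.locallyIntegrable (by norm_num)).integrableOn_isCompact isCompact_Icc).mono_set
        Ioo_subset_Icc_self
    · have := (h2.freePhase_mul (-t)).isFourierPair.memLp_left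
      simp only [nuTwo_eq, freePhase_mul_squareDensity] at this
      exact ((this.locallyIntegrable (by norm_num)).integrableOn_isCompact isCompact_Icc).mono_set
        Ioo_subset_Icc_self

theorem norm_setAverage_le_one {f : ℝ → ℂ} (hf : Continuous f) (h : ∀ y, ‖f y‖ ≤ 1) (a b : ℝ) :
    ‖⨍ y in Ioo a b, f y‖ ≤ 1 := by
  rcases le_or_gt b a with hab | hab
  · simp [Ioo_eq_empty (not_lt.2 hab)]
  · have := (convex_closedBall (0 : ℂ) 1).set_average_mem (μ := volume) (t := Ioo a b) (f := f)
      Metric.isClosed_closedBall (by simp [hab]) (by simp)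
      (.of_forall fun y ↦ by simpa using h y)
      ((hf.integrableOn_Icc).mono_set Ioo_subset_Icc_self)
    simpa using this

theorem tendsto_setAverage {f : ℝ → ℂ} (hf : Continuous f) (x : ℝ) :
    Tendsto (fun δ : ℝ ↦ ⨍ y in Ioo (x - δ) (x + δ), f y) (𝓝[>] 0) (𝓝 (f x)) := by
  rw [Metric.tendsto_nhds]
  intro ε hε
  obtain ⟨η, hη, hfη⟩ := Metric.continuous_iff.1 hf x (ε / 2) (half_pos hε)
  filter_upwards [Ioo_mem_nhdsGT hη] with δ hδ
  have := (convex_closedBall (f x) (ε / 2)).set_average_mem (μ := volume)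
    (t := Ioo (x - δ) (x + δ)) (f := f) Metric.isClosed_closedBall
    (by simp [hδ.1]) (by simp) ?_ ((hf.integrableOn_Icc).mono_set Ioo_subset_Icc_self)
  · exact (Metric.mem_closedBall.1 this).trans_lt (half_lt_self hε)
  · filter_upwards [ae_restrict_mem measurableSet_Ioo] with y hy
    refine (hfη y ?_).le
    rw [Real.dist_eq, abs_lt]
    constructor <;> linarith [hy.1, hy.2, hδ.2]

theorem measurable_setAverage_traceKernel (a b : ℝ) :
    Measurable fun τ ↦ ⨍ y in Ioo a b, traceKernel τ y := by
  simp only [setAverage_eq]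
  exact (measurable_traceKernel.stronglyMeasurable.integral_prod_right').measurable.const_smul
    ((volume.real (Ioo a b))⁻¹)

theorem memLp_mul_of_norm_le_one {m f : ℝ → ℂ} (hm : Measurable m) (h : ∀ τ, ‖m τ‖ ≤ 1)
    (hf : MemLp f 2 volume) : MemLp (fun τ ↦ m τ * f τ) 2 volume :=
  hf.mono (hm.aestronglyMeasurable.mul hf.1) (.of_forall fun τ ↦ by
    rw [norm_mul]
    exact mul_le_of_le_one_left (norm_nonneg _) (h τ))

theorem setAverage_wBdr_ae_eq {h : ℝ → ℂ} (hℓ : MemLp (laplaceBdry h) 2 volume)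
    (h1 : MemLp (nuOne h) 2 volume) (h2 : IsLaplaceDensity 0 (nuTwo h)) (a b : ℝ) :
    (fun t ↦ ⨍ y in Ioo a b, wBdr h t y) =ᵐ[volume] planchIntegral fun τ ↦
      (1 / (2 * Real.pi) : ℂ) * ((⨍ y in Ioo a b, traceKernel τ y) * laplaceBdry h τ) := by
  have hm2 : MemLp (fun τ ↦ (1 / (2 * Real.pi) : ℂ) *
      ((⨍ y in Ioo a b, traceKernel τ y) * laplaceBdry h τ)) 2 volume :=
    (memLp_mul_of_norm_le_one (measurable_setAverage_traceKernel a b)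
      (fun τ ↦ norm_setAverage_le_one (continuous_traceKernel τ) (norm_traceKernel_le τ) a b)
      hℓ).const_mul _
  have hm1 : Integrable (fun τ ↦ (1 / (2 * Real.pi) : ℂ) *
      ((⨍ y in Ioo a b, traceKernel τ y) * laplaceBdry h τ)) volume := by
    refine (((setIntegral_wBdr h1 h2 0 a b).1.const_mul
      ((volume.real (Ioo a b))⁻¹ : ℂ)).const_mul (1 / (2 * Real.pi) : ℂ)).congr (.of_forall fun τ ↦ ?_)
    simp only [setAverage_eq, zero_mul, Complex.ofReal_zero, mul_zero, Complex.exp_zero, one_mul,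
      Complex.real_smul, Complex.ofReal_inv]
    ring
  refine EventuallyEq.symm ((planchIntegral_ae_eq_integral hm2 hm1).trans (.of_forall fun t ↦ ?_))
  simp only [setAverage_eq, (setIntegral_wBdr h1 h2 t a b).2, Complex.real_smul]
  rw [← integral_const_mul, ← integral_const_mul]
  refine integral_congr_ae (.of_forall fun τ ↦ ?_)
  simp only
  ring

theorem hNormOn_le_besselNorm (σ : ℝ) (Ω : Set ℝ) (g : ℝ → ℂ) :
    hNormOn σ Ω g ≤ besselNorm σ 2 g :=
  iInf₂_le (f := fun (g' : ℝ → ℂ) (_ : g' =ᵐ[volume.restrict Ω] g) ↦ besselNorm σ 2 g') g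
    (EventuallyEq.refl _ _)

/-- The averaged multipliers are bounded by 1 and converge to the multiplier at x by its continuity
in space. Dominated convergence and Plancherel therefore give the L² limit over the whole time line,
hence over (0,T). A multiplier bounded by 1 does not increase the weighted L² norm of the transform.
-/
theorem exists_isTemporalTrace {σ : ℝ} {h h' : ℝ → ℂ}
    (hp : IsFourierPair ((Ioi 0).indicator h) h')
    (hw : MemLp (fun ξ ↦ bracket σ ξ * h' ξ) 2 volume)
    (h1 : MemLp (nuOne h) 2 volume) (h2 : IsLaplaceDensity 0 (nuTwo h)) (T x : ℝ) :
    ∃ g : ℝ → ℂ, IsTemporalTrace T (wBdr h) x g ∧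
      ∀ Ω : Set ℝ, hNormOn σ Ω g ≤ eLpNorm (fun ξ ↦ bracket σ ξ * h' ξ) 2 volume := by
  have hpi := Real.two_pi_pos
  have hℓ : MemLp (laplaceBdry h) 2 volume := by
    refine (memLp_congr_ae (laplaceBdry_ae_eq hp)).2 ?_
    simpa [div_eq_inv_mul] using
      HalfLineNLS.MemLp.comp_const_mul hp.memLp_right (inv_ne_zero hpi.ne')
  have hkm : Measurable fun τ ↦ traceKernel τ x :=
    measurable_traceKernel.comp (f := fun τ : ℝ ↦ (τ, x)) (by fun_prop)
  have hG : MemLp (fun τ ↦ (1 / (2 * Real.pi) : ℂ) * (traceKernel τ x * laplaceBdry h τ)) 2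
      volume :=
    (memLp_mul_of_norm_le_one hkm (fun τ ↦ norm_traceKernel_le τ x) hℓ).const_mul _
  refine ⟨planchIntegral fun τ ↦ (1 / (2 * Real.pi) : ℂ) * (traceKernel τ x * laplaceBdry h τ),
    ?_, fun Ω ↦ ?_⟩
  · set M : ℝ → ℝ → ℂ := fun δ τ ↦ ⨍ y in Ioo (x - δ) (x + δ), traceKernel τ y with hM
    have hM1 : ∀ δ τ, ‖M δ τ‖ ≤ 1 := fun δ τ ↦
      norm_setAverage_le_one (continuous_traceKernel τ) (norm_traceKernel_le τ) _ _
    have hlim := tendsto_eLpNorm_two_mul (l := 𝓝[>] (0 : ℝ))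
      (m := fun δ τ ↦ M δ τ - traceKernel τ x) hℓ (C := 2)
      (fun δ ↦ ((measurable_setAverage_traceKernel _ _).sub hkm).aestronglyMeasurable)
      (fun δ ↦ .of_forall fun τ ↦ ?_) (.of_forall fun τ ↦ ?_)
    · have h3 := ENNReal.Tendsto.const_mul
        (a := ENNReal.ofReal √(2 * Real.pi) * ‖(1 / (2 * Real.pi) : ℂ)‖ₑ) hlim
        (.inr (by finiteness))
      rw [mul_zero] at h3
      refine tendsto_of_tendsto_of_tendsto_of_le_of_le tendsto_const_nhds h3 (fun _ ↦ zero_le)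
        fun δ ↦ ?_
      have hGδ : MemLp (fun τ ↦ (1 / (2 * Real.pi) : ℂ) * (M δ τ * laplaceBdry h τ)) 2 volume :=
        (memLp_mul_of_norm_le_one (measurable_setAverage_traceKernel _ _) (hM1 δ) hℓ).const_mul _
      refine (eLpNorm_mono_measure _ Measure.restrict_le_self).trans (le_of_eq ?_)
      refine (eLpNorm_congr_ae ((setAverage_wBdr_ae_eq hℓ h1 h2 (x - δ) (x + δ)).sub
        (EventuallyEq.refl _ _))).trans ?_
      rw [eLpNorm_planchIntegral_sub hGδ hG, mul_assoc, ← eLpNorm_const_smul]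
      congr 2
      funext τ
      simp only [Pi.sub_apply, Pi.smul_apply, smul_eq_mul]
      ring
    · rw [← ofReal_norm]
      refine ENNReal.ofReal_le_of_le_toReal ((norm_sub_le _ _).trans ?_)
      have := hM1 δ τ
      have := norm_traceKernel_le τ x
      norm_num
      linarith
    · simpa using (tendsto_setAverage (continuous_traceKernel τ) x).sub_const (traceKernel τ x)
  · refine (hNormOn_le_besselNorm σ Ω _).trans ?_
    have hpair : IsFourierPair
        (planchIntegral fun τ ↦ (1 / (2 * Real.pi) : ℂ) * (traceKernel τ x * laplaceBdry h τ))
        (fun ξ ↦ traceKernel (2 * Real.pi * ξ) x * h' ξ) := by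
      refine (isFourierPair_planchIntegral hG).congr .rfl ?_
      have hq : Measure.QuasiMeasurePreserving (fun ξ : ℝ ↦ 2 * Real.pi * ξ) volume volume := by
        refine ⟨by fun_prop, ?_⟩
        rw [Real.map_volume_mul_left hpi.ne']
        exact Measure.smul_absolutelyContinuous
      filter_upwards [hq.ae_eq_comp (laplaceBdry_ae_eq hp)] with ξ hξ
      simp only [Function.comp_apply, mul_div_cancel_left₀ ξ hpi.ne'] at hξ
      rw [hξ]
      have : (Real.pi : ℂ) ≠ 0 := by exact_mod_cast Real.pi_ne_zero
      push_cast
      field_simp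
    have hle : ∀ ξ, ‖(bracket σ ξ : ℂ) * (traceKernel (2 * Real.pi * ξ) x * h' ξ)‖ ≤
        ‖(bracket σ ξ : ℂ) * h' ξ‖ := fun ξ ↦ by
      rw [norm_mul, norm_mul, norm_mul]
      refine mul_le_mul_of_nonneg_left ?_ (norm_nonneg _)
      exact mul_le_of_le_one_left (norm_nonneg _) (norm_traceKernel_le _ _)
    have hmem : MemLp (fun ξ ↦ (bracket σ ξ : ℂ) * (traceKernel (2 * Real.pi * ξ) x * h' ξ)) 2
        volume := hw.mono ((Complex.continuous_ofReal.comp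
          (continuous_bracket σ)).aestronglyMeasurable.mul hpair.memLp_right.1) (.of_forall hle)
    rw [besselNorm_two_eq hpair hmem]
    exact eLpNorm_mono hle

/-! ### Interpolation between the endpoints -/

theorem eLpNorm_interpolate {f : ℝ → ℂ} (hf : AEStronglyMeasurable f volume) {r : ℝ≥0∞}
    (hr : 2 ≤ r) (hr' : r ≠ ⊤) :
    eLpNorm f r volume ≤ (eLpNorm f ⊤ volume ^ (r.toReal - 2) * eLpNorm f 2 volume ^ 2) ^
      (1 / r.toReal) := by
  have hρ : 2 ≤ r.toReal := by
    simpa using (ENNReal.toReal_le_toReal (by norm_num) hr').2 hr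
  have hr0 : r ≠ 0 := fun h ↦ by simp [h] at hr
  rw [eLpNorm_eq_lintegral_rpow_enorm_toReal hr0 hr', eLpNorm_two_sq]
  refine ENNReal.rpow_le_rpow ?_ (by positivity)
  rw [← lintegral_const_mul'' _ (hf.enorm.pow_const 2)]
  refine lintegral_mono_ae ?_
  filter_upwards [enorm_ae_le_eLpNormEssSup f volume] with x hx
  rw [← eLpNorm_exponent_top] at hx
  calc ‖f x‖ₑ ^ r.toReal = ‖f x‖ₑ ^ (r.toReal - 2) * ‖f x‖ₑ ^ 2 := by
        rw [← ENNReal.rpow_natCast, ← ENNReal.rpow_add_of_nonneg _ _ (by linarith) (by norm_num)]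
        congr 1; push_cast; ring
    _ ≤ _ := by gcongr

theorem eLpNorm_lt_top_of_two_of_top {f : ℝ → ℂ} (hf : AEStronglyMeasurable f volume) {r : ℝ≥0∞}
    (hr : 2 ≤ r) (h2 : eLpNorm f 2 volume < ⊤) (htop : eLpNorm f ⊤ volume < ⊤) :
    eLpNorm f r volume < ⊤ := by
  rcases eq_or_ne r ⊤ with rfl | hr'
  · exact htop
  have hρ : 2 ≤ r.toReal := by
    simpa using (ENNReal.toReal_le_toReal (by norm_num) hr').2 hr
  refine (eLpNorm_interpolate hf hr hr').trans_lt (ENNReal.rpow_lt_top_of_nonneg (by positivity) ?_)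
  exact ENNReal.mul_ne_top (ENNReal.rpow_ne_top_of_nonneg (by linarith) htop.ne)
    (ENNReal.pow_ne_top h2.ne)

theorem Admissible.cases {q r : ℝ≥0∞} (h : Admissible q r) :
    (r = 2 ∧ q = ⊤) ∨ (r = ⊤ ∧ q = 4) ∨ (r ≠ ⊤ ∧ q ≠ ⊤ ∧ 0 < q.toReal ∧ 0 < r.toReal ∧
      1 / q.toReal + 1 / (2 * r.toReal) = 1 / 4) := by
  obtain ⟨hq, hr, h⟩ := h
  have hq0 : q ≠ 0 := fun h ↦ by simp [h] at hq
  have hr0 : r ≠ 0 := fun h ↦ by simp [h] at hr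
  rcases eq_or_ne r ⊤ with rfl | hrt
  · refine Or.inr (Or.inl ⟨rfl, ?_⟩)
    simpa [ENNReal.mul_top] using h
  rcases eq_or_ne q ⊤ with rfl | hqt
  · refine Or.inl ⟨?_, rfl⟩
    have h2 := congrArg ENNReal.toReal h
    simp at h2
    have hrt' : r.toReal = 2 := by
      have : r.toReal ≠ 0 := (ENNReal.toReal_ne_zero).2 ⟨hr0, hrt⟩
      field_simp at h2
      linarith
    rw [← ENNReal.ofReal_toReal hrt, hrt']
    simp
  · refine Or.inr (Or.inr ⟨hrt, hqt, ENNReal.toReal_pos hq0 hqt, ENNReal.toReal_pos hr0 hrt, ?_⟩)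
    have h2 := congrArg ENNReal.toReal h
    rw [ENNReal.toReal_add (by simp [hq0]) (by simp [hr0])] at h2
    simpa using h2

/-- Pointwise in time, the L^r norm interpolates between L² and L^∞; admissibility makes the power
of the L^∞ norm exactly 4, so the time integral closes with the L⁴L^∞ bound. -/
theorem StrichartzBound.eLpNorm_le {v : ℝ → ℝ → ℂ} {N : ℝ≥0∞} (hv : StrichartzBound v N)
    {q r : ℝ≥0∞} (hqr : Admissible q r) :
    eLpNorm (fun t ↦ eLpNorm (v t) r volume) q volume ≤ N := by
  rcases hqr.cases with ⟨rfl, rfl⟩ | ⟨rfl, rfl⟩ | ⟨hr, hq, hκ, hρ, h⟩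
  · rw [eLpNorm_exponent_top]
    exact eLpNormEssSup_le_of_ae_enorm_bound (.of_forall fun t ↦ by simpa using hv.two_le t)
  · exact hv.four_le
  set κ := q.toReal
  set ρ := r.toReal
  have hq0 : q ≠ 0 := fun h ↦ by simpa [h] using hqr.1
  rw [eLpNorm_eq_lintegral_rpow_enorm_toReal hq0 hq]
  have hρ2 : 2 ≤ ρ := by
    simpa using (ENNReal.toReal_le_toReal (by norm_num) hr).2 hqr.2.1
  -- This and the next identity restate 1/κ + 1/(2ρ) = 1/4: the first fixes the power of the L^∞
  -- norm, and the second says that the total power of N is κ.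
  have e1 : (ρ - 2) * (1 / ρ * κ) = 4 := by
    field_simp at h
    field_simp
    linarith
  have e2 : 4 + 2 * (1 / ρ * κ) = κ := by
    field_simp at h
    field_simp
    linarith
  have hpt : ∀ t, ‖eLpNorm (v t) r volume‖ₑ ^ κ ≤
      eLpNorm (v t) ⊤ volume ^ 4 * N ^ (2 * (1 / ρ * κ)) := fun t ↦ by
    rw [enorm_eq_self]
    refine (ENNReal.rpow_le_rpow (eLpNorm_interpolate (hv.aesm t) hqr.2.1 hr) hκ.le).trans ?_
    rw [← ENNReal.rpow_mul, ENNReal.mul_rpow_of_nonneg _ _ (by positivity), ← ENNReal.rpow_mul,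
      e1, ← ENNReal.rpow_natCast, ← ENNReal.rpow_natCast, ← ENNReal.rpow_mul]
    push_cast
    gcongr
    exact hv.two_le t
  calc _ ≤ (∫⁻ t, eLpNorm (v t) ⊤ volume ^ 4 * N ^ (2 * (1 / ρ * κ))) ^ (1 / κ) :=
        ENNReal.rpow_le_rpow (lintegral_mono hpt) (by positivity)
    _ ≤ (N ^ 4 * N ^ (2 * (1 / ρ * κ))) ^ (1 / κ) := by
        refine ENNReal.rpow_le_rpow ?_ (by positivity)
        rw [lintegral_mul_const _ ((hv.measurable ⊤).pow_const 4), ← eLpNorm_four_pow]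
        gcongr
        exact hv.four_le
    _ = N := by
        rw [← ENNReal.rpow_natCast, ← ENNReal.rpow_add_of_nonneg _ _ (by norm_num) (by positivity)]
        push_cast
        rw [e2, ← ENNReal.rpow_mul, mul_one_div_cancel hκ.ne', ENNReal.rpow_one]

theorem StrichartzBound.ae_eLpNorm_lt_top {v : ℝ → ℝ → ℂ} {N : ℝ≥0∞} (hv : StrichartzBound v N)
    (hN : N ≠ ⊤) {r : ℝ≥0∞} (hr : 2 ≤ r) : ∀ᵐ t, eLpNorm (v t) r volume < ⊤ := by
  have h1 : ∫⁻ t, eLpNorm (v t) ⊤ volume ^ 4 ≠ ⊤ := by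
    rw [← eLpNorm_four_pow]
    exact ENNReal.pow_ne_top (ne_top_of_le_ne_top hN hv.four_le)
  filter_upwards [ae_lt_top ((hv.measurable ⊤).pow_const 4) h1] with t ht
  refine eLpNorm_lt_top_of_two_of_top (hv.aesm t) hr ((hv.two_le t).trans_lt hN.lt_top) ?_
  exact (ENNReal.pow_lt_top_iff.1 ht).resolve_right (by norm_num)

namespace SobolevStrichartz

variable {s : ℝ} {u : ℝ → ℝ → ℂ} {N : ℝ≥0∞}

theorem besselNorm_le (h : SobolevStrichartz s u N) (t : ℝ) : besselNorm s 2 (u t) ≤ N := by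
  obtain ⟨g, hg⟩ := h.exists_pair
  rw [besselNorm_two_eq (hg t).1 (hg t).2.1]
  exact (hg t).2.2

theorem sobolevNorm_bound (h : SobolevStrichartz s u N) (hs : s ≤ 1) (hN : N ≠ ⊤) {q r : ℝ≥0∞}
    (hqr : Admissible q r) :
    Measurable (fun t ↦ sobolevNorm s r (u t)) ∧
      eLpNorm (fun t ↦ sobolevNorm s r (u t)) q volume ≤ 2 * N := by
  have hr : 1 ≤ r := le_trans (by norm_num) hqr.2.1
  have hq : 1 ≤ q := le_trans (by norm_num) hqr.1
  rcases hs.lt_or_eq with hs1 | hs1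
  · obtain ⟨v, g, hv, hg⟩ := h.exists_bessel hs1
    have e : ∀ t, sobolevNorm s r (u t) =
        if eLpNorm (u t) r volume < ⊤ then eLpNorm (v t) r volume else ⊤ := fun t ↦ by
      rw [sobolevNorm, if_neg hs1.ne, besselNorm_eq_ite hr (hg t).1 (hg t).2]
    simp only [e]
    refine ⟨Measurable.ite (measurableSet_lt (h.bound.measurable r) measurable_const)
      (hv.measurable r) measurable_const, ?_⟩
    -- The curve lies in L^r for almost every time, so the value ∞ prescribed outside L^r does not
    -- affect the norm in time.
    have hae : (fun t ↦ if eLpNorm (u t) r volume < ⊤ then eLpNorm (v t) r volume else ⊤)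
        =ᵐ[volume] fun t ↦ eLpNorm (v t) r volume := by
      filter_upwards [h.bound.ae_eLpNorm_lt_top hN hqr.2.1] with t ht
      rw [if_pos ht]
    rw [eLpNorm_congr_ae hae]
    exact (hv.eLpNorm_le hqr).trans (by rw [two_mul]; exact le_self_add)
  · obtain ⟨v, hv, hd⟩ := h.exists_deriv hs1
    have e : ∀ t, sobolevNorm s r (u t) = eLpNorm (u t) r volume + eLpNorm (v t) r volume :=
      fun t ↦ by
        rw [sobolevNorm, if_pos hs1, firstOrderNorm_eq hr (h.bound.aesm t)
          ((hd t).1.locallyIntegrable (by norm_num)) (hd t).2]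
    simp only [e]
    refine ⟨(h.bound.measurable r).add (hv.measurable r), ?_⟩
    rw [two_mul]
    exact (eLpNorm_add_le (h.bound.measurable r).aestronglyMeasurable
      (hv.measurable r).aestronglyMeasurable hq).trans
      (add_le_add (h.bound.eLpNorm_le hqr) (hv.eLpNorm_le hqr))

end SobolevStrichartz

/-! ### The boundary integral operator and the final estimates -/

/-- The boundary integral operator satisfies the Strichartz estimates at the order `s`, in terms
of the weighted `L²` norm of the Laplace transform of the boundary data. -/
theorem exists_sobolevStrichartz_wBdr {s : ℝ} (h0 : 0 ≤ s) (h1 : s ≤ 1) :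
    ∃ C : ℝ≥0∞, C ≠ ⊤ ∧ ∀ h h' : ℝ → ℂ, IsFourierPair ((Ioi 0).indicator h) h' →
      MemLp (fun ξ ↦ bracket ((2 * s + 1) / 4) ξ * h' ξ) 2 volume →
      MemLp (nuOne h) 2 volume ∧ IsLaplaceDensity 0 (nuTwo h) ∧ SobolevStrichartz s (wBdr h)
        (C * eLpNorm (fun ξ ↦ bracket ((2 * s + 1) / 4) ξ * h' ξ) 2 volume) := by
  obtain ⟨C, hC, hlap⟩ := exists_sobolevStrichartz_laplaceEven (s := s)
  have hpi := Real.two_pi_pos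
  set P := ENNReal.ofReal (2 * Real.pi) with hP
  refine ⟨(2 * ENNReal.ofReal Real.pi * evolutionConst + C) * P,
    ENNReal.mul_ne_top (ENNReal.add_ne_top.2 ⟨ENNReal.mul_ne_top (by finiteness)
      evolutionConst_ne_top, hC⟩) (by finiteness), fun h h' hp hw ↦ ?_⟩
  set L := eLpNorm (fun τ ↦ bracket ((2 * s + 1) / 4) (τ / (2 * Real.pi)) * laplaceBdry h τ) 2
    volume with hL
  set W := eLpNorm (fun ξ ↦ bracket ((2 * s + 1) / 4) ξ * h' ξ) 2 volume with hW
  have hLW : L ≤ P * W := by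
    refine (ENNReal.pow_right_strictMono (n := 2) (by norm_num)).le_iff_le.1 ?_
    rw [hL, eLpNorm_bracket_laplaceBdry hp, mul_pow]
    refine mul_le_mul_left ?_ _
    -- The exact factor is √(2π); since 2π ≥ 1, the cruder factor 2π suffices.
    refine le_self_pow₀ ?_ two_ne_zero
    rw [ENNReal.one_le_ofReal]
    linarith [Real.pi_gt_three]
  have hL' : L < ⊤ := hLW.trans_lt (ENNReal.mul_lt_top ENNReal.ofReal_lt_top hw.2)
  have hm1 := measurable_nuOne h
  have hm2 := measurable_nuTwo h
  have hw1 : MemLp (fun β ↦ bracket s (β / (2 * Real.pi)) * nuOne h β) 2 volume :=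
    ⟨((continuous_bracket_div s).measurable.mul hm1).aestronglyMeasurable,
      (eLpNorm_nuOne_le h0 h1 h).trans_lt hL'⟩
  have hd2 : IsLaplaceDensity s (nuTwo h) :=
    ⟨h0, h1, hm2, fun β hβ ↦ squareDensity_of_nonpos _ hβ,
      ((continuous_bracket_div s).measurable.mul hm2).aestronglyMeasurable,
      (eLpNorm_nuTwo_le h0 h1 h).trans_lt hL'⟩
  refine ⟨memLp_of_memLp_bracket_mul h0 hm1.aestronglyMeasurable hw1, hd2.zero, ?_⟩
  have hsum := (sobolevStrichartz_planchIntegral h0 hm1 hw1).add (hlap _ hd2)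
  have hfun : wBdr h = fun t ↦ (planchIntegral fun β ↦ freePhase t β * nuOne h β) +
      laplaceEven fun β ↦ freePhase (-t) β * nuTwo h β := by
    funext t x
    rw [wBdr, wbOne_eq, wbTwo_eq, Pi.add_apply]
  rw [hfun]
  refine hsum.mono ?_
  calc _ ≤ 2 * ENNReal.ofReal Real.pi * evolutionConst * (P * W) + C * (P * W) := by
        gcongr
        · exact (eLpNorm_nuOne_le h0 h1 h).trans hLW
        · exact (eLpNorm_nuTwo_le h0 h1 h).trans hLW
    _ = _ := by ring

end HalfLineNLS

end

theorem proposition3p5 (s T : ℝ) (hs : 0 ≤ s) (hs' : s ≤ 1) (hs2 : s ≠ 1 / 2) (hT : 0 < T)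
    (q r : ℝ≥0∞) (hqr : HalfLineNLS.Admissible q r) :
    ∃ C : ℝ≥0, 0 < C ∧ ∀ h : ℝ → ℂ, HalfLineNLS.MemHZero ((2 * s + 1) / 4) h →
      -- the Strichartz bound in `L^q(0,T; W^{s,r}(ℝ))`
      (AEMeasurable (fun t => HalfLineNLS.sobolevNorm s r (HalfLineNLS.wBdr h t))
          (volume.restrict (Ioo 0 T)) ∧
        eLpNorm (fun t => HalfLineNLS.sobolevNorm s r (HalfLineNLS.wBdr h t)) q
            (volume.restrict (Ioo 0 T)) ≤
          C * HalfLineNLS.hNormOn ((2 * s + 1) / 4) (Ioi 0) h) ∧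
      -- the bound in `H^s(ℝ)`, uniform in time
      (⨆ t ∈ Ioo 0 T, HalfLineNLS.besselNorm s 2 (HalfLineNLS.wBdr h t)) ≤
          C * HalfLineNLS.hNormOn ((2 * s + 1) / 4) (Ioi 0) h ∧
      -- the bound of the temporal traces in `H^{(2s+1)/4}(0,T)`, uniform in space
      ∀ x : ℝ, ∃ g : ℝ → ℂ, HalfLineNLS.IsTemporalTrace T (HalfLineNLS.wBdr h) x g ∧
        HalfLineNLS.hNormOn ((2 * s + 1) / 4) (Ioo 0 T) g ≤
          C * HalfLineNLS.hNormOn ((2 * s + 1) / 4) (Ioi 0) h := by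
  obtain ⟨C₀, hC₀⟩ := HalfLineNLS.exists_eLpNorm_bracket_indicator_le (σ := (2 * s + 1) / 4)
    (by linarith) (by linarith) (fun e ↦ hs2 (by linarith))
  obtain ⟨C₁, hC₁, hW⟩ := HalfLineNLS.exists_sobolevStrichartz_wBdr hs hs'
  lift C₁ to ℝ≥0 using hC₁
  -- The first term serves the Strichartz bound (two summands at s = 1) and dominates the constant
  -- C₁C₀ of the H^s bound; C₀ serves the temporal traces, and 1 makes the constant positive.
  refine ⟨2 * C₁ * C₀ + C₀ + 1, by positivity, fun h hh ↦ ?_⟩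
  obtain ⟨h', hp, hle⟩ := hC₀ h hh
  set N := HalfLineNLS.hNormOn ((2 * s + 1) / 4) (Ioi 0) h
  set L := eLpNorm (fun ξ ↦ HalfLineNLS.bracket ((2 * s + 1) / 4) ξ * h' ξ) 2 volume
  have hL : L < ⊤ := hle.trans_lt (ENNReal.mul_lt_top ENNReal.coe_lt_top hh.1)
  have hw : MemLp (fun ξ ↦ HalfLineNLS.bracket ((2 * s + 1) / 4) ξ * h' ξ) 2 volume :=
    ⟨(Complex.continuous_ofReal.comp
      (HalfLineNLS.continuous_bracket _)).aestronglyMeasurable.mul hp.memLp_right.1, hL⟩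
  obtain ⟨h1, h2, hS⟩ := hW h h' hp hw
  have hfin : (C₁ : ℝ≥0∞) * L ≠ ⊤ := ENNReal.mul_ne_top ENNReal.coe_ne_top hL.ne
  have key {c : ℝ≥0} (hc : c * C₀ ≤ 2 * C₁ * C₀ + C₀ + 1) :
      (c : ℝ≥0∞) * L ≤ (2 * C₁ * C₀ + C₀ + 1 : ℝ≥0) * N :=
    calc (c : ℝ≥0∞) * L ≤ c * (C₀ * N) := by gcongr
      _ = (c * C₀ : ℝ≥0) * N := by rw [ENNReal.coe_mul, mul_assoc]
      _ ≤ _ := by gcongr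
  obtain ⟨hm, hb⟩ := hS.sobolevNorm_bound hs' hfin hqr
  refine ⟨⟨hm.aemeasurable, ?_⟩, ?_, fun x ↦ ?_⟩
  · refine ((eLpNorm_mono_measure _ Measure.restrict_le_self).trans hb).trans ?_
    have := key (c := 2 * C₁) (by rw [add_assoc]; exact le_self_add)
    rwa [ENNReal.coe_mul, ENNReal.coe_ofNat, mul_assoc] at this
  · refine iSup₂_le fun t _ ↦ (hS.besselNorm_le t).trans (key ?_)
    rw [← NNReal.coe_le_coe]
    push_cast
    have := mul_nonneg C₁.coe_nonneg C₀.coe_nonneg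
    linarith [C₀.coe_nonneg]
  · obtain ⟨g, hg, hgN⟩ := HalfLineNLS.exists_isTemporalTrace hp hw h1 h2 T x
    refine ⟨g, hg, (hgN _).trans ?_⟩
    have := key (c := 1) (by rw [one_mul, add_right_comm]; exact le_add_self)
    rwa [ENNReal.coe_one, one_mul] at this
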